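/- Consider the differential equation $y''=q_0y+q_1y'$ with $q_0,q_1\in\mathbb C(z)$, and let $S=\{t_1,\dots,t_r\}\subset\mathbb C$ be the set of its singular points in $\mathbb C$, that is, of the poles of $q_0$ and $q_1$. Assume that the equation is Fuchsian, i.e. every $t_i\in S$ is a regular singular point: $(z-t_i)q_1$ and $(z-t_i)^2q_0$ have no pole at $t_i$ (nothing is required at $\infty$). Assume moreover that it is generic: for each $t_i\in S$ the $\mathbb C$-vector space of its (possibly multivalued) solutions near $t_i$ has a basis $y_1,y_2$ such that $y_2$ extends holomorphically to $t_i$ and $y_1$ does not. Let $q_{0,n},q_{1,n}\in\mathbb C(z)$ be the rational functions with $y^{(n)}=q_{0,n}y+q_{1,n}y'$ obtained from the equation by repeated differentiation, i.e. $q_{0,0}=1$, $q_{1,0}=0$, $q_{0,n+1}=q_{0,n}'+q_{1,n}q_0$, $q_{1,n+1}=q_{0,n}+q_{1,n}'+q_{1,n}q_1$. Fix $t_i\in S$ and let $U_i=\{z\in\mathbb C : |z-t_i|<|z-t_j| \text{ for all } j\ne i\}$ be its Voronoi cell. Then the equation has a solution $y_2\not\equiv0$ that is holomorphic on all of $U_i$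 (including $t_i$), and it is unique up to multiplication by a constant. The rational function $q_{1,n}$ is nonzero for all large $n$, and $$\frac{q_{0,n}}{q_{1,n}}\longrightarrow-\frac{y_2'}{y_2}\qquad(n\to\infty)$$ uniformly on compact subsets of $U_i$. Here uniform convergence of rational functions to a meromorphic function means: uniformly in the chordal metric of the Riemann sphere on every compact $K\subset U_i$; and, on every compact $K\subset U_i$ containing no zero of $y_2$, the functions have no poles on $K$ for large $n$ and converge uniformly in the usual sense. Equivalently, let $a_{1,n},a_{2,n}\in\mathbb C(z)$, $n\ge0$, be any rational functions such that every local solution $y$ satisfies $x_n=a_{1,n}x_{n+1}+a_{2,n}x_{n+2}$ for all $n\ge0$, where $x_n=y^{(n)}/n!$. Then for all $n\ge 1$ the finite continued fraction $$\cfrac{1}{a_{1,0}+\cfrac{a_{2,0}}{a_{1,1}+\cfrac{\ddots}{a_{1,n-2}}}}$$ (the convergent given by the usual three-term recurrences for numerators and denominators, and equal to $0$ for $n=1$) equals $-q_{0,n}/q_{1,n}$ (when $q_{1,n}=0$ the denominator of the convergent vanishes too), and as $n\to\infty$ these fractions converge to $y_2'/y_2$ uniformly on compact subsets of $U_i$ in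 the same sense. -/

import Mathlib

open Filter Topology

noncomputable section

namespace Perron

/-- `z` is a pole of the rational function `q` (written in lowest terms). -/
def IsPole (q : RatFunc ℂ) (z : ℂ) : Prop := q.denom.eval z = 0

/-- The value of a rational function at a point. -/
def value (q : RatFunc ℂ) (z : ℂ) : ℂ := q.eval (RingHom.id ℂ) z

open Classical in
/-- The value of a rational function, seen as a map to the Riemann sphere `ℂ ∪ {∞}`. -/
def sphereValue (q : RatFunc ℂ) (z : ℂ) : OnePoint ℂ :=
  if IsPole q z then OnePoint.infty else OnePoint.some (value q z)

/-- The derivative `d/dz` on `ℂ(z)`, by the quotient rule. -/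
def ratDeriv (q : RatFunc ℂ) : RatFunc ℂ :=
  algebraMap (Polynomial ℂ) (RatFunc ℂ)
      (Polynomial.derivative q.num * q.denom - q.num * Polynomial.derivative q.denom) /
    algebraMap (Polynomial ℂ) (RatFunc ℂ) (q.denom ^ 2)

/-- The singular points in `ℂ` of `y'' = q₀ y + q₁ y'`: the poles of the coefficients. -/
def singularSet (q₀ q₁ : RatFunc ℂ) : Set ℂ := {z | IsPole q₀ z ∨ IsPole q₁ z}

/-- Every singular point `t` in `ℂ` of `y'' = q₀ y + q₁ y'` is a regular singular point:
`(z - t) q₁` and `(z - t)² q₀` have no pole at `t`. Nothing is asked at infinity. -/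
def IsFuchsian (q₀ q₁ : RatFunc ℂ) : Prop :=
  ∀ t ∈ singularSet q₀ q₁,
    ¬ IsPole ((RatFunc.X - RatFunc.C t) * q₁) t ∧
    ¬ IsPole ((RatFunc.X - RatFunc.C t) ^ 2 * q₀) t

/-- `y` is a holomorphic solution of `y'' = q₀ y + q₁ y'` on the open set `V`. If `V` contains
singular points, `y` is holomorphic there too, and the equation is asked for off them. -/
def IsSolutionOn (q₀ q₁ : RatFunc ℂ) (V : Set ℂ) (y : ℂ → ℂ) : Prop :=
  DifferentiableOn ℂ y V ∧
    ∀ z ∈ V, z ∉ singularSet q₀ q₁ →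
      deriv (deriv y) z = value q₀ z * y z + value q₁ z * deriv y z

/-- The disc of centre `t` and radius `ε`, cut along a radius. -/
def slitDisc (t : ℂ) (ε : ℝ) : Set ℂ := {z | ‖z - t‖ < ε ∧ z - t ∈ Complex.slitPlane}

/-- `y₁, y₂` is a basis of the `ℂ`-vector space of the solutions on `V`. -/
def IsSolutionBasisOn (q₀ q₁ : RatFunc ℂ) (V : Set ℂ) (y₁ y₂ : ℂ → ℂ) : Prop :=
  IsSolutionOn q₀ q₁ V y₁ ∧ IsSolutionOn q₀ q₁ V y₂ ∧
  (∀ c₁ c₂ : ℂ, (∀ z ∈ V, c₁ * y₁ z + c₂ * y₂ z = 0) → c₁ = 0 ∧ c₂ = 0) ∧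
  (∀ y : ℂ → ℂ, IsSolutionOn q₀ q₁ V y →
    ∃ c₁ c₂ : ℂ, ∀ z ∈ V, y z = c₁ * y₁ z + c₂ * y₂ z)

/-- `y`, given on the slit disc, extends holomorphically to the whole disc. -/
def ExtendsToDisc (t : ℂ) (ε : ℝ) (y : ℂ → ℂ) : Prop :=
  ∃ g : ℂ → ℂ, DifferentiableOn ℂ g (Metric.ball t ε) ∧ Set.EqOn g y (slitDisc t ε)

/-- The equation is generic: near each singular point `t` in `ℂ` there is a basis `y₁, y₂` of the
space of (branches of) solutions such that `y₂` extends holomorphically to `t`, `y₁` does not. -/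
def IsGeneric (q₀ q₁ : RatFunc ℂ) : Prop :=
  ∀ t ∈ singularSet q₀ q₁, ∃ ε : ℝ, 0 < ε ∧
    (∀ s ∈ singularSet q₀ q₁, s ∈ Metric.ball t ε → s = t) ∧
    ∃ y₁ y₂ : ℂ → ℂ, IsSolutionBasisOn q₀ q₁ (slitDisc t ε) y₁ y₂ ∧
      ExtendsToDisc t ε y₂ ∧ ¬ ExtendsToDisc t ε y₁

/-- The open Voronoi cell of `t` with respect to `S`. -/
def voronoiCell (S : Set ℂ) (t : ℂ) : Set ℂ := {z | ∀ s ∈ S, s ≠ t → ‖z - t‖ < ‖z - s‖}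

/-- The pair `(q_{0,n}, q_{1,n})` with `y^{(n)} = q_{0,n} y + q_{1,n} y'`, obtained by
differentiating `n` times and replacing `y''` by `q₀ y + q₁ y'`. -/
def derivCoeff (q₀ q₁ : RatFunc ℂ) : ℕ → RatFunc ℂ × RatFunc ℂ
  | 0 => (1, 0)
  | n + 1 =>
    (ratDeriv (derivCoeff q₀ q₁ n).1 + (derivCoeff q₀ q₁ n).2 * q₀,
      (derivCoeff q₀ q₁ n).1 + ratDeriv (derivCoeff q₀ q₁ n).2 + (derivCoeff q₀ q₁ n).2 * q₁)

/-- The chordal distance on the Riemann sphere. -/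
def chordalDist : OnePoint ℂ → OnePoint ℂ → ℝ
  | OnePoint.some z, OnePoint.some w =>
      2 * ‖z - w‖ / (Real.sqrt (1 + ‖z‖ ^ 2) * Real.sqrt (1 + ‖w‖ ^ 2))
  | OnePoint.some z, OnePoint.infty => 2 / Real.sqrt (1 + ‖z‖ ^ 2)
  | OnePoint.infty, OnePoint.some w => 2 / Real.sqrt (1 + ‖w‖ ^ 2)
  | OnePoint.infty, OnePoint.infty => 0

open Classical in
/-- The rational functions `R n` converge, uniformly on compact subsets of `U`, to the meromorphic
function `f` with set of poles `P`: in the chordal distance on every compact subset of `U`, and in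
the usual sense on the compact subsets of `U` that avoid `P`, where `R n` has no poles for
large `n`. -/
structure ConvergesOnCompacts (R : ℕ → RatFunc ℂ) (f : ℂ → ℂ) (P U : Set ℂ) : Prop where
  spherical : ∀ K ⊆ U, IsCompact K → ∀ ε > 0, ∀ᶠ n in atTop, ∀ z ∈ K,
    chordalDist (sphereValue (R n) z)
      (if z ∈ P then OnePoint.infty else OnePoint.some (f z)) < ε
  usual : ∀ K ⊆ U, IsCompact K → Disjoint K P →
    (∀ᶠ n in atTop, ∀ z ∈ K, ¬ IsPole (R n) z) ∧
    TendstoUniformlyOn (fun n z => value (R n) z) f atTop K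

/-- `x_n = a_{1,n} x_{n+1} + a_{2,n} x_{n+2}` holds with `x_n = y^{(n)} / n!`, for every local
solution `y` of `y'' = q₀ y + q₁ y'` and every `n`, wherever the coefficients have no pole. -/
def IsRecurrence (q₀ q₁ : RatFunc ℂ) (a₁ a₂ : ℕ → RatFunc ℂ) : Prop :=
  ∀ (V : Set ℂ) (y : ℂ → ℂ), IsOpen V → Disjoint V (singularSet q₀ q₁) →
    IsSolutionOn q₀ q₁ V y →
    ∀ (n : ℕ), ∀ z ∈ V, ¬ IsPole (a₁ n) z → ¬ IsPole (a₂ n) z →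
      iteratedDeriv n y z / (n.factorial : ℂ) =
        value (a₁ n) z * (iteratedDeriv (n + 1) y z / ((n + 1).factorial : ℂ)) +
        value (a₂ n) z * (iteratedDeriv (n + 2) y z / ((n + 2).factorial : ℂ))

/-- The continued fraction `1 / (a_{1,0} + a_{2,0} / (a_{1,1} + a_{2,1} / (a_{1,2} + ⋯)))`
over `ℂ(z)`. -/
def perronFraction (a₁ a₂ : ℕ → RatFunc ℂ) : GenContFract (RatFunc ℂ) where
  h := 0
  s := Stream'.Seq.ofStream fun n =>
    ⟨match n with
      | 0 => 1
      | k + 1 => a₂ k, a₁ n⟩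

end Perron

end

namespace Perron

/-! ### Values and derivatives of rational functions -/

/-! The quotient converges because the holomorphic solution has much smaller derivatives than a
solution singular at `t`. In homogeneous coordinates the chordal distance between `[q_{0,n} :
q_{1,n}]` and `[-y₂' : y₂]` at `z` is twice `|q_{0,n} y₂ + q_{1,n} y₂'| = |y₂^{(n)}|` divided by the
norms of the two pairs. It must be shown that `y₂^{(n)}(z)` is negligible against the norm of
`(q_{0,n}, q_{1,n})(z)`; this reduction is `converges_of_iteratedDeriv_small`.

Upper bound. The solution `y₂` extends from a disc about `t` to the star domain of `t`. For `z` in a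
compact subset of the Voronoi cell this contains the disc of radius `|z - t| + η` about `z`, so
Cauchy's estimate gives `y₂^{(n)}(z) = O(n! (|z - t| + η)^{-n})`.

Lower bound. Reduction of order produces a second solution `(w - t)^s H + c g log (w - t)`;
genericity ensures that it is truly singular at `t` (`exists_second_solution`,
`exists_singular_solution`). After finitely many derivatives it looks like `(w - t)^{-P}` with `Re P
≥ 3`. By a Darboux argument, its further derivatives at `z` are at least of order `n! |z - t|^{-n}`,
up to fixed powers of `|z - t|` (`HasSingularForm.exists_le_norm_iteratedDeriv`). They are
combinations of `q_{0,n}` and `q_{1,n}` with controlled coefficients, so the pair is at least that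
large (`exists_le_coeffNorm`). The geometric gain `(|z - t| / (|z - t| + η))^n` then beats every
power of `n`.

Two points need care. The singular solution is multivalued, so slit planes in four directions are
used, each serving one sector of centres `z`. All bounds degenerate by powers of `|z - t|`; they are
kept uniform on `z ≠ t`, and `t` itself follows by continuity of the chordal distance.

The continued fraction is pure algebra: since initial values are arbitrary, the recurrence for
solutions is a recurrence for the coefficients, and the convergents are solved from it by Cramer's
rule. -/

theorem not_isPole_of_denom_dvd {q : RatFunc ℂ} {p : Polynomial ℂ} {z : ℂ} (h : q.denom ∣ p)
    (hp : p.eval z ≠ 0) : ¬ IsPole q z := by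
  obtain ⟨r, rfl⟩ := h
  intro hq
  exact hp (by rw [Polynomial.eval_mul, hq, zero_mul])

theorem not_isPole_add {p q : RatFunc ℂ} {z : ℂ} (hp : ¬ IsPole p z) (hq : ¬ IsPole q z) :
    ¬ IsPole (p + q) z :=
  not_isPole_of_denom_dvd (RatFunc.denom_add_dvd p q)
    (by rw [Polynomial.eval_mul]; exact mul_ne_zero hp hq)

theorem not_isPole_mul {p q : RatFunc ℂ} {z : ℂ} (hp : ¬ IsPole p z) (hq : ¬ IsPole q z) :
    ¬ IsPole (p * q) z :=
  not_isPole_of_denom_dvd (RatFunc.denom_mul_dvd p q)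
    (by rw [Polynomial.eval_mul]; exact mul_ne_zero hp hq)

theorem not_isPole_zero (z : ℂ) : ¬ IsPole 0 z := by simp [IsPole]

theorem not_isPole_one (z : ℂ) : ¬ IsPole 1 z := by simp [IsPole]

theorem not_isPole_C (c z : ℂ) : ¬ IsPole (RatFunc.C c) z := by simp [IsPole]

theorem not_isPole_X (z : ℂ) : ¬ IsPole RatFunc.X z := by simp [IsPole]

theorem not_isPole_ratDeriv {q : RatFunc ℂ} {z : ℂ} (hq : ¬ IsPole q z) :
    ¬ IsPole (ratDeriv q) z :=
  not_isPole_of_denom_dvd (RatFunc.denom_div_dvd _ _)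
    (by rw [Polynomial.eval_pow]; exact pow_ne_zero 2 hq)

theorem value_eq (q : RatFunc ℂ) (z : ℂ) : value q z = q.num.eval z / q.denom.eval z := rfl

theorem value_add {p q : RatFunc ℂ} {z : ℂ} (hp : ¬ IsPole p z) (hq : ¬ IsPole q z) :
    value (p + q) z = value p z + value q z :=
  RatFunc.eval_add _ _ hp hq

theorem value_mul {p q : RatFunc ℂ} {z : ℂ} (hp : ¬ IsPole p z) (hq : ¬ IsPole q z) :
    value (p * q) z = value p z * value q z :=
  RatFunc.eval_mul _ _ hp hq

@[simp] theorem value_zero (z : ℂ) : value 0 z = 0 := RatFunc.eval_zero _ _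

@[simp] theorem value_one (z : ℂ) : value 1 z = 1 := RatFunc.eval_one _ _

@[simp] theorem value_C (c z : ℂ) : value (RatFunc.C c) z = c := by simp [value]

@[simp] theorem value_X (z : ℂ) : value RatFunc.X z = z := by simp [value]

theorem value_algebraMap (p : Polynomial ℂ) (z : ℂ) :
    value (algebraMap (Polynomial ℂ) (RatFunc ℂ) p) z = p.eval z := by
  simp [value_eq]

theorem not_isPole_algebraMap (p : Polynomial ℂ) (z : ℂ) :
    ¬ IsPole (algebraMap (Polynomial ℂ) (RatFunc ℂ) p) z := by
  simp [IsPole]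

/-- The fraction need not be in lowest terms, so the value is obtained by multiplying back by `q`.
-/
theorem value_algebraMap_div (p : Polynomial ℂ) {q : Polynomial ℂ} {z : ℂ} (hq : q.eval z ≠ 0) :
    value (algebraMap (Polynomial ℂ) (RatFunc ℂ) p / algebraMap (Polynomial ℂ) (RatFunc ℂ) q) z =
      p.eval z / q.eval z := by
  have hq0 : q ≠ 0 := by rintro rfl; simp at hq
  have h : algebraMap (Polynomial ℂ) (RatFunc ℂ) p / algebraMap (Polynomial ℂ) (RatFunc ℂ) q *
      algebraMap (Polynomial ℂ) (RatFunc ℂ) q = algebraMap (Polynomial ℂ) (RatFunc ℂ) p :=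
    div_mul_cancel₀ _ (by simpa using hq0)
  have h2 := congrArg (fun f => value f z) h
  rw [value_mul (not_isPole_of_denom_dvd (RatFunc.denom_div_dvd _ _) hq)
    (not_isPole_algebraMap _ _), value_algebraMap, value_algebraMap] at h2
  rw [eq_div_iff hq, h2]

theorem hasDerivAt_value {q : RatFunc ℂ} {z : ℂ} (hq : ¬ IsPole q z) :
    HasDerivAt (value q) (value (ratDeriv q) z) z := by
  have h := (q.num.hasDerivAt z).div (q.denom.hasDerivAt z) hq
  have h2 : value (ratDeriv q) z = _ := value_algebraMap_div _
    (by rw [Polynomial.eval_pow]; exact pow_ne_zero 2 hq)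
  rw [h2]
  convert! h using 1
  simp

theorem differentiableAt_value {q : RatFunc ℂ} {z : ℂ} (hq : ¬ IsPole q z) :
    DifferentiableAt ℂ (value q) z := (hasDerivAt_value hq).differentiableAt

theorem finite_setOf_isPole (q : RatFunc ℂ) : {z | IsPole q z}.Finite := by
  refine (q.denom.roots.toFinset.finite_toSet).subset fun z hz => ?_
  simpa [RatFunc.denom_ne_zero, IsPole] using hz

theorem finite_singularSet (q₀ q₁ : RatFunc ℂ) : (singularSet q₀ q₁).Finite :=
  ((finite_setOf_isPole q₀).union (finite_setOf_isPole q₁)).subset fun _ hz => hz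

theorem isOpen_compl_singularSet (q₀ q₁ : RatFunc ℂ) : IsOpen (singularSet q₀ q₁)ᶜ :=
  (finite_singularSet q₀ q₁).isClosed.isOpen_compl

theorem num_eval_ne_zero_of_isPole {q : RatFunc ℂ} {z : ℂ} (h : q.denom.eval z = 0) :
    q.num.eval z ≠ 0 := by
  intro h0
  obtain ⟨a, b, hab⟩ := RatFunc.isCoprime_num_denom q
  have := congrArg (Polynomial.eval z) hab
  simp [h, h0] at this

/-- A rational function vanishing outside a finite set is zero. -/
theorem eq_zero_of_value_eq_zero {q : RatFunc ℂ} {F : Set ℂ} (hF : F.Finite)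
    (h : ∀ z, z ∉ F → value q z = 0) : q = 0 := by
  rw [← RatFunc.num_eq_zero_iff]
  refine Polynomial.eq_zero_of_infinite_isRoot _ ?_
  refine Set.Infinite.mono (s := (F ∪ {z | IsPole q z})ᶜ) (fun z hz => ?_)
    (hF.union (finite_setOf_isPole q)).infinite_compl
  simp only [Set.mem_compl_iff, Set.mem_union, not_or] at hz
  have h1 := h z hz.1
  rw [value_eq, div_eq_zero_iff] at h1
  exact h1.resolve_right hz.2

theorem not_isPole_neg {q : RatFunc ℂ} {z : ℂ} (hq : ¬ IsPole q z) : ¬ IsPole (-q) z := by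
  have : -q = RatFunc.C (-1) * q := by simp
  rw [this]
  exact not_isPole_mul (not_isPole_C _ _) hq

theorem value_neg {q : RatFunc ℂ} {z : ℂ} (hq : ¬ IsPole q z) : value (-q) z = -value q z := by
  have : -q = RatFunc.C (-1) * q := by simp
  rw [this, value_mul (not_isPole_C _ _) hq, value_C]
  simp

/-- The cross-multiplied form stays meaningful where `b` vanishes at `z`; it identifies the
homogeneous coordinates of `a / b` with the pair of values of `a` and `b`. -/
theorem num_eval_mul_value_of_div {a b : RatFunc ℂ} {z : ℂ} (hb : b ≠ 0) (ha' : ¬ IsPole a z)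
    (hb' : ¬ IsPole b z) :
    (a / b).num.eval z * value b z = (a / b).denom.eval z * value a z := by
  have h : algebraMap (Polynomial ℂ) (RatFunc ℂ) (a / b).num * b =
      algebraMap (Polynomial ℂ) (RatFunc ℂ) (a / b).denom * a := by
    have h1 := RatFunc.num_div_denom (a / b)
    have h2 : algebraMap (Polynomial ℂ) (RatFunc ℂ) (a / b).denom ≠ 0 := by
      simpa using RatFunc.denom_ne_zero _
    rw [div_eq_div_iff h2 hb] at h1
    rw [h1, mul_comm]
  have h3 := congrArg (fun f => value f z) h
  rwa [value_mul (not_isPole_algebraMap _ _) hb', value_mul (not_isPole_algebraMap _ _) ha',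
    value_algebraMap, value_algebraMap] at h3

/-! ### The coefficients of the higher derivatives -/

theorem not_isPole_derivCoeff {q₀ q₁ : RatFunc ℂ} {z : ℂ} (hz : z ∉ singularSet q₀ q₁) (n : ℕ) :
    ¬ IsPole (derivCoeff q₀ q₁ n).1 z ∧ ¬ IsPole (derivCoeff q₀ q₁ n).2 z := by
  have h0 : ¬ IsPole q₀ z := fun h => hz (Or.inl h)
  have h1 : ¬ IsPole q₁ z := fun h => hz (Or.inr h)
  induction n with
  | zero => exact ⟨not_isPole_one z, not_isPole_zero z⟩
  | succ n ih =>
    exact ⟨not_isPole_add (not_isPole_ratDeriv ih.1) (not_isPole_mul ih.2 h0),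
      not_isPole_add (not_isPole_add ih.1 (not_isPole_ratDeriv ih.2)) (not_isPole_mul ih.2 h1)⟩

theorem IsSolutionOn.iteratedDeriv_eq {q₀ q₁ : RatFunc ℂ} {V : Set ℂ} {y : ℂ → ℂ}
    (hV : IsOpen V) (hy : IsSolutionOn q₀ q₁ V y) (n : ℕ) {z : ℂ} (hz : z ∈ V)
    (hzS : z ∉ singularSet q₀ q₁) :
    iteratedDeriv n y z =
      value (derivCoeff q₀ q₁ n).1 z * y z + value (derivCoeff q₀ q₁ n).2 z * deriv y z := by
  induction n generalizing z with
  | zero => simp [derivCoeff]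
  | succ n ih =>
    have hev : iteratedDeriv n y =ᶠ[𝓝 z] fun w =>
        value (derivCoeff q₀ q₁ n).1 w * y w + value (derivCoeff q₀ q₁ n).2 w * deriv y w := by
      filter_upwards [hV.mem_nhds hz, (isOpen_compl_singularSet q₀ q₁).mem_nhds hzS] with w hw hwS
      exact ih hw hwS
    rw [iteratedDeriv_succ, hev.deriv_eq]
    obtain ⟨ha, hb⟩ := not_isPole_derivCoeff hzS n
    have h0 : ¬ IsPole q₀ z := fun h => hzS (Or.inl h)
    have h1 : ¬ IsPole q₁ z := fun h => hzS (Or.inr h)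
    have hd : HasDerivAt y (deriv y z) z :=
      (hy.1.differentiableAt (hV.mem_nhds hz)).hasDerivAt
    have hdd : HasDerivAt (deriv y) (deriv (deriv y) z) z :=
      ((hy.1.deriv hV).differentiableAt (hV.mem_nhds hz)).hasDerivAt
    refine (((hasDerivAt_value ha).mul hd).add ((hasDerivAt_value hb).mul hdd)).deriv.trans ?_
    have e1 : value (derivCoeff q₀ q₁ (n + 1)).1 z =
        value (ratDeriv (derivCoeff q₀ q₁ n).1) z + value (derivCoeff q₀ q₁ n).2 z * value q₀ z := by
      rw [← value_mul hb h0, ← value_add (not_isPole_ratDeriv ha) (not_isPole_mul hb h0)]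
      rfl
    have e2 : value (derivCoeff q₀ q₁ (n + 1)).2 z =
        value (derivCoeff q₀ q₁ n).1 z + value (ratDeriv (derivCoeff q₀ q₁ n).2) z +
          value (derivCoeff q₀ q₁ n).2 z * value q₁ z := by
      rw [← value_mul hb h1, ← value_add ha (not_isPole_ratDeriv hb),
        ← value_add (not_isPole_add ha (not_isPole_ratDeriv hb)) (not_isPole_mul hb h1)]
      rfl
    rw [e1, e2, hy.2 z hz hzS]
    ring

end Perron

namespace Perron

/-! ### Linear equations of second order on convex sets -/

/-- Integration along the segment from `p` to `w`. The factor `1 / (k + 1)` gained here builds up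
the factorials in the Picard iteration. -/
theorem norm_le_of_norm_deriv_le_pow {V : Set ℂ} (hc : Convex ℝ V) {p : ℂ} (hp : p ∈ V)
    {f F : ℂ → ℂ} (hF : ∀ w ∈ V, HasDerivAt F (f w) w) (hFp : F p = 0) {C : ℝ} {k : ℕ}
    (hfC : ∀ w ∈ V, ‖f w‖ ≤ C * ‖w - p‖ ^ k) {w : ℂ} (hw : w ∈ V) :
    ‖F w‖ ≤ C * ‖w - p‖ ^ (k + 1) / (k + 1) := by
  have hmem : ∀ s ∈ Set.Icc (0 : ℝ) 1, p + s * (w - p) ∈ V := by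
    intro s hs
    have := hc.add_smul_sub_mem hp hw hs
    simpa using this
  have hder : ∀ s ∈ Set.Icc (0 : ℝ) 1,
      HasDerivAt (fun s : ℝ => F (p + s * (w - p))) (f (p + s * (w - p)) * (w - p)) s := by
    intro s hs
    have h1 : HasDerivAt (fun s : ℝ => p + (s : ℂ) * (w - p)) (w - p) s := by
      simpa using ((Complex.ofRealCLM.hasDerivAt (x := s)).mul_const (w - p)).const_add p
    exact (hF _ (hmem s hs)).comp s h1
  have key := image_norm_le_of_norm_deriv_right_le_deriv_boundary' (a := 0) (b := 1)
    (f := fun s : ℝ => F (p + s * (w - p))) (f' := fun s : ℝ => f (p + s * (w - p)) * (w - p))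
    (B := fun s : ℝ => C * ‖w - p‖ ^ (k + 1) / (k + 1) * s ^ (k + 1))
    (B' := fun s : ℝ => C * ‖w - p‖ ^ (k + 1) * s ^ k)
    (fun s hs => (hder s hs).continuousAt.continuousWithinAt)
    (fun s hs => (hder s ⟨hs.1, hs.2.le⟩).hasDerivWithinAt) (by simp [hFp])
    (by fun_prop)
    (fun s _ => by
      have := ((hasDerivAt_pow (k + 1) s).const_mul (C * ‖w - p‖ ^ (k + 1) / (k + 1)))
      convert! this.hasDerivWithinAt using 1
      have : (k : ℝ) + 1 ≠ 0 := by positivity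
      push_cast
      field_simp)
    (fun s hs => by
      rw [norm_mul]
      have h2 := hfC _ (hmem s ⟨hs.1, hs.2.le⟩)
      have h3 : ‖p + (s : ℂ) * (w - p) - p‖ = s * ‖w - p‖ := by
        rw [add_sub_cancel_left, norm_mul, Complex.norm_real, Real.norm_of_nonneg hs.1]
      rw [h3, mul_pow] at h2
      calc _ ≤ C * (s ^ k * ‖w - p‖ ^ k) * ‖w - p‖ := by gcongr
        _ = _ := by ring)
    (Set.right_mem_Icc.2 zero_le_one)
  simpa using key

/-- Picard iteration for the system `u' = v`, `v' = f u + g v`, summed as a series of increments.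
Convexity gives primitives on all of `V`, and the factorial bounds make the series converge there,
not only near `p`. -/
theorem exists_linear_ode_solution_of_convex {V : Set ℂ} (hV : IsOpen V) (hc : Convex ℝ V) {p : ℂ}
    (hp : p ∈ V) {f g : ℂ → ℂ} (hf : DifferentiableOn ℂ f V) (hg : DifferentiableOn ℂ g V)
    {M D : ℝ} (hfM : ∀ w ∈ V, ‖f w‖ ≤ M) (hgM : ∀ w ∈ V, ‖g w‖ ≤ M) (hD : ∀ w ∈ V, ‖w - p‖ ≤ D)
    (a b : ℂ) :
    ∃ u v : ℂ → ℂ, (∀ w ∈ V, HasDerivAt u (v w) w) ∧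
      (∀ w ∈ V, HasDerivAt v (f w * u w + g w * v w) w) ∧ u p = a ∧ v p = b := by
  have hM : 0 ≤ M := (norm_nonneg _).trans (hfM p hp)
  -- Stated for every `h`, holomorphic or not, so that choice yields a total operator to iterate.
  have prim : ∀ h : ℂ → ℂ, ∃ F : ℂ → ℂ, DifferentiableOn ℂ h V →
      (∀ w ∈ V, HasDerivAt F (h w) w) ∧ F p = 0 := by
    intro h
    by_cases hh : DifferentiableOn ℂ h V
    · obtain ⟨F, hF⟩ := hc.exists_forall_hasDerivWithinAt hh
      exact ⟨fun w => F w - F p, fun _ =>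
        ⟨fun w hw => ((hF w hw).hasDerivAt (hV.mem_nhds hw)).sub_const _, sub_self _⟩⟩
    · exact ⟨0, fun h' => absurd h' hh⟩
  choose P hP using prim
  let s : ℕ → (ℂ → ℂ) × (ℂ → ℂ) := fun n =>
    Nat.rec (fun _ => a, fun _ => b) (fun _ s => (P s.2, P (fun w => f w * s.1 w + g w * s.2 w))) n
  have hs1 : ∀ n, (s (n + 1)).1 = P (s n).2 := fun _ => rfl
  have hs2 : ∀ n, (s (n + 1)).2 = P (fun w => f w * (s n).1 w + g w * (s n).2 w) := fun _ => rfl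
  have hs01 : (s 0).1 = fun _ => a := rfl
  have hs02 : (s 0).2 = fun _ => b := rfl
  clear_value s
  have hdiff : ∀ n, DifferentiableOn ℂ (s n).1 V ∧ DifferentiableOn ℂ (s n).2 V := by
    intro n
    induction n with
    | zero => rw [hs01, hs02]; exact ⟨differentiableOn_const _, differentiableOn_const _⟩
    | succ n ih =>
      rw [hs1, hs2]
      exact ⟨fun w hw => ((hP _ ih.2).1 w hw).differentiableAt.differentiableWithinAt,
        fun w hw => ((hP _ ((hf.mul ih.1).add (hg.mul ih.2))).1 w hw
          ).differentiableAt.differentiableWithinAt⟩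
  have hd1 : ∀ n, ∀ w ∈ V, HasDerivAt (s (n + 1)).1 ((s n).2 w) w := fun n w hw => by
    rw [hs1]; exact (hP _ (hdiff n).2).1 w hw
  have hd2 : ∀ n, ∀ w ∈ V, HasDerivAt (s (n + 1)).2 (f w * (s n).1 w + g w * (s n).2 w) w :=
    fun n w hw => by rw [hs2]; exact (hP _ ((hf.mul (hdiff n).1).add (hg.mul (hdiff n).2))).1 w hw
  have hp1 : ∀ n, (s (n + 1)).1 p = 0 := fun n => by rw [hs1]; exact (hP _ (hdiff n).2).2
  have hp2 : ∀ n, (s (n + 1)).2 p = 0 :=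
    fun n => by rw [hs2]; exact (hP _ ((hf.mul (hdiff n).1).add (hg.mul (hdiff n).2))).2
  -- `2 * M` absorbs the two terms of `f u + g v`; the extra `1` gives `N ≥ 1`, as needed for `u' =
  -- v`.
  set N : ℝ := 2 * M + 1 with hN
  set C : ℝ := ‖a‖ + ‖b‖ with hC
  have hbound : ∀ n, ∀ w ∈ V, ‖(s n).1 w‖ ≤ C * N ^ n / n.factorial * ‖w - p‖ ^ n ∧
      ‖(s n).2 w‖ ≤ C * N ^ n / n.factorial * ‖w - p‖ ^ n := by
    intro n
    induction n with
    | zero => intro w _; simp [hs01, hs02, hC]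
    | succ n ih =>
      have hCn : 0 ≤ C * N ^ n / n.factorial := by positivity
      have e : ∀ w, C * N ^ n / n.factorial * N * ‖w - p‖ ^ (n + 1) / (n + 1) =
          C * N ^ (n + 1) / (n + 1).factorial * ‖w - p‖ ^ (n + 1) := by
        intro w
        rw [Nat.factorial_succ]
        push_cast
        field_simp
        ring
      intro w hw
      rw [← e]
      constructor
      · refine norm_le_of_norm_deriv_le_pow hc hp (hd1 n) (hp1 n) (fun z hz => ?_) hw
        refine (ih z hz).2.trans ?_
        gcongr
        rw [hN]
        nlinarith
      · refine norm_le_of_norm_deriv_le_pow hc hp (hd2 n) (hp2 n) (fun z hz => ?_) hw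
        have h1 := (ih z hz).1
        have h2 := (ih z hz).2
        set T := C * N ^ n / n.factorial * ‖z - p‖ ^ n with hT
        have hT0 : 0 ≤ T := by positivity
        calc _ ≤ ‖f z‖ * ‖(s n).1 z‖ + ‖g z‖ * ‖(s n).2 z‖ := by
              rw [← norm_mul, ← norm_mul]; exact norm_add_le _ _
          _ ≤ M * T + M * T := by
              gcongr
              · exact hfM z hz
              · exact hgM z hz
          _ ≤ T * N := by rw [hN]; nlinarith
          _ = _ := by rw [hT]; ring
  have hsum : Summable fun n : ℕ => C * ((N * D) ^ n / n.factorial) :=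
    (Real.summable_pow_div_factorial _).mul_left C
  have hle : ∀ n, ∀ w ∈ V, C * N ^ n / n.factorial * ‖w - p‖ ^ n ≤
      C * ((N * D) ^ n / n.factorial) := by
    intro n w hw
    have h1 : ‖w - p‖ ^ n ≤ D ^ n := pow_le_pow_left₀ (norm_nonneg _) (hD w hw) n
    calc _ ≤ C * N ^ n / n.factorial * D ^ n := by gcongr
      _ = _ := by rw [mul_pow]; ring
  have hb1 : ∀ n, ∀ w ∈ V, ‖(s n).1 w‖ ≤ C * ((N * D) ^ n / n.factorial) :=
    fun n w hw => ((hbound n w hw).1).trans (hle n w hw)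
  have hb2 : ∀ n, ∀ w ∈ V, ‖(s n).2 w‖ ≤ C * ((N * D) ^ n / n.factorial) :=
    fun n w hw => ((hbound n w hw).2).trans (hle n w hw)
  have hS1 : ∀ w ∈ V, Summable fun n => (s n).1 w :=
    fun w hw => Summable.of_norm_bounded hsum fun n => hb1 n w hw
  have hS2 : ∀ w ∈ V, Summable fun n => (s n).2 w :=
    fun w hw => Summable.of_norm_bounded hsum fun n => hb2 n w hw
  refine ⟨fun w => ∑' n, (s n).1 w, fun w => ∑' n, (s n).2 w, fun w hw => ?_, fun w hw => ?_,
    ?_, ?_⟩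
  · have h1 := Complex.hasSum_deriv_of_summable_norm hsum (fun n => (hdiff n).1) hV hb1 hw
    have h2 : deriv (fun w => ∑' n, (s n).1 w) w = ∑' n, (s n).2 w := by
      rw [← h1.tsum_eq, h1.summable.tsum_eq_zero_add]
      have h3 : deriv (s 0).1 w = 0 := by simp [hs01]
      rw [h3, zero_add]
      exact tsum_congr fun n => (hd1 n w hw).deriv
    show HasDerivAt _ (∑' n, (s n).2 w) w
    rw [← h2]
    exact ((Complex.differentiableOn_tsum_of_summable_norm hsum (fun n => (hdiff n).1) hV
      hb1).differentiableAt (hV.mem_nhds hw)).hasDerivAt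
  · have h1 := Complex.hasSum_deriv_of_summable_norm hsum (fun n => (hdiff n).2) hV hb2 hw
    have h2 : deriv (fun w => ∑' n, (s n).2 w) w =
        f w * ∑' n, (s n).1 w + g w * ∑' n, (s n).2 w := by
      rw [← h1.tsum_eq, h1.summable.tsum_eq_zero_add]
      have h3 : deriv (s 0).2 w = 0 := by simp [hs02]
      rw [h3, zero_add, ← tsum_mul_left, ← tsum_mul_left,
        ← ((hS1 w hw).mul_left _).tsum_add ((hS2 w hw).mul_left _)]
      exact tsum_congr fun n => (hd2 n w hw).deriv
    show HasDerivAt _ (f w * ∑' n, (s n).1 w + g w * ∑' n, (s n).2 w) w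
    rw [← h2]
    exact ((Complex.differentiableOn_tsum_of_summable_norm hsum (fun n => (hdiff n).2) hV
      hb2).differentiableAt (hV.mem_nhds hw)).hasDerivAt
  · show ∑' n, (s n).1 p = a
    rw [(hS1 p hp).tsum_eq_zero_add]
    simp [hp1, hs01]
  · show ∑' n, (s n).2 p = b
    rw [(hS2 p hp).tsum_eq_zero_add]
    simp [hp2, hs02]

end Perron

namespace Perron

/-! ### Existence, uniqueness and continuation of solutions -/

variable {q₀ q₁ : RatFunc ℂ} {V : Set ℂ} {y u v : ℂ → ℂ}

theorem IsSolutionOn.mono {W : Set ℂ} (h : IsSolutionOn q₀ q₁ V y) (hW : W ⊆ V) :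
    IsSolutionOn q₀ q₁ W y :=
  ⟨h.1.mono hW, fun z hz => h.2 z (hW hz)⟩

theorem IsSolutionOn.congr (hV : IsOpen V) (h : IsSolutionOn q₀ q₁ V y) (huv : Set.EqOn u y V) :
    IsSolutionOn q₀ q₁ V u := by
  refine ⟨h.1.congr huv, fun z hz hzS => ?_⟩
  have h1 : u =ᶠ[𝓝 z] y := by filter_upwards [hV.mem_nhds hz] with w hw using huv hw
  rw [h1.deriv.deriv_eq, h1.deriv_eq, huv hz, h.2 z hz hzS]

theorem IsSolutionOn.congr_nhds (h : ∀ z ∈ V, ∃ W, IsOpen W ∧ z ∈ W ∧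
    ∃ u, IsSolutionOn q₀ q₁ W u ∧ Set.EqOn y u W) : IsSolutionOn q₀ q₁ V y := by
  constructor
  · intro z hz
    obtain ⟨W, hW, hzW, u, hu, huy⟩ := h z hz
    exact ((hu.congr hW huy).1.differentiableAt (hW.mem_nhds hzW)).differentiableWithinAt
  · intro z hz
    obtain ⟨W, hW, hzW, u, hu, huy⟩ := h z hz
    exact (hu.congr hW huy).2 z hzW

theorem IsSolutionOn.add_mul (hV : IsOpen V) (hu : IsSolutionOn q₀ q₁ V u)
    (hv : IsSolutionOn q₀ q₁ V v) (a b : ℂ) :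
    IsSolutionOn q₀ q₁ V fun z => a * u z + b * v z := by
  refine ⟨(hu.1.const_mul a).add (hv.1.const_mul b), fun z hz hzS => ?_⟩
  have h1 : ∀ w ∈ V, HasDerivAt (fun z => a * u z + b * v z) (a * deriv u w + b * deriv v w) w :=
    fun w hw => ((hu.1.differentiableAt (hV.mem_nhds hw)).hasDerivAt.const_mul a).add
      ((hv.1.differentiableAt (hV.mem_nhds hw)).hasDerivAt.const_mul b)
  have h2 : deriv (fun z => a * u z + b * v z) =ᶠ[𝓝 z] fun w => a * deriv u w + b * deriv v w := by
    filter_upwards [hV.mem_nhds hz] with w hw using (h1 w hw).deriv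
  have h3 : HasDerivAt (fun w => a * deriv u w + b * deriv v w)
      (a * deriv (deriv u) z + b * deriv (deriv v) z) z :=
    (((hu.1.deriv hV).differentiableAt (hV.mem_nhds hz)).hasDerivAt.const_mul a).add
      (((hv.1.deriv hV).differentiableAt (hV.mem_nhds hz)).hasDerivAt.const_mul b)
  rw [h2.deriv_eq, h3.deriv, (h1 z hz).deriv, hu.2 z hz hzS, hv.2 z hz hzS]
  ring

theorem isSolutionOn_of_hasDerivAt (hV : IsOpen V) (h1 : ∀ w ∈ V, HasDerivAt u (v w) w)
    (h2 : ∀ w ∈ V, HasDerivAt v (value q₀ w * u w + value q₁ w * v w) w) :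
    IsSolutionOn q₀ q₁ V u := by
  refine ⟨fun w hw => (h1 w hw).differentiableAt.differentiableWithinAt, fun z hz _ => ?_⟩
  have : deriv u =ᶠ[𝓝 z] v := by
    filter_upwards [hV.mem_nhds hz] with w hw using (h1 w hw).deriv
  rw [this.deriv_eq, (h2 z hz).deriv, (h1 z hz).deriv]

theorem differentiableOn_value {q : RatFunc ℂ} (hq : ∀ z ∈ V, ¬ IsPole q z) :
    DifferentiableOn ℂ (value q) V :=
  fun z hz => (differentiableAt_value (hq z hz)).differentiableWithinAt

theorem exists_isSolutionOn_of_convex {K : Set ℂ} (hK : IsCompact K)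
    (hKS : Disjoint K (singularSet q₀ q₁)) (hV : IsOpen V) (hc : Convex ℝ V) (hVK : V ⊆ K) {p : ℂ}
    (hp : p ∈ V) (a b : ℂ) : ∃ y, IsSolutionOn q₀ q₁ V y ∧ y p = a ∧ deriv y p = b := by
  have hd0 : DifferentiableOn ℂ (value q₀) K :=
    differentiableOn_value fun z hz h => hKS.notMem_of_mem_left hz (Or.inl h)
  have hd1 : DifferentiableOn ℂ (value q₁) K :=
    differentiableOn_value fun z hz h => hKS.notMem_of_mem_left hz (Or.inr h)
  obtain ⟨M0, hM0⟩ := hK.exists_bound_of_continuousOn hd0.continuousOn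
  obtain ⟨M1, hM1⟩ := hK.exists_bound_of_continuousOn hd1.continuousOn
  obtain ⟨D, hD⟩ := hK.exists_bound_of_continuousOn (f := fun w => w - p) (by fun_prop)
  obtain ⟨u, v, hu, hv, hup, hvp⟩ := exists_linear_ode_solution_of_convex hV hc hp
    (hd0.mono hVK) (hd1.mono hVK) (M := max M0 M1) (D := D)
    (fun w hw => (hM0 w (hVK hw)).trans (le_max_left _ _))
    (fun w hw => (hM1 w (hVK hw)).trans (le_max_right _ _)) (fun w hw => hD w (hVK hw)) a b
  exact ⟨u, isSolutionOn_of_hasDerivAt hV hu hv, hup, by rw [(hu p hp).deriv, hvp]⟩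

theorem exists_closedBall_disjoint {z : ℂ} (hz : z ∉ singularSet q₀ q₁) :
    ∃ r > 0, Disjoint (Metric.closedBall z r) (singularSet q₀ q₁) := by
  obtain ⟨r, hr, h⟩ := Metric.nhds_basis_closedBall.mem_iff.1
    ((isOpen_compl_singularSet q₀ q₁).mem_nhds hz)
  exact ⟨r, hr, Set.disjoint_left.2 fun w hw => h hw⟩

theorem exists_isSolutionOn_ball {z : ℂ} {r : ℝ} (hr : 0 < r)
    (h : Disjoint (Metric.closedBall z r) (singularSet q₀ q₁)) (a b : ℂ) :
    ∃ y, IsSolutionOn q₀ q₁ (Metric.ball z r) y ∧ y z = a ∧ deriv y z = b :=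
  exists_isSolutionOn_of_convex (isCompact_closedBall z r) h Metric.isOpen_ball
    (convex_ball z r) Metric.ball_subset_closedBall (Metric.mem_ball_self hr) a b

/-- Every derivative at `p` is a combination of `y p` and `deriv y p`, so the Taylor series
vanishes. -/
theorem IsSolutionOn.eventually_eq_zero (hV : IsOpen V) (hy : IsSolutionOn q₀ q₁ V y) {p : ℂ}
    (hp : p ∈ V) (hpS : p ∉ singularSet q₀ q₁) (h0 : y p = 0) (h1 : deriv y p = 0) :
    ∀ᶠ z in 𝓝 p, y z = 0 := by
  obtain ⟨r, hr, hrV⟩ := Metric.isOpen_iff.1 hV p hp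
  filter_upwards [Metric.ball_mem_nhds p hr] with z hz
  rw [← Complex.taylorSeries_eq_on_ball' hz (hy.1.mono hrV)]
  simp [hy.iteratedDeriv_eq hV _ hp hpS, h0, h1]

theorem eqOn_of_eventuallyEq (hV : IsOpen V) (hc : IsPreconnected V) (hu : DifferentiableOn ℂ u V)
    (hv : DifferentiableOn ℂ v V) {p : ℂ} (hp : p ∈ V) (h : u =ᶠ[𝓝 p] v) : Set.EqOn u v V :=
  (hu.analyticOnNhd hV).eqOn_of_preconnected_of_eventuallyEq (hv.analyticOnNhd hV) hc hp h

theorem IsSolutionOn.eqOn (hV : IsOpen V) (hc : IsPreconnected V) (hu : IsSolutionOn q₀ q₁ V u)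
    (hv : IsSolutionOn q₀ q₁ V v) {p : ℂ} (hp : p ∈ V) (hpS : p ∉ singularSet q₀ q₁)
    (h0 : u p = v p) (h1 : deriv u p = deriv v p) : Set.EqOn u v V := by
  refine eqOn_of_eventuallyEq hV hc hu.1 hv.1 hp ?_
  have h := hu.add_mul hV hv 1 (-1)
  have hd : deriv (fun z => 1 * u z + -1 * v z) p = 0 := by
    rw [(((hu.1.differentiableAt (hV.mem_nhds hp)).hasDerivAt.const_mul 1).fun_add
      ((hv.1.differentiableAt (hV.mem_nhds hp)).hasDerivAt.const_mul (-1))).deriv, h1]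
    ring
  filter_upwards [h.eventually_eq_zero hV hp hpS (by simp [h0]) hd] with z hz
  linear_combination hz

/-- A solution near `t` on a set `V` that is closed under contraction towards `t` and avoids the
singular points extends to the whole of `V`. -/
theorem IsSolutionOn.exists_extension {t : ℂ} {ε : ℝ} (hε : 0 < ε) (hV : IsOpen V)
    (hVS : Disjoint V (singularSet q₀ q₁))
    (hst : ∀ w ∈ V, ∀ s : ℝ, 0 < s → s ≤ 1 → t + s * (w - t) ∈ V)
    (hy : IsSolutionOn q₀ q₁ (V ∩ Metric.ball t ε) y) :
    ∃ u, IsSolutionOn q₀ q₁ V u ∧ Set.EqOn u y (V ∩ Metric.ball t ε) := by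
  -- The factor `σ w` moves `w` along its ray, continuously in `w`, to a point `c w` of the disc
  -- where `y` is given. The solution with the data of `y` at `c w` is then carried to `w` along a
  -- convex neighbourhood of the segment.
  set σ : ℂ → ℝ := fun w => ε / (ε + ‖w - t‖) with hσ
  have hσ0 : ∀ w, 0 < σ w := fun w => by positivity
  have hσ1 : ∀ w, σ w ≤ 1 := fun w => by
    rw [hσ, div_le_one (by positivity)]; linarith [norm_nonneg (w - t)]
  set c : ℂ → ℂ := fun w => t + σ w * (w - t) with hc
  have hcV : ∀ w ∈ V, c w ∈ V := fun w hw => hst w hw _ (hσ0 w) (hσ1 w)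
  have hcb : ∀ w, c w ∈ Metric.ball t ε := fun w => by
    rw [mem_ball_iff_norm, hc, add_sub_cancel_left, norm_mul, Complex.norm_real,
      Real.norm_of_nonneg (hσ0 w).le, hσ, div_mul_eq_mul_div, div_lt_iff₀ (by positivity)]
    nlinarith
  have hccont : Continuous c := by
    have : Continuous σ := by
      refine continuous_const.div (by fun_prop) fun w => ?_
      positivity
    exact continuous_const.add ((Complex.continuous_ofReal.comp this).mul (by fun_prop))
  have hopen : IsOpen (V ∩ Metric.ball t ε) := hV.inter Metric.isOpen_ball
  have hex : ∀ w : ℂ, ∃ (T : Set ℂ) (f : ℂ → ℂ), w ∈ V → (IsOpen T ∧ Convex ℝ T ∧ T ⊆ V ∧ w ∈ T ∧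
      c w ∈ T ∧ IsSolutionOn q₀ q₁ T f ∧ Set.EqOn f y (T ∩ Metric.ball t ε)) := by
    intro w
    by_cases hw : w ∈ V
    swap
    · exact ⟨∅, 0, fun h => absurd h hw⟩
    have hseg : segment ℝ (c w) w ⊆ V := by
      rw [segment_eq_image]
      rintro _ ⟨θ, ⟨h0, h1⟩, rfl⟩
      have : (1 - θ) • c w + θ • w = t + (((1 - θ) * σ w + θ : ℝ) : ℂ) * (w - t) := by
        simp only [hc, Complex.real_smul]
        push_cast
        ring
      simp only [this]
      refine hst w hw _ ?_ ?_
      · rcases h0.eq_or_lt with rfl | h0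
        · simpa using hσ0 w
        · nlinarith [hσ0 w]
      · nlinarith [hσ1 w]
    have hcpt : IsCompact (segment ℝ (c w) w) := by
      rw [segment_eq_image]
      exact isCompact_Icc.image (by fun_prop)
    obtain ⟨δ, hδ, hδV⟩ := hcpt.exists_cthickening_subset_open hV hseg
    have hTV : Metric.thickening δ (segment ℝ (c w) w) ⊆ V :=
      (Metric.thickening_subset_cthickening _ _).trans hδV
    have hsT := Metric.self_subset_thickening hδ (segment ℝ (c w) w)
    have hcT := hsT (left_mem_segment ℝ (c w) w)
    have hTc := (convex_segment (𝕜 := ℝ) (c w) w).thickening δ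
    obtain ⟨f, hf, hf0, hf1⟩ := exists_isSolutionOn_of_convex (hcpt.cthickening (r := δ))
      (hVS.mono_left hδV) Metric.isOpen_thickening hTc
      (Metric.thickening_subset_cthickening δ _) hcT (y (c w)) (deriv y (c w))
    refine ⟨_, f, fun _ => ⟨Metric.isOpen_thickening, hTc, hTV, hsT (right_mem_segment ℝ _ _), hcT,
      hf, ?_⟩⟩
    exact (hf.mono Set.inter_subset_left).eqOn (Metric.isOpen_thickening.inter Metric.isOpen_ball)
      (hTc.inter (convex_ball t ε)).isPreconnected
      (hy.mono (Set.inter_subset_inter_left _ hTV)) ⟨hcT, hcb w⟩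
      (hVS.notMem_of_mem_left (hcV w hw)) hf0 hf1
  choose T f hTf using hex
  -- For `z` near `w` the point `c z` lies in both convex sets, and near it both solutions equal
  -- `y`; the identity theorem on the convex intersection makes them agree at `z`.
  have hkey : ∀ w ∈ V, ∀ᶠ z in 𝓝 w, f z z = f w z := by
    intro w hw
    obtain ⟨hTo, hTc, hTV, hwT, hcT, hf, hfy⟩ := hTf w hw
    filter_upwards [hV.mem_nhds hw, hTo.mem_nhds hwT,
      hccont.continuousAt.eventually_mem (hTo.mem_nhds hcT)] with z hz hzT hczT
    obtain ⟨hTo', hTc', hTV', hzT', hcT', hf', hfy'⟩ := hTf z hz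
    refine eqOn_of_eventuallyEq (hTo.inter hTo') (hTc.inter hTc').isPreconnected
      (hf'.1.mono Set.inter_subset_right) (hf.1.mono Set.inter_subset_left) ⟨hczT, hcT'⟩ ?_
      ⟨hzT, hzT'⟩
    filter_upwards [hTo.mem_nhds hczT, hTo'.mem_nhds hcT', Metric.isOpen_ball.mem_nhds (hcb z)]
      with x hx hx' hxb
    rw [hfy ⟨hx, hxb⟩, hfy' ⟨hx', hxb⟩]
  refine ⟨fun z => f z z, IsSolutionOn.congr_nhds fun w hw => ?_, fun w hw => ?_⟩
  · obtain ⟨W, hW, hWo, hwW⟩ := eventually_nhds_iff.1 (hkey w hw)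
    obtain ⟨hTo, hTc, hTV, hwT, hcT, hf, hfy⟩ := hTf w hw
    exact ⟨W ∩ T w, hWo.inter hTo, ⟨hwW, hwT⟩, f w, hf.mono Set.inter_subset_right,
      fun x hx => hW x hx.1⟩
  · obtain ⟨hTo, hTc, hTV, hwT, hcT, hf, hfy⟩ := hTf w hw.1
    exact hfy ⟨hwT, hw.2⟩

end Perron

namespace Perron

/-! ### The continued fraction -/

/-- Off a finite set, local solutions take arbitrary values of `(y, y')` at a point. The data `(1,
0)` and `(0, 1)` separate the two coefficients, and equality off a finite set is equality of
rational functions. -/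
theorem IsRecurrence.derivCoeff_eq {q₀ q₁ : RatFunc ℂ} {a₁ a₂ : ℕ → RatFunc ℂ}
    (h : IsRecurrence q₀ q₁ a₁ a₂) (n : ℕ) :
    (derivCoeff q₀ q₁ n).1 * RatFunc.C ((n.factorial : ℂ)⁻¹) =
      a₁ n * ((derivCoeff q₀ q₁ (n + 1)).1 * RatFunc.C (((n + 1).factorial : ℂ)⁻¹)) +
      a₂ n * ((derivCoeff q₀ q₁ (n + 2)).1 * RatFunc.C (((n + 2).factorial : ℂ)⁻¹)) ∧
    (derivCoeff q₀ q₁ n).2 * RatFunc.C ((n.factorial : ℂ)⁻¹) =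
      a₁ n * ((derivCoeff q₀ q₁ (n + 1)).2 * RatFunc.C (((n + 1).factorial : ℂ)⁻¹)) +
      a₂ n * ((derivCoeff q₀ q₁ (n + 2)).2 * RatFunc.C (((n + 2).factorial : ℂ)⁻¹)) := by
  have hF := ((finite_singularSet q₀ q₁).union (finite_setOf_isPole (a₁ n))).union
    (finite_setOf_isPole (a₂ n))
  have key : ∀ (z : ℂ), z ∉ singularSet q₀ q₁ ∪ {z | IsPole (a₁ n) z} ∪ {z | IsPole (a₂ n) z} →
      ∀ a b : ℂ, (value (derivCoeff q₀ q₁ n).1 z * a + value (derivCoeff q₀ q₁ n).2 z * b) /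
          (n.factorial : ℂ) =
        value (a₁ n) z * ((value (derivCoeff q₀ q₁ (n + 1)).1 z * a +
          value (derivCoeff q₀ q₁ (n + 1)).2 z * b) / ((n + 1).factorial : ℂ)) +
        value (a₂ n) z * ((value (derivCoeff q₀ q₁ (n + 2)).1 z * a +
          value (derivCoeff q₀ q₁ (n + 2)).2 z * b) / ((n + 2).factorial : ℂ)) := by
    intro z hz a b
    simp only [Set.mem_union, not_or] at hz
    obtain ⟨⟨hzS, hz1⟩, hz2⟩ := hz
    obtain ⟨r, hr, hd⟩ := exists_closedBall_disjoint hzS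
    obtain ⟨y, hy, hy0, hy1⟩ := exists_isSolutionOn_ball hr hd a b
    have := h _ y Metric.isOpen_ball (hd.mono_left Metric.ball_subset_closedBall) hy n z
      (Metric.mem_ball_self hr) hz1 hz2
    simpa only [hy.iteratedDeriv_eq Metric.isOpen_ball _ (Metric.mem_ball_self hr) hzS, hy0, hy1]
      using this
  constructor
  all_goals
    rw [← sub_eq_zero]
    refine eq_zero_of_value_eq_zero hF fun z hz => ?_
    have hk := key z hz
    simp only [Set.mem_union, not_or] at hz
    obtain ⟨⟨hzS, hz1⟩, hz2⟩ := hz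
    have p1 := not_isPole_derivCoeff hzS n
    have p2 := not_isPole_derivCoeff hzS (n + 1)
    have p3 := not_isPole_derivCoeff hzS (n + 2)
    have hz1' : ¬ IsPole (a₁ n) z := hz1
    have hz2' : ¬ IsPole (a₂ n) z := hz2
    have np : ∀ {p : RatFunc ℂ} (c : ℂ), ¬ IsPole p z → ¬ IsPole (p * RatFunc.C c) z :=
      fun c hp => not_isPole_mul hp (not_isPole_C c z)
    have vp : ∀ {p : RatFunc ℂ} (c : ℂ), ¬ IsPole p z → value (p * RatFunc.C c) z = value p z * c :=
      fun c hp => by rw [value_mul hp (not_isPole_C c z), value_C]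
  · have n2 := not_isPole_mul hz1' (np (((n + 1).factorial : ℂ)⁻¹) p2.1)
    have n3 := not_isPole_mul hz2' (np (((n + 2).factorial : ℂ)⁻¹) p3.1)
    rw [sub_eq_add_neg, value_add (np _ p1.1) (not_isPole_neg (not_isPole_add n2 n3)),
      value_neg (not_isPole_add n2 n3), value_add n2 n3, value_mul hz1' (np _ p2.1),
      value_mul hz2' (np _ p3.1), vp _ p1.1, vp _ p2.1, vp _ p3.1]
    have := hk 1 0
    simp only [mul_one, mul_zero, add_zero] at this
    linear_combination this
  · have n2 := not_isPole_mul hz1' (np (((n + 1).factorial : ℂ)⁻¹) p2.2)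
    have n3 := not_isPole_mul hz2' (np (((n + 2).factorial : ℂ)⁻¹) p3.2)
    rw [sub_eq_add_neg, value_add (np _ p1.2) (not_isPole_neg (not_isPole_add n2 n3)),
      value_neg (not_isPole_add n2 n3), value_add n2 n3, value_mul hz1' (np _ p2.2),
      value_mul hz2' (np _ p3.2), vp _ p1.2, vp _ p2.2, vp _ p3.2]
    have := hk 0 1
    simp only [mul_one, mul_zero, zero_add] at this
    linear_combination this

/-- The case `b = 0` is allowed: then `r = 0` too, and both quotients are `0` by convention. -/
theorem div_eq_neg_div_of_eq_mul {K : Type*} [Field K] {p r D a b : K} (hr : r = D * b)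
    (hp : p = -(D * a)) (hD : D ≠ 0) : a / b = -(p / r) := by
  rw [hr, hp, neg_div, neg_neg, mul_div_mul_left _ _ hD]

/-- The normalised coefficients `P n`, `R n` solve the recurrence with initial values `(1, 0)` and
`(0, 1)`. Unrolling it writes `x_0` and `x_1` through `x_n` and `x_{n+1}`, with the continuants as
coefficients. The convergent numbered `n` ends in `a₁ (n - 1)`, hence the index `n + 1` on the
right. -/
theorem IsRecurrence.convs_perronFraction {q₀ q₁ : RatFunc ℂ} {a₁ a₂ : ℕ → RatFunc ℂ}
    (h : IsRecurrence q₀ q₁ a₁ a₂) (n : ℕ) :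
    (perronFraction a₁ a₂).convs n =
      -((derivCoeff q₀ q₁ (n + 1)).1 / (derivCoeff q₀ q₁ (n + 1)).2) := by
  set g := perronFraction a₁ a₂ with hg
  let α : ℕ → RatFunc ℂ := fun n => match n with
    | 0 => 1
    | k + 1 => a₂ k
  have hα : ∀ n, g.s.get? n = some ⟨α n, a₁ n⟩ := fun n => rfl
  set P : ℕ → RatFunc ℂ := fun n => (derivCoeff q₀ q₁ n).1 * RatFunc.C ((n.factorial : ℂ)⁻¹) with hP
  set R : ℕ → RatFunc ℂ := fun n => (derivCoeff q₀ q₁ n).2 * RatFunc.C ((n.factorial : ℂ)⁻¹) with hR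
  have hPr : ∀ n, P n = a₁ n * P (n + 1) + a₂ n * P (n + 2) := fun n => (h.derivCoeff_eq n).1
  have hRr : ∀ n, R n = a₁ n * R (n + 1) + a₂ n * R (n + 2) := fun n => (h.derivCoeff_eq n).2
  have hP0 : P 0 = 1 := by simp [P, derivCoeff]
  have hP1 : P 1 = 0 := by simp [P, derivCoeff, ratDeriv]
  have hR0 : R 0 = 0 := by simp [R, derivCoeff]
  have hR1 : R 1 = 1 := by simp [R, derivCoeff, ratDeriv]
  have hc : ∀ n, g.contsAux (n + 2) =
      ⟨a₁ n * (g.contsAux (n + 1)).a + α n * (g.contsAux n).a,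
        a₁ n * (g.contsAux (n + 1)).b + α n * (g.contsAux n).b⟩ := fun n =>
    GenContFract.contsAux_recurrence (hα n) rfl rfl
  -- The lines with `.b` express `x_0` and those with `.a` express `x_1`, for `x = P` and `x = R`.
  -- Together they say that a matrix of continuants is inverse to the matrix of `P` and `R`.
  have hinv : ∀ n,
      (g.contsAux (n + 1)).b * P n + α n * (g.contsAux n).b * P (n + 1) = 1 ∧
      (g.contsAux (n + 1)).b * R n + α n * (g.contsAux n).b * R (n + 1) = 0 ∧
      (g.contsAux (n + 1)).a * P n + α n * (g.contsAux n).a * P (n + 1) = 0 ∧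
      (g.contsAux (n + 1)).a * R n + α n * (g.contsAux n).a * R (n + 1) = 1 := by
    intro n
    induction n with
    | zero =>
      have h1 : g.contsAux 1 = ⟨0, 1⟩ := rfl
      have h0 : g.contsAux 0 = ⟨1, 0⟩ := rfl
      have hα0 : α 0 = 1 := rfl
      simp [h1, h0, hP0, hP1, hR0, hR1, hα0]
    | succ n ih =>
      have hαn : α (n + 1) = a₂ n := rfl
      rw [hc, hαn]
      rw [hPr n, hRr n] at ih
      obtain ⟨i1, i2, i3, i4⟩ := ih
      refine ⟨?_, ?_, ?_, ?_⟩
      · linear_combination i1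
      · linear_combination i2
      · linear_combination i3
      · linear_combination i4
  obtain ⟨i1, i2, i3, i4⟩ := hinv n
  -- Determinants of the two inverse matrices; the next two identities are Cramer's rule.
  have hdet : (P n * R (n + 1) - R n * P (n + 1)) *
      ((g.contsAux (n + 1)).b * (α n * (g.contsAux n).a) -
        (g.contsAux (n + 1)).a * (α n * (g.contsAux n).b)) = 1 := by
    linear_combination
      ((g.contsAux (n + 1)).a * R n + α n * (g.contsAux n).a * R (n + 1)) * i1 + i4 -
        ((g.contsAux (n + 1)).a * P n + α n * (g.contsAux n).a * P (n + 1)) * i2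
  have hb : R (n + 1) = (P n * R (n + 1) - R n * P (n + 1)) * (g.contsAux (n + 1)).b := by
    linear_combination (-R (n + 1)) * i1 + P (n + 1) * i2
  have ha : P (n + 1) = -((P n * R (n + 1) - R n * P (n + 1)) * (g.contsAux (n + 1)).a) := by
    linear_combination R (n + 1) * i3 - P (n + 1) * i4
  have hD : P n * R (n + 1) - R n * P (n + 1) ≠ 0 := left_ne_zero_of_mul_eq_one hdet
  have hfac : RatFunc.C (((n + 1).factorial : ℂ)⁻¹) ≠ 0 := by
    rw [ne_eq, map_eq_zero]
    exact inv_ne_zero (by exact_mod_cast (n + 1).factorial_ne_zero)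
  have e1 : (derivCoeff q₀ q₁ (n + 1)).1 / (derivCoeff q₀ q₁ (n + 1)).2 = P (n + 1) / R (n + 1) :=
    (mul_div_mul_right _ _ hfac).symm
  have e2 : g.convs n = (g.contsAux (n + 1)).a / (g.contsAux (n + 1)).b := rfl
  rw [e1, e2]
  exact div_eq_neg_div_of_eq_mul hb ha hD

end Perron

namespace Perron

/-! ### The chordal distance -/

open Classical in
/-- The point of the Riemann sphere with homogeneous coordinates `[a : b]`. -/
noncomputable def ofHomogeneous (a b : ℂ) : OnePoint ℂ :=
  if b = 0 then OnePoint.infty else OnePoint.some (a / b)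

theorem sqrt_one_add_norm_div_sq (a : ℂ) {b : ℂ} (hb : b ≠ 0) :
    √(1 + ‖a / b‖ ^ 2) = √(‖a‖ ^ 2 + ‖b‖ ^ 2) / ‖b‖ := by
  have hb' : 0 < ‖b‖ := norm_pos_iff.2 hb
  have h : 1 + ‖a / b‖ ^ 2 = (‖a‖ ^ 2 + ‖b‖ ^ 2) / ‖b‖ ^ 2 := by
    rw [norm_div]; field_simp; ring
  rw [h, Real.sqrt_div (by positivity), Real.sqrt_sq hb'.le]

theorem sqrt_norm_sq_add_pos {a b : ℂ} (h : a ≠ 0 ∨ b ≠ 0) : 0 < √(‖a‖ ^ 2 + ‖b‖ ^ 2) := by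
  apply Real.sqrt_pos.2
  rcases h with h | h
  · have := norm_pos_iff.2 h; positivity
  · have := norm_pos_iff.2 h; positivity

/-- One formula covers all four cases and is visibly continuous at infinity. For `[q_{0,n} :
q_{1,n}]` and `[-y' : y]` the determinant in it is `y^{(n)}`. -/
theorem chordalDist_ofHomogeneous {a b c d : ℂ} (hab : a ≠ 0 ∨ b ≠ 0) (hcd : c ≠ 0 ∨ d ≠ 0) :
    chordalDist (ofHomogeneous a b) (ofHomogeneous c d) =
      2 * ‖a * d - b * c‖ / (√(‖a‖ ^ 2 + ‖b‖ ^ 2) * √(‖c‖ ^ 2 + ‖d‖ ^ 2)) := by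
  have h1 := sqrt_norm_sq_add_pos hab
  have h2 := sqrt_norm_sq_add_pos hcd
  unfold ofHomogeneous
  split_ifs with hb hd hd
  · simp [chordalDist, hb, hd]
  · subst hb
    have hd' : 0 < ‖d‖ := norm_pos_iff.2 hd
    have ha : 0 < ‖a‖ := norm_pos_iff.2 (hab.resolve_right (fun h => h rfl))
    simp only [chordalDist, sqrt_one_add_norm_div_sq c hd]
    simp only [norm_zero, zero_mul, sub_zero, norm_mul, ne_eq, OfNat.ofNat_ne_zero,
      not_false_eq_true, zero_pow, add_zero, Real.sqrt_sq ha.le]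
    field_simp
  · subst hd
    have hb' : 0 < ‖b‖ := norm_pos_iff.2 hb
    have hc : 0 < ‖c‖ := norm_pos_iff.2 (hcd.resolve_right (fun h => h rfl))
    simp only [chordalDist, sqrt_one_add_norm_div_sq a hb]
    simp only [norm_zero, mul_zero, zero_sub, norm_neg, norm_mul, ne_eq, OfNat.ofNat_ne_zero,
      not_false_eq_true, zero_pow, add_zero, Real.sqrt_sq hc.le]
    field_simp
  · have hb' : 0 < ‖b‖ := norm_pos_iff.2 hb
    have hd' : 0 < ‖d‖ := norm_pos_iff.2 hd
    simp only [chordalDist, sqrt_one_add_norm_div_sq a hb, sqrt_one_add_norm_div_sq c hd]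
    rw [div_sub_div _ _ hb hd, norm_div, norm_mul b d]
    field_simp

theorem ofHomogeneous_eq_of_mul_eq {a b c d : ℂ} (hab : a ≠ 0 ∨ b ≠ 0) (hcd : c ≠ 0 ∨ d ≠ 0)
    (h : a * d = b * c) : ofHomogeneous a b = ofHomogeneous c d := by
  unfold ofHomogeneous
  by_cases hb : b = 0
  · subst hb
    have ha : a ≠ 0 := hab.resolve_right (fun h => h rfl)
    have hd : d = 0 := by simpa [ha] using h
    simp [hd]
  · by_cases hd : d = 0
    · subst hd
      have hc : c ≠ 0 := hcd.resolve_right (fun h => h rfl)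
      simp [hb, hc] at h
    · rw [if_neg hb, if_neg hd, div_eq_div_iff hb hd |>.2 (by rw [h, mul_comm])]

theorem sphereValue_eq_ofHomogeneous (q : RatFunc ℂ) (z : ℂ) :
    sphereValue q z = ofHomogeneous (q.num.eval z) (q.denom.eval z) := by
  unfold sphereValue ofHomogeneous IsPole
  rw [value_eq]

theorem num_eval_or_denom_eval_ne_zero (q : RatFunc ℂ) (z : ℂ) :
    q.num.eval z ≠ 0 ∨ q.denom.eval z ≠ 0 := by
  by_cases h : q.denom.eval z = 0
  · exact Or.inl (num_eval_ne_zero_of_isPole h)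
  · exact Or.inr h

theorem isPole_neg_iff {q : RatFunc ℂ} {z : ℂ} : IsPole (-q) z ↔ IsPole q z :=
  ⟨fun h => by_contra fun h' => not_isPole_neg h' h,
    fun h => by_contra fun h' => not_isPole_neg h' (by simpa using h)⟩

open Classical in
theorem chordalDist_sphereValue_neg (q : RatFunc ℂ) (p : Prop) (w z : ℂ) :
    chordalDist (sphereValue (-q) z) (if p then OnePoint.infty else OnePoint.some (-w)) =
      chordalDist (sphereValue q z) (if p then OnePoint.infty else OnePoint.some w) := by
  unfold sphereValue
  rw [isPole_neg_iff]
  by_cases h : IsPole q z <;> by_cases hp : p <;> simp only [h, hp, if_true, if_false]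
  · simp [chordalDist]
  · simp [chordalDist, value_neg h]
  · rw [value_neg h]
    simp only [chordalDist, norm_neg]
    rw [← neg_sub', norm_neg]

/-- Infinity is at distance at least `2 / (1 + B)` from `z`, which `hε1` excludes. For finite `w`
and `d = ‖w - z‖` the bound reads `2 d < ε (1 + B + d) (1 + B) ≤ η + d`. -/
theorem exists_coe_of_chordalDist_lt {x : OnePoint ℂ} {z : ℂ} {B η ε : ℝ} (hB : ‖z‖ ≤ B)
    (hε0 : 0 ≤ ε) (hε1 : ε * (1 + B) ≤ 1) (hε2 : ε * (1 + B) ^ 2 ≤ η)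
    (h : chordalDist x (OnePoint.some z) < ε) :
    ∃ w : ℂ, x = OnePoint.some w ∧ ‖w - z‖ < η := by
  have hs : ∀ w : ℂ, √(1 + ‖w‖ ^ 2) ≤ 1 + ‖w‖ := fun w => by
    rw [Real.sqrt_le_left (by positivity)]
    nlinarith [norm_nonneg w]
  have hp : ∀ w : ℂ, 0 < √(1 + ‖w‖ ^ 2) := fun w => by positivity
  have hz : √(1 + ‖z‖ ^ 2) ≤ 1 + B := (hs z).trans (by linarith)
  have hB0 : 0 ≤ B := (norm_nonneg z).trans hB
  induction x using OnePoint.rec with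
  | infty =>
    have h1 : 2 / √(1 + ‖z‖ ^ 2) < ε := h
    rw [div_lt_iff₀ (hp z)] at h1
    nlinarith
  | coe w =>
    refine ⟨w, rfl, ?_⟩
    have h1 : 2 * ‖w - z‖ / (√(1 + ‖w‖ ^ 2) * √(1 + ‖z‖ ^ 2)) < ε := h
    have hpos := mul_pos (hp w) (hp z)
    rw [div_lt_iff₀ hpos] at h1
    have h2 : ‖w‖ ≤ B + ‖w - z‖ := by
      have := norm_add_le z (w - z)
      rw [add_sub_cancel] at this
      linarith
    have h3 : √(1 + ‖w‖ ^ 2) * √(1 + ‖z‖ ^ 2) ≤ (1 + B + ‖w - z‖) * (1 + B) := by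
      have := hs w
      gcongr
      linarith
    have h4 : ε * (√(1 + ‖w‖ ^ 2) * √(1 + ‖z‖ ^ 2)) ≤ ε * ((1 + B + ‖w - z‖) * (1 + B)) := by
      gcongr
    nlinarith [norm_nonneg (w - z)]

open Classical in
-- On a compact set without poles `f` is bounded, and there the chordal distance controls the usual
-- one and keeps the approximants finite.
theorem ConvergesOnCompacts.of_spherical {R : ℕ → RatFunc ℂ} {f : ℂ → ℂ} {P U : Set ℂ}
    (hf : ContinuousOn f (U \ P))
    (h : ∀ K ⊆ U, IsCompact K → ∀ ε > 0, ∀ᶠ n in atTop, ∀ z ∈ K,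
      chordalDist (sphereValue (R n) z)
        (if z ∈ P then OnePoint.infty else OnePoint.some (f z)) < ε) :
    ConvergesOnCompacts R f P U := by
  refine ⟨fun K hK hKc ε hε => ?_, fun K hK hKc hKP => ?_⟩
  · filter_upwards [h K hK hKc ε hε] with n hn z hz
    convert! hn z hz
  obtain ⟨B, hB⟩ := hKc.exists_bound_of_continuousOn
    (hf.mono (Set.subset_sdiff.2 ⟨hK, hKP⟩))
  have key : ∀ η > 0, ∀ᶠ n in atTop, ∀ z ∈ K, ∃ w : ℂ, sphereValue (R n) z = OnePoint.some w ∧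
      ‖w - f z‖ < η := by
    intro η hη
    have hs : 0 < 1 + |B| := by positivity
    filter_upwards [h K hK hKc (min (1 / (1 + |B|)) (η / (1 + |B|) ^ 2)) (by positivity)]
      with n hn z hz
    have h1 := hn z hz
    rw [if_neg (hKP.notMem_of_mem_left hz)] at h1
    refine exists_coe_of_chordalDist_lt ((hB z hz).trans (le_abs_self B)) (by positivity) ?_ ?_ h1
    · rw [← le_div_iff₀ hs]; exact min_le_left _ _
    · rw [← le_div_iff₀ (by positivity)]; exact min_le_right _ _
  have hval : ∀ n z (w : ℂ), sphereValue (R n) z = OnePoint.some w →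
      ¬ IsPole (R n) z ∧ value (R n) z = w := by
    intro n z w hw
    unfold sphereValue at hw
    split_ifs at hw with hp
    · exact absurd hw (OnePoint.infty_ne_coe w)
    · exact ⟨hp, OnePoint.coe_injective hw⟩
  constructor
  · filter_upwards [key 1 one_pos] with n hn z hz
    obtain ⟨w, hw, -⟩ := hn z hz
    exact (hval n z w hw).1
  · rw [Metric.tendstoUniformlyOn_iff]
    intro η hη
    filter_upwards [key η hη] with n hn z hz
    obtain ⟨w, hw, hwz⟩ := hn z hz
    rw [(hval n z w hw).2, dist_comm, dist_eq_norm]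
    exact hwz

theorem ConvergesOnCompacts.neg_shift {R : ℕ → RatFunc ℂ} {f : ℂ → ℂ} {P U : Set ℂ}
    (hf : ContinuousOn f (U \ P)) (h : ConvergesOnCompacts R f P U) :
    ConvergesOnCompacts (fun n => -R (n + 1)) (fun z => -f z) P U := by
  refine ConvergesOnCompacts.of_spherical hf.neg fun K hK hKc ε hε => ?_
  filter_upwards [(tendsto_add_atTop_nat 1).eventually (h.spherical K hK hKc ε hε)] with n hn z hz
  rw [chordalDist_sphereValue_neg]
  convert! hn z hz

end Perron

/-! ### From small derivatives to chordal convergence -/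

namespace Perron

variable {q₀ q₁ : RatFunc ℂ} {U : Set ℂ} {y : ℂ → ℂ} {t : ℂ}

open Classical in
-- At a multiple zero of `y` the pair `(-y', y)` degenerates to `(0, 0)`. Cancelling `(z - t)^(m -
-- 1)` leaves coordinates that are continuous and not both zero at `t`; for `m = 0` nothing is
-- cancelled.
theorem exists_homogeneous_logDeriv {G : ℂ → ℂ} {m : ℕ} (hG : AnalyticAt ℂ G t) (hGt : G t ≠ 0)
    (hy : ∀ᶠ z in 𝓝 t, y z = (z - t) ^ m * G z) :
    ∃ c d : ℂ → ℂ, ContinuousAt c t ∧ ContinuousAt d t ∧ (c t ≠ 0 ∨ d t ≠ 0) ∧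
      ∀ᶠ z in 𝓝 t, (if y z = 0 then OnePoint.infty else OnePoint.some (-(deriv y z / y z))) =
        ofHomogeneous (c z) (d z) := by
  have hG0 : ∀ᶠ z in 𝓝 t, G z ≠ 0 := hG.continuousAt.eventually_ne hGt
  rcases m with _ | m
  · have hyG : y =ᶠ[𝓝 t] G := by filter_upwards [hy] with z hz using by simpa using hz
    refine ⟨fun z => -deriv G z, G, hG.deriv.continuousAt.neg, hG.continuousAt, Or.inr hGt, ?_⟩
    filter_upwards [hyG.eventuallyEq_nhds, hG0] with z hz hz0
    rw [hz.deriv_eq, hz.eq_of_nhds, if_neg hz0]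
    simp [ofHomogeneous, hz0, neg_div]
  · refine ⟨fun z => -((m + 1) * G z + (z - t) * deriv G z), fun z => (z - t) * G z, ?_, ?_, ?_, ?_⟩
    · have h1 := hG.deriv.continuousAt
      have h2 := hG.continuousAt
      fun_prop
    · have h2 := hG.continuousAt
      fun_prop
    · left
      have : (m : ℂ) + 1 ≠ 0 := Nat.cast_add_one_ne_zero m
      simp [this, hGt]
    · filter_upwards [(show y =ᶠ[𝓝 t] _ from hy).eventuallyEq_nhds, hG0,
        hG.eventually_analyticAt] with z hz hz0 hGz
      have hd : HasDerivAt (fun z => (z - t) ^ (m + 1) * G z)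
          ((z - t) ^ m * ((m + 1) * G z + (z - t) * deriv G z)) z := by
        have h1 := (((hasDerivAt_id z).sub_const t).pow (m + 1)).mul
          hGz.differentiableAt.hasDerivAt
        convert! h1 using 1
        simp
        ring
      rw [hz.deriv_eq, hz.eq_of_nhds, hd.deriv]
      by_cases hzt : z - t = 0
      · simp [hzt, ofHomogeneous]
      · have h3 : (z - t) ^ m ≠ 0 := pow_ne_zero m hzt
        rw [if_neg (mul_ne_zero (pow_ne_zero _ hzt) hz0), ofHomogeneous,
          if_neg (mul_ne_zero hzt hz0)]
        congr 1
        field_simp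
        ring

theorem sphereValue_div {a b : RatFunc ℂ} {z : ℂ} (hb : b ≠ 0) (ha' : ¬ IsPole a z)
    (hb' : ¬ IsPole b z) (h : value a z ≠ 0 ∨ value b z ≠ 0) :
    sphereValue (a / b) z = ofHomogeneous (value a z) (value b z) := by
  rw [sphereValue_eq_ofHomogeneous]
  exact ofHomogeneous_eq_of_mul_eq (num_eval_or_denom_eval_ne_zero _ _) h
    (num_eval_mul_value_of_div hb ha' hb')

theorem ne_zero_or_ne_zero_of_sqrt_pos {a b : ℂ} (h : 0 < √(‖a‖ ^ 2 + ‖b‖ ^ 2)) :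
    a ≠ 0 ∨ b ≠ 0 := by
  by_contra hcon
  rw [not_or, not_not, not_not] at hcon
  simp [hcon.1, hcon.2] at h

/-- Convergence of `q_{0,n} / q_{1,n}` follows if the derivatives of the solution `y` are small
compared with the coefficients. -/
theorem converges_of_iteratedDeriv_small (hU : IsOpen U) (htU : t ∈ U)
    (hUS : ∀ z ∈ U, z ≠ t → z ∉ singularSet q₀ q₁) (hy : IsSolutionOn q₀ q₁ U y)
    (hy0 : ∀ z ∈ U, z ≠ t → y z ≠ 0 ∨ deriv y z ≠ 0)
    {G : ℂ → ℂ} {m : ℕ} (hG : AnalyticAt ℂ G t) (hGt : G t ≠ 0)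
    (hyG : ∀ᶠ z in 𝓝 t, y z = (z - t) ^ m * G z)
    (H : ∀ K ⊆ U, IsCompact K → ∀ ε > 0, ∀ᶠ n in atTop, ∀ z ∈ K, z ≠ t →
      0 < √(‖value (derivCoeff q₀ q₁ n).1 z‖ ^ 2 + ‖value (derivCoeff q₀ q₁ n).2 z‖ ^ 2) ∧
      ‖iteratedDeriv n y z‖ ≤ ε *
        (√(‖value (derivCoeff q₀ q₁ n).1 z‖ ^ 2 + ‖value (derivCoeff q₀ q₁ n).2 z‖ ^ 2) *
          √(‖deriv y z‖ ^ 2 + ‖y z‖ ^ 2))) :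
    (∀ᶠ n in atTop, (derivCoeff q₀ q₁ n).2 ≠ 0) ∧
      ConvergesOnCompacts (fun n => (derivCoeff q₀ q₁ n).1 / (derivCoeff q₀ q₁ n).2)
        (fun z => -(deriv y z / y z)) {z | y z = 0} U := by
  classical
  -- At one point with `y z ≠ 0`, a vanishing `q_{1,n}` would give `y^{(n)} = q_{0,n} y`, and the
  -- chosen `ε` would force `|q_{0,n} y| ≤ |q_{0,n} y| / 2` with `q_{0,n}` nonzero there.
  have hne : ∀ᶠ n in atTop, (derivCoeff q₀ q₁ n).2 ≠ 0 := by
    have h1 : ∀ᶠ z in 𝓝[≠] t, z ∈ U ∧ z ≠ t ∧ y z ≠ 0 := by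
      filter_upwards [nhdsWithin_le_nhds (hU.mem_nhds htU), nhdsWithin_le_nhds hyG,
        nhdsWithin_le_nhds (hG.continuousAt.eventually_ne hGt), self_mem_nhdsWithin]
        with z h1 h2 h3 h4
      exact ⟨h1, h4, by rw [h2]; exact mul_ne_zero (pow_ne_zero _ (sub_ne_zero.2 h4)) h3⟩
    obtain ⟨z, hzU, hzt, hz0⟩ := h1.exists
    have hN := sqrt_norm_sq_add_pos (hy0 z hzU hzt).symm
    have hz0' : 0 < ‖y z‖ := norm_pos_iff.2 hz0
    filter_upwards [H {z} (by simpa using hzU) isCompact_singleton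
      (‖y z‖ / (2 * √(‖deriv y z‖ ^ 2 + ‖y z‖ ^ 2))) (by positivity)] with n hn h0
    obtain ⟨h2, h3⟩ := hn z rfl hzt
    rw [hy.iteratedDeriv_eq hU n hzU (hUS z hzU hzt)] at h3
    simp only [h0, value_zero, norm_zero, zero_mul, add_zero, ne_eq, OfNat.ofNat_ne_zero,
      not_false_eq_true, zero_pow, Real.sqrt_sq (norm_nonneg _), norm_mul] at h2 h3
    field_simp at h3
    linarith
  refine ⟨hne, ConvergesOnCompacts.of_spherical ?_ fun K hK hKc ε hε => ?_⟩
  · exact (((hy.1.deriv hU).continuousOn.mono Set.sdiff_subset).div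
      (hy.1.continuousOn.mono Set.sdiff_subset) fun z hz => hz.2).neg
  -- A disc about `t` is added to `K` so that, even if `t` is isolated in `K`, the bound is
  -- available at points tending to `t`.
  obtain ⟨ρ, hρ, hρU⟩ := Metric.nhds_basis_closedBall.mem_iff.1 (hU.mem_nhds htU)
  obtain ⟨c, d, hc, hd, hcd, hev⟩ := exists_homogeneous_logDeriv hG hGt hyG
  filter_upwards [hne, H (K ∪ Metric.closedBall t ρ) (Set.union_subset hK hρU)
    (hKc.union (isCompact_closedBall t ρ)) (ε / 4) (by positivity)] with n hn hHn
  have hoff : ∀ z ∈ K ∪ Metric.closedBall t ρ, z ≠ t →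
      chordalDist (sphereValue ((derivCoeff q₀ q₁ n).1 / (derivCoeff q₀ q₁ n).2) z)
        (if y z = 0 then OnePoint.infty else OnePoint.some (-(deriv y z / y z))) ≤ ε / 2 := by
    intro z hz hzt
    have hzU : z ∈ U := Set.union_subset hK hρU hz
    obtain ⟨h1, h2⟩ := hHn z hz hzt
    have hp := not_isPole_derivCoeff (hUS z hzU hzt) n
    have hy0' := hy0 z hzU hzt
    have hN := sqrt_norm_sq_add_pos hy0'.symm
    have e1 : (if y z = 0 then OnePoint.infty else OnePoint.some (-(deriv y z / y z))) =
        ofHomogeneous (-deriv y z) (y z) := by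
      unfold ofHomogeneous
      rw [neg_div]
    have hcd' : -deriv y z ≠ 0 ∨ y z ≠ 0 := by simpa using hy0'.symm
    rw [e1, sphereValue_div hn hp.1 hp.2 (ne_zero_or_ne_zero_of_sqrt_pos h1),
      chordalDist_ofHomogeneous (ne_zero_or_ne_zero_of_sqrt_pos h1) hcd', norm_neg,
      div_le_iff₀ (mul_pos h1 hN), mul_neg, sub_neg_eq_add,
      ← hy.iteratedDeriv_eq hU n hzU (hUS z hzU hzt)]
    linarith
  intro z hz
  change chordalDist (sphereValue ((derivCoeff q₀ q₁ n).1 / (derivCoeff q₀ q₁ n).2) z)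
    (if y z = 0 then OnePoint.infty else OnePoint.some (-(deriv y z / y z))) < ε
  by_cases hzt : z = t
  swap
  · exact (hoff z (Or.inl hz) hzt).trans_lt (by linarith)
  subst hzt
  refine lt_of_le_of_lt ?_ (half_lt_self hε)
  set f := (derivCoeff q₀ q₁ n).1 / (derivCoeff q₀ q₁ n).2 with hf
  have hcd1 : ∀ᶠ w in 𝓝 z, c w ≠ 0 ∨ d w ≠ 0 := by
    rcases hcd with h | h
    · filter_upwards [hc.eventually_ne h] with w hw using Or.inl hw
    · filter_upwards [hd.eventually_ne h] with w hw using Or.inr hw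
  -- At `t` itself the coefficients may have poles. The distance is written in coordinates
  -- continuous at `t`, namely the reduced numerator and denominator of `f` and the pair `c`, `d`,
  -- so the bound off `t` passes to the limit.
  have hfm : ∀ᶠ w in 𝓝 z, chordalDist (sphereValue f w)
        (if y w = 0 then OnePoint.infty else OnePoint.some (-(deriv y w / y w))) =
      2 * ‖f.num.eval w * d w - f.denom.eval w * c w‖ /
        (√(‖f.num.eval w‖ ^ 2 + ‖f.denom.eval w‖ ^ 2) * √(‖c w‖ ^ 2 + ‖d w‖ ^ 2)) := by
    filter_upwards [hev, hcd1] with w hw hw1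
    rw [hw, sphereValue_eq_ofHomogeneous,
      chordalDist_ofHomogeneous (num_eval_or_denom_eval_ne_zero f w) hw1]
  rw [hfm.self_of_nhds]
  have hcont : ContinuousAt (fun w => 2 * ‖f.num.eval w * d w - f.denom.eval w * c w‖ /
        (√(‖f.num.eval w‖ ^ 2 + ‖f.denom.eval w‖ ^ 2) * √(‖c w‖ ^ 2 + ‖d w‖ ^ 2))) z := by
    have hn' : ContinuousAt (fun w => f.num.eval w) z := f.num.continuous.continuousAt
    have hd' : ContinuousAt (fun w => f.denom.eval w) z := f.denom.continuous.continuousAt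
    refine ContinuousAt.div (by fun_prop) (by fun_prop) ?_
    exact (mul_pos (sqrt_norm_sq_add_pos (num_eval_or_denom_eval_ne_zero f z))
      (sqrt_norm_sq_add_pos hcd)).ne'
  refine le_of_tendsto (hcont.tendsto.mono_left (nhdsWithin_le_nhds (s := {z}ᶜ))) ?_
  filter_upwards [nhdsWithin_le_nhds hfm, nhdsWithin_le_nhds (Metric.closedBall_mem_nhds z hρ),
    self_mem_nhdsWithin] with w h1 h2 h3
  rw [← h1]
  exact hoff w (Or.inr h2) h3

end Perron

namespace Perron

/-! ### Branches of the logarithm and the second local solution -/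

/-- `ℓ` is a branch of `log (w - t)` on the open set `V`, with bounded imaginary part. -/
structure IsLogBranch (t : ℂ) (V : Set ℂ) (ℓ : ℂ → ℂ) : Prop where
  isOpen : IsOpen V
  exp_eq : ∀ w ∈ V, Complex.exp (ℓ w) = w - t
  hasDerivAt : ∀ w ∈ V, HasDerivAt ℓ (1 / (w - t)) w
  abs_im_le : ∀ w ∈ V, |(ℓ w).im| ≤ 2 * Real.pi

/-- The plane cut along the ray from `t` in the direction `-α`. -/
def slitPlaneAt (t α : ℂ) : Set ℂ := {w | (w - t) / α ∈ Complex.slitPlane}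

theorem isLogBranch_slitPlaneAt (t : ℂ) {α : ℂ} (hα : α ≠ 0) :
    IsLogBranch t (slitPlaneAt t α) fun w => Complex.log ((w - t) / α) + Complex.log α where
  isOpen := Complex.isOpen_slitPlane.preimage (by fun_prop : Continuous fun w => (w - t) / α)
  exp_eq w hw := by
    rw [Complex.exp_add, Complex.exp_log (Complex.slitPlane_ne_zero hw), Complex.exp_log hα,
      div_mul_cancel₀ _ hα]
  hasDerivAt w hw := by
    have h1 : HasDerivAt (fun w => (w - t) / α) (1 / α) w :=
      ((hasDerivAt_id w).sub_const t).div_const α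
    have h2 := (h1.clog hw).add_const (Complex.log α)
    have h3 : w - t ≠ 0 := fun h => Complex.slitPlane_ne_zero hw (by simp [h])
    convert! h2 using 1
    field_simp
  abs_im_le w _ := by
    rw [Complex.add_im]
    have h1 := Complex.abs_arg_le_pi ((w - t) / α)
    have h2 := Complex.abs_arg_le_pi α
    rw [← Complex.log_im] at h1 h2
    exact (abs_add_le _ _).trans (by linarith)

namespace IsLogBranch

variable {t : ℂ} {V : Set ℂ} {ℓ : ℂ → ℂ} {w : ℂ}

theorem mono (h : IsLogBranch t V ℓ) {W : Set ℂ} (hW : IsOpen W) (hWV : W ⊆ V) :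
    IsLogBranch t W ℓ :=
  ⟨hW, fun w hw => h.exp_eq w (hWV hw), fun w hw => h.hasDerivAt w (hWV hw),
    fun w hw => h.abs_im_le w (hWV hw)⟩

theorem sub_ne_zero (h : IsLogBranch t V ℓ) (hw : w ∈ V) : w - t ≠ 0 := by
  rw [← h.exp_eq w hw]; exact Complex.exp_ne_zero _

theorem exp_natCast_mul (h : IsLogBranch t V ℓ) (hw : w ∈ V) (n : ℕ) :
    Complex.exp (n * ℓ w) = (w - t) ^ n := by
  rw [Complex.exp_nat_mul, h.exp_eq w hw]

theorem exp_sub_one_mul (h : IsLogBranch t V ℓ) (hw : w ∈ V) (s : ℂ) :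
    Complex.exp ((s - 1) * ℓ w) = Complex.exp (s * ℓ w) / (w - t) := by
  rw [sub_mul, one_mul, Complex.exp_sub, h.exp_eq w hw]

theorem hasDerivAt_exp (h : IsLogBranch t V ℓ) (hw : w ∈ V) (s : ℂ) :
    HasDerivAt (fun w => Complex.exp (s * ℓ w)) (s * Complex.exp ((s - 1) * ℓ w)) w := by
  have := ((h.hasDerivAt w hw).const_mul s).cexp
  rw [h.exp_sub_one_mul hw]
  convert! this using 1
  ring

theorem re_eq (h : IsLogBranch t V ℓ) (hw : w ∈ V) : (ℓ w).re = Real.log ‖w - t‖ := by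
  rw [← h.exp_eq w hw, Complex.norm_exp, Real.log_exp]

theorem norm_exp (h : IsLogBranch t V ℓ) (hw : w ∈ V) (s : ℂ) :
    ‖Complex.exp (s * ℓ w)‖ = ‖w - t‖ ^ s.re * Real.exp (-(s.im * (ℓ w).im)) := by
  rw [Complex.norm_exp, Complex.mul_re, h.re_eq hw,
    Real.rpow_def_of_pos (norm_pos_iff.2 (h.sub_ne_zero hw)), ← Real.exp_add]
  congr 1
  ring

theorem norm_exp_le (h : IsLogBranch t V ℓ) (hw : w ∈ V) (s : ℂ) :
    ‖Complex.exp (s * ℓ w)‖ ≤ Real.exp (|s.im| * (2 * Real.pi)) * ‖w - t‖ ^ s.re := by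
  rw [h.norm_exp hw, mul_comm]
  gcongr
  calc -(s.im * (ℓ w).im) ≤ |s.im * (ℓ w).im| := neg_le_abs _
    _ = |s.im| * |(ℓ w).im| := abs_mul _ _
    _ ≤ _ := by gcongr; exact h.abs_im_le w hw

theorem le_norm_exp (h : IsLogBranch t V ℓ) (hw : w ∈ V) (s : ℂ) :
    Real.exp (-(|s.im| * (2 * Real.pi))) * ‖w - t‖ ^ s.re ≤ ‖Complex.exp (s * ℓ w)‖ := by
  rw [h.norm_exp hw, mul_comm]
  refine mul_le_mul_of_nonneg_left (Real.exp_le_exp.2 (neg_le_neg ?_)) (by positivity)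
  calc s.im * (ℓ w).im ≤ |s.im * (ℓ w).im| := le_abs_self _
    _ = |s.im| * |(ℓ w).im| := abs_mul _ _
    _ ≤ _ := by gcongr; exact h.abs_im_le w hw

/-- A logarithm grows more slowly than `1 / |w - t|`. -/
theorem norm_le (h : IsLogBranch t V ℓ) (hw : w ∈ V) (hw1 : ‖w - t‖ ≤ 1) :
    ‖ℓ w‖ ≤ (1 + 2 * Real.pi) * ‖w - t‖⁻¹ := by
  have hpos := norm_pos_iff.2 (h.sub_ne_zero hw)
  have h1 : 1 ≤ ‖w - t‖⁻¹ := (one_le_inv₀ hpos).2 hw1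
  have h2 : |(ℓ w).re| ≤ ‖w - t‖⁻¹ := by
    rw [h.re_eq hw, abs_of_nonpos (Real.log_nonpos hpos.le hw1), ← Real.log_inv]
    exact (Real.log_le_sub_one_of_pos (by positivity)).trans (by linarith)
  calc ‖ℓ w‖ ≤ |(ℓ w).re| + |(ℓ w).im| := Complex.norm_le_abs_re_add_abs_im _
    _ ≤ ‖w - t‖⁻¹ + 2 * Real.pi * ‖w - t‖⁻¹ := by
        gcongr
        exact (h.abs_im_le w hw).trans (le_mul_of_one_le_right (by positivity) h1)
    _ = _ := by ring

end IsLogBranch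

/-- The Euler equation `X κ' + τ κ = k`, solved up to a possible resonant monomial. -/
theorem exists_euler_solution {t : ℂ} {R ρ : ℝ} (hρ : 0 < ρ) (hρR : ρ < R) {k : ℂ → ℂ}
    (hk : DifferentiableOn ℂ k (Metric.ball t R)) (τ : ℂ) :
    ∃ (κ : ℂ → ℂ) (c : ℂ) (j : ℕ), DifferentiableOn ℂ κ (Metric.ball t ρ) ∧ (c = 0 ∨ τ = -j) ∧
      ∀ w ∈ Metric.ball t ρ, (w - t) * deriv κ w + τ * κ w = k w - c * (w - t) ^ j := by
  set a : ℕ → ℂ := fun n => (n.factorial : ℂ)⁻¹ * iteratedDeriv n k t with ha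
  have hsumk : ∀ w ∈ Metric.ball t R, HasSum (fun n => a n * (w - t) ^ n) (k w) := by
    intro w hw
    have := Complex.hasSum_taylorSeries_on_ball hk hw
    convert! this using 2
    simp [ha, mul_assoc, mul_comm, mul_left_comm]
  have hsum : Summable fun n => ‖a n‖ * ρ ^ n := by
    have h1 : t + (ρ : ℂ) ∈ Metric.ball t R := by
      simpa [mem_ball_iff_norm, abs_of_pos hρ] using hρR
    have := (hsumk _ h1).summable.norm
    simpa [abs_of_pos hρ] using this
  -- For `n > ‖τ‖ + 1` the norm exceeds `1`, so only finitely many `n` matter.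
  obtain ⟨δ, hδ, hδτ⟩ : ∃ δ > 0, ∀ n : ℕ, (τ + n ≠ 0) → δ ≤ ‖τ + n‖ := by
    obtain ⟨N, hN⟩ := exists_nat_gt (‖τ‖ + 1)
    have hfin : ∀ M : ℕ, ∃ δ > 0, δ ≤ 1 ∧ ∀ n : ℕ, n < M → τ + n ≠ 0 → δ ≤ ‖τ + n‖ := by
      intro M
      induction M with
      | zero => exact ⟨1, one_pos, le_rfl, fun n hn => absurd hn (Nat.not_lt_zero n)⟩
      | succ M ih =>
        obtain ⟨δ, hδ, hδ1, h⟩ := ih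
        by_cases hM : τ + M = 0
        · refine ⟨δ, hδ, hδ1, fun n hn hn0 => ?_⟩
          rcases Nat.lt_succ_iff_lt_or_eq.1 hn with h' | rfl
          · exact h n h' hn0
          · exact absurd hM hn0
        · refine ⟨min δ ‖τ + M‖, lt_min hδ (norm_pos_iff.2 hM), (min_le_left _ _).trans hδ1,
            fun n hn hn0 => ?_⟩
          rcases Nat.lt_succ_iff_lt_or_eq.1 hn with h' | rfl
          · exact (min_le_left _ _).trans (h n h' hn0)
          · exact min_le_right _ _
    obtain ⟨δ, hδ, hδ1, h⟩ := hfin N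
    refine ⟨δ, hδ, fun n hn0 => ?_⟩
    rcases lt_or_ge n N with h' | h'
    · exact h n h' hn0
    · have h1 : (N : ℝ) ≤ n := by exact_mod_cast h'
      have h2 : ‖(n : ℂ)‖ ≤ ‖τ + n‖ + ‖τ‖ := by
        have := norm_sub_le (τ + n) τ
        rwa [add_sub_cancel_left] at this
      rw [Complex.norm_natCast] at h2
      linarith
  -- Division by zero gives `0`, so a resonant term is dropped here and returns as the monomial `c *
  -- (w - t) ^ j`.
  set F : ℕ → ℂ → ℂ := fun n w => a n / (τ + n) * (w - t) ^ n with hF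
  have hFd : ∀ n, DifferentiableOn ℂ (F n) (Metric.ball t ρ) := fun n => by
    simp only [hF]; fun_prop
  have hcoef : ∀ n, ‖a n / (τ + n)‖ ≤ δ⁻¹ * ‖a n‖ := by
    intro n
    by_cases h0 : τ + n = 0
    · rw [h0, div_zero, norm_zero]; positivity
    · rw [norm_div, div_eq_inv_mul]
      have := hδτ n h0
      gcongr
  have hFle : ∀ n, ∀ w ∈ Metric.ball t ρ, ‖F n w‖ ≤ δ⁻¹ * (‖a n‖ * ρ ^ n) := by
    intro n w hw
    rw [mem_ball_iff_norm] at hw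
    simp only [hF, norm_mul, norm_pow]
    calc _ ≤ (δ⁻¹ * ‖a n‖) * ρ ^ n := by
          gcongr
          exact hcoef n
      _ = _ := by ring
  have hsum' := hsum.mul_left δ⁻¹
  obtain ⟨c, j, hcj, hterm⟩ : ∃ (c : ℂ) (j : ℕ), (c = 0 ∨ τ = -j) ∧ ∀ n w,
      a n / (τ + n) * (τ + n) * (w - t) ^ n =
        a n * (w - t) ^ n - if n = j then c * (w - t) ^ j else 0 := by
    by_cases h : ∃ j : ℕ, τ + j = 0
    · obtain ⟨j, hj⟩ := h
      refine ⟨a j, j, Or.inr (eq_neg_of_add_eq_zero_left hj), fun n w => ?_⟩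
      by_cases hnj : n = j
      · subst hnj; simp [hj]
      · have : τ + n ≠ 0 := by
          intro h0
          apply hnj
          have : (n : ℂ) = j := by linear_combination h0 - hj
          exact_mod_cast this
        rw [div_mul_cancel₀ _ this, if_neg hnj, sub_zero]
    · rw [not_exists] at h
      refine ⟨0, 0, Or.inl rfl, fun n w => ?_⟩
      rw [div_mul_cancel₀ _ (h n)]
      simp
  refine ⟨fun w => ∑' n, F n w, c, j,
    Complex.differentiableOn_tsum_of_summable_norm hsum' hFd Metric.isOpen_ball hFle, hcj, ?_⟩
  intro w hw
  have h1 := (Complex.hasSum_deriv_of_summable_norm hsum' hFd Metric.isOpen_ball hFle hw).mul_left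
    (w - t)
  have h2 : HasSum (fun n => F n w) (∑' n, F n w) :=
    (Summable.of_norm_bounded hsum' fun n => hFle n w hw).hasSum
  have h3 := h1.add (h2.mul_left τ)
  have h4 := (hsumk w (Metric.ball_subset_ball hρR.le hw)).sub
    (hasSum_ite_eq j (c * (w - t) ^ j))
  refine h3.unique ?_
  convert! h4 using 2 with n
  rw [← hterm]
  have hd : deriv (F n) w = a n / (τ + n) * (n * (w - t) ^ (n - 1)) := by
    have := (((hasDerivAt_id w).sub_const t).pow n).const_mul (a n / (τ + n))
    refine this.deriv.trans ?_
    simp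
  rw [hd]
  simp only [hF]
  rcases n with _ | n
  · simp; ring
  · rw [Nat.add_sub_cancel, pow_succ]; ring

/-- Reduction of order: `g * Y` is a solution when `Y' = W / g²` and `W' = q₁ W`. Regularity of `q₁`
gives `W = (w - t)^{p t} exp C`, so `Y' = (w - t)^(τ - 1) k` with `k` holomorphic, and `Y = (w -
t)^τ κ + c log (w - t)` by the Euler equation. The data `H`, `s`, `c` do not depend on the branch,
and the final inequality, a nonzero Wronskian, expresses independence of `g`. -/
theorem exists_second_solution {q₀ q₁ : RatFunc ℂ} {t : ℂ} {R : ℝ} (hR : 0 < R)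
    (hS : ∀ z ∈ Metric.ball t R, z ≠ t → z ∉ singularSet q₀ q₁)
    (hreg : ¬ IsPole ((RatFunc.X - RatFunc.C t) * q₁) t)
    {g G : ℂ → ℂ} {m : ℕ} (hg : IsSolutionOn q₀ q₁ (Metric.ball t R) g)
    (hG : DifferentiableOn ℂ G (Metric.ball t R)) (hG0 : ∀ z ∈ Metric.ball t R, G z ≠ 0)
    (hgG : ∀ z ∈ Metric.ball t R, g z = (z - t) ^ m * G z) :
    ∃ ρ : ℝ, 0 < ρ ∧ ρ < R ∧ ∃ (H : ℂ → ℂ) (s c : ℂ), DifferentiableOn ℂ H (Metric.ball t ρ) ∧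
      ((∀ n : ℕ, s ≠ n) → H t ≠ 0 ∧ (c = 0 ∨ ∃ p : ℕ, 1 ≤ p ∧ s = -p)) ∧
      ∀ (V : Set ℂ) (ℓ : ℂ → ℂ), IsLogBranch t V ℓ → V ⊆ Metric.ball t ρ →
        IsSolutionOn q₀ q₁ V (fun w => Complex.exp (s * ℓ w) * H w + c * (g w * ℓ w)) ∧
        ∀ w ∈ V, g w * deriv (fun w => Complex.exp (s * ℓ w) * H w + c * (g w * ℓ w)) w -
          deriv g w * (Complex.exp (s * ℓ w) * H w + c * (g w * ℓ w)) ≠ 0 := by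
  have hB := Metric.isOpen_ball (x := t) (ε := R)
  have htB : t ∈ Metric.ball t R := Metric.mem_ball_self hR
  have hXt : ∀ z : ℂ, ¬ IsPole (RatFunc.X - RatFunc.C t) z := fun z => by
    rw [sub_eq_add_neg]
    exact not_isPole_add (not_isPole_X z) (not_isPole_neg (not_isPole_C t z))
  set p : ℂ → ℂ := value ((RatFunc.X - RatFunc.C t) * q₁) with hp
  have hpd : DifferentiableOn ℂ p (Metric.ball t R) := by
    refine differentiableOn_value fun z hz => ?_
    by_cases hzt : z = t
    · rwa [hzt]
    · exact not_isPole_mul (hXt z) fun h => hS z hz hzt (Or.inr h)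
  have hpv : ∀ z ∈ Metric.ball t R, z ≠ t → p z = (z - t) * value q₁ z := by
    intro z hz hzt
    rw [hp, value_mul (hXt z) fun h => hS z hz hzt (Or.inr h), sub_eq_add_neg,
      value_add (not_isPole_X z) (not_isPole_neg (not_isPole_C t z)), value_neg (not_isPole_C t z),
      value_X, value_C, sub_eq_add_neg]
  obtain ⟨C, hC⟩ := ((Complex.differentiableOn_dslope (hB.mem_nhds htB)).2 hpd).isExactOn_ball
  set k : ℂ → ℂ := fun w => Complex.exp (C w) / G w ^ 2 with hk
  have hkd : DifferentiableOn ℂ k (Metric.ball t R) := fun w hw =>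
    (((hC w hw).differentiableAt.cexp).div
      ((hG.differentiableAt (hB.mem_nhds hw)).pow 2)
      (pow_ne_zero 2 (hG0 w hw))).differentiableWithinAt
  have hk0 : k t ≠ 0 := div_ne_zero (Complex.exp_ne_zero _) (pow_ne_zero 2 (hG0 t htB))
  set τ : ℂ := p t - 2 * m + 1 with hτ
  obtain ⟨κ, c, j, hκ, hcj, hκe⟩ := exists_euler_solution (ρ := R / 2) (by linarith) (by linarith)
    hkd τ
  have hsub : Metric.ball t (R / 2) ⊆ Metric.ball t R := Metric.ball_subset_ball (by linarith)
  refine ⟨R / 2, by linarith, by linarith, fun w => G w * κ w, τ + m, c, (hG.mono hsub).mul hκ,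
    fun hs => ?_, fun V ℓ hℓ hV => ?_⟩
  -- If `τ = -j`, then `s = m - j`, which is not natural only if `j > m`; the resonant monomial then
  -- vanishes at `t`, so `τ κ(t) = k(t) ≠ 0`.
  · have h1 := hκe t (Metric.mem_ball_self (by linarith))
    rw [sub_self, zero_mul, zero_add] at h1
    have h2 : c = 0 ∨ ∃ p : ℕ, 1 ≤ p ∧ j = m + p := by
      refine hcj.imp_right fun hj => ?_
      have hmj : m < j := by
        by_contra hcon
        obtain ⟨n, rfl⟩ := Nat.exists_eq_add_of_le (not_lt.1 hcon)
        exact hs n (by rw [hj]; push_cast; ring)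
      exact ⟨j - m, by omega, by omega⟩
    refine ⟨mul_ne_zero (hG0 t htB) fun h0 => hk0 ?_, ?_⟩
    · rw [h0, mul_zero] at h1
      rcases h2 with h2 | ⟨p, hp1, hp2⟩
      · simpa [h2] using h1.symm
      · rw [hp2, zero_pow (by omega), mul_zero, sub_zero] at h1
        exact h1.symm
    · rcases h2 with h2 | ⟨n, hn1, hn2⟩
      · exact Or.inl h2
      · refine hcj.imp_right fun hj => ⟨n, hn1, ?_⟩
        rw [hj, hn2]
        push_cast
        ring
  · set Y : ℂ → ℂ := fun w => Complex.exp (τ * ℓ w) * κ w + c * ℓ w with hY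
    set W : ℂ → ℂ := fun w => Complex.exp (p t * ℓ w) * Complex.exp (C w) with hW
    have hVR : V ⊆ Metric.ball t R := hV.trans hsub
    have hne : ∀ w ∈ V, w ≠ t := fun w hw => sub_ne_zero.1 (hℓ.sub_ne_zero hw)
    have hg0 : ∀ w ∈ V, g w ≠ 0 := fun w hw => by
      rw [hgG w (hVR hw)]
      exact mul_ne_zero (pow_ne_zero _ (hℓ.sub_ne_zero hw)) (hG0 w (hVR hw))
    have hYd : ∀ w ∈ V, HasDerivAt Y (W w / g w ^ 2) w := by
      intro w hw
      have hX := hℓ.sub_ne_zero hw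
      have h1 := ((hℓ.hasDerivAt_exp hw τ).mul
        (hκ.differentiableAt (Metric.isOpen_ball.mem_nhds (hV hw))).hasDerivAt).add
        ((hℓ.hasDerivAt w hw).const_mul c)
      convert! h1 using 1
      have e1 : W w / g w ^ 2 = Complex.exp (τ * ℓ w) / (w - t) * k w := by
        have e2 : Complex.exp (τ * ℓ w) = Complex.exp (p t * ℓ w) * (w - t) / (w - t) ^ (2 * m) := by
          rw [← hℓ.exp_natCast_mul hw, ← hℓ.exp_eq w hw, ← Complex.exp_add, ← Complex.exp_sub]
          congr 1
          rw [hτ]; push_cast; ring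
        have hG0' := hG0 w (hVR hw)
        rw [e2, hgG w (hVR hw), mul_pow, ← pow_mul, mul_comm m 2]
        simp only [hW, hk]
        field_simp
      have e3 : c * Complex.exp (τ * ℓ w) * (w - t) ^ j = c := by
        rcases hcj with h | h
        · simp [h]
        · rw [← hℓ.exp_natCast_mul hw, mul_assoc, ← Complex.exp_add, h]
          simp
      rw [e1, hℓ.exp_sub_one_mul hw]
      have e4 := hκe w (hV hw)
      have e5 : k w = (w - t) * deriv κ w + τ * κ w + c * (w - t) ^ j := by linear_combination -e4
      rw [e5]
      field_simp
      linear_combination e3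
    have hWd : ∀ w ∈ V, HasDerivAt W (value q₁ w * W w) w := by
      intro w hw
      have hX := hℓ.sub_ne_zero hw
      have h1 := (hℓ.hasDerivAt_exp hw (p t)).mul (hC w (hVR hw)).cexp
      convert! h1 using 1
      have e1 : dslope p t w = (p w - p t) / (w - t) := by
        rw [dslope_of_ne _ (hne w hw), slope_def_field]
      rw [e1, hpv w (hVR hw) (hne w hw), hℓ.exp_sub_one_mul hw]
      simp only [hW]
      field_simp
      ring
    have hgd : ∀ w ∈ V, HasDerivAt g (deriv g w) w := fun w hw =>
      (hg.1.differentiableAt (hB.mem_nhds (hVR hw))).hasDerivAt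
    have hgdd : ∀ w ∈ V, HasDerivAt (deriv g) (value q₀ w * g w + value q₁ w * deriv g w) w := by
      intro w hw
      rw [← hg.2 w (hVR hw) (hS w (hVR hw) (hne w hw))]
      exact ((hg.1.deriv hB).differentiableAt (hB.mem_nhds (hVR hw))).hasDerivAt
    have heq : Set.EqOn (fun w => Complex.exp ((τ + m) * ℓ w) * (G w * κ w) + c * (g w * ℓ w))
        (fun w => g w * Y w) V := by
      intro w hw
      simp only [hY]
      rw [add_mul, Complex.exp_add, hℓ.exp_natCast_mul hw, hgG w (hVR hw)]
      ring
    have hu : ∀ w ∈ V, HasDerivAt (fun w => g w * Y w) (deriv g w * Y w + W w / g w) w := by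
      intro w hw
      have h1 := (hgd w hw).mul (hYd w hw)
      have := hg0 w hw
      convert! h1 using 1
      field_simp
    have hsol : IsSolutionOn q₀ q₁ V (fun w => g w * Y w) := by
      refine isSolutionOn_of_hasDerivAt hℓ.isOpen hu fun w hw => ?_
      have h1 := ((hgdd w hw).mul (hYd w hw)).add ((hWd w hw).div (hgd w hw) (hg0 w hw))
      have := hg0 w hw
      convert! h1 using 1
      field_simp
      ring
    refine ⟨hsol.congr hℓ.isOpen heq, fun w hw => ?_⟩
    have h1 : (fun w => Complex.exp ((τ + m) * ℓ w) * (G w * κ w) + c * (g w * ℓ w)) =ᶠ[𝓝 w]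
        (fun w => g w * Y w) := heq.eventuallyEq_of_mem (hℓ.isOpen.mem_nhds hw)
    have h2 : Complex.exp ((τ + m) * ℓ w) * (G w * κ w) + c * (g w * ℓ w) = g w * Y w := heq hw
    rw [h1.deriv_eq, h2, (hu w hw).deriv]
    have h3 : g w * (deriv g w * Y w + W w / g w) - deriv g w * (g w * Y w) = W w := by
      have := hg0 w hw
      field_simp
      ring
    rw [h3]
    exact mul_ne_zero (Complex.exp_ne_zero _) (Complex.exp_ne_zero _)

end Perron

namespace Perron

/-! ### Local singular forms -/

/-- On `V`, the function `F` is `(w - t) ^ (-P) * B w`, up to a logarithmic term that occurs only if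
the exponent `-P` is a negative integer; `-P` is not a natural number and `B t ≠ 0`. -/
def HasSingularForm (t : ℂ) (ρ : ℝ) (V : Set ℂ) (ℓ : ℂ → ℂ) (P : ℂ) (F : ℂ → ℂ) : Prop :=
  ∃ (c : ℂ) (B ψ : ℂ → ℂ), DifferentiableOn ℂ B (Metric.ball t ρ) ∧
    DifferentiableOn ℂ ψ (Metric.ball t ρ) ∧ B t ≠ 0 ∧ (c = 0 ∨ ∃ p : ℕ, 1 ≤ p ∧ P = p) ∧
    (∀ n : ℕ, P ≠ -n) ∧ ∀ w ∈ V, F w = Complex.exp (-P * ℓ w) * B w + c * (ψ w * ℓ w)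

variable {t : ℂ} {ρ : ℝ} {V : Set ℂ} {ℓ : ℂ → ℂ} {P : ℂ} {F : ℂ → ℂ}

/-- The new leading coefficient is `-P * B t`, nonzero since `P ≠ 0`. The term `c ψ / (w - t)` from
the logarithm is absorbed into `B` with the factor `(w - t) ^ p`, which vanishes at `t` as `p ≥ 1`.
-/
theorem HasSingularForm.hasSingularForm_deriv (hℓ : IsLogBranch t V ℓ) (hV : V ⊆ Metric.ball t ρ)
    (hF : HasSingularForm t ρ V ℓ P F) : HasSingularForm t ρ V ℓ (P + 1) (deriv F) := by
  obtain ⟨c, B, ψ, hB, hψ, hBt, hc, hP, hFe⟩ := hF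
  have hball := Metric.isOpen_ball (x := t) (ε := ρ)
  have hder : ∀ w ∈ V, deriv F w = Complex.exp (-(P + 1) * ℓ w) * (-P * B w + (w - t) * deriv B w) +
      c * (deriv ψ w * ℓ w) + c * (ψ w * (1 / (w - t))) := by
    intro w hw
    have h1 : F =ᶠ[𝓝 w] fun w => Complex.exp (-P * ℓ w) * B w + c * (ψ w * ℓ w) := by
      filter_upwards [hℓ.isOpen.mem_nhds hw] with x hx using hFe x hx
    have h2 := ((hℓ.hasDerivAt_exp hw (-P)).mul
      (hB.differentiableAt (hball.mem_nhds (hV hw))).hasDerivAt).add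
      (((hψ.differentiableAt (hball.mem_nhds (hV hw))).hasDerivAt.mul
        (hℓ.hasDerivAt w hw)).const_mul c)
    rw [h1.deriv_eq]
    refine h2.deriv.trans ?_
    have hX := hℓ.sub_ne_zero hw
    rw [show -(P + 1) = -P - 1 by ring, hℓ.exp_sub_one_mul hw]
    field_simp
    ring
  have hP0 : P ≠ 0 := by simpa using hP 0
  have hP' : ∀ n : ℕ, P + 1 ≠ -n := fun n h => hP (n + 1) (by push_cast; linear_combination h)
  have hdB : DifferentiableOn ℂ (fun w => -P * B w + (w - t) * deriv B w) (Metric.ball t ρ) := by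
    have := hB.deriv hball
    fun_prop
  rcases hc with rfl | ⟨p, hp1, rfl⟩
  · refine ⟨0, _, _, hdB, hψ.deriv hball, ?_, Or.inl rfl, hP', fun w hw => ?_⟩
    · simp [hP0, hBt]
    · rw [hder w hw]; ring
  · refine ⟨c, fun w => -p * B w + (w - t) * deriv B w + c * (w - t) ^ p * ψ w, _,
      hdB.add (by fun_prop), hψ.deriv hball, ?_, Or.inr ⟨p + 1, by omega, by push_cast; ring⟩, hP',
      fun w hw => ?_⟩
    · simp [hP0, hBt, show p ≠ 0 by omega]
    · have hX := hℓ.sub_ne_zero hw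
      have e1 : Complex.exp (-((p : ℂ) + 1) * ℓ w) * (w - t) ^ p = 1 / (w - t) := by
        rw [← hℓ.exp_natCast_mul hw, ← Complex.exp_add, one_div, ← hℓ.exp_eq w hw,
          ← Complex.exp_neg]
        congr 1
        ring
      rw [hder w hw, ← e1]
      ring

theorem HasSingularForm.hasSingularForm_iteratedDeriv (hℓ : IsLogBranch t V ℓ)
    (hV : V ⊆ Metric.ball t ρ) (hF : HasSingularForm t ρ V ℓ P F) (n : ℕ) :
    HasSingularForm t ρ V ℓ (P + n) (iteratedDeriv n F) := by
  induction n with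
  | zero => simpa using hF
  | succ n ih =>
    rw [iteratedDeriv_succ]
    have := ih.hasSingularForm_deriv hℓ hV
    rwa [add_assoc, ← Nat.cast_add_one] at this

/-- The threshold `3` makes `2 - Re P ≤ -1`, so that the logarithmic term is of the order of the
remainder. -/
theorem HasSingularForm.exists_three_le_re (hℓ : IsLogBranch t V ℓ)
    (hV : V ⊆ Metric.ball t ρ) (hF : HasSingularForm t ρ V ℓ P F) :
    ∃ (n : ℕ) (Q : ℂ), 3 ≤ Q.re ∧ HasSingularForm t ρ V ℓ Q (iteratedDeriv n F) := by
  obtain ⟨n, hn⟩ := exists_nat_ge (3 - P.re)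
  refine ⟨n, P + n, ?_, hF.hasSingularForm_iteratedDeriv hℓ hV n⟩
  simp only [Complex.add_re, Complex.natCast_re]
  linarith

theorem differentiableOn_iteratedDeriv {U : Set ℂ} (hU : IsOpen U) {f : ℂ → ℂ}
    (hf : DifferentiableOn ℂ f U) (n : ℕ) : DifferentiableOn ℂ (iteratedDeriv n f) U := by
  induction n with
  | zero => simpa using hf
  | succ n ih => rw [iteratedDeriv_succ]; exact ih.deriv hU

/-- After enough derivatives the logarithmic singularity `g * log` turns into a simple pole. -/
theorem exists_iteratedDeriv_hasSingularForm_of_log (hρ : 0 < ρ) (hℓ : IsLogBranch t V ℓ)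
    (hV : V ⊆ Metric.ball t ρ) {g D : ℂ → ℂ} {c : ℂ} (hc : c ≠ 0)
    (hg : DifferentiableOn ℂ g (Metric.ball t ρ)) (hg0 : ∃ z ∈ Metric.ball t ρ, g z ≠ 0)
    (hD : DifferentiableOn ℂ D (Metric.ball t ρ))
    (hF : ∀ w ∈ V, F w = D w + c * (g w * ℓ w)) :
    ∃ n, HasSingularForm t ρ V ℓ 1 (iteratedDeriv n F) := by
  have hball := Metric.isOpen_ball (x := t) (ε := ρ)
  have htB : t ∈ Metric.ball t ρ := Metric.mem_ball_self hρ
  have hex : ∃ n, iteratedDeriv n g t ≠ 0 := by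
    by_contra! hcon
    obtain ⟨z, hz, hz0⟩ := hg0
    apply hz0
    rw [← Complex.taylorSeries_eq_on_ball' hz hg]
    simp [hcon]
  classical
  -- `N` is the order of vanishing of `g` at `t`. Up to the `N`-th derivative, the terms
  -- `iteratedDeriv i g w / (w - t)` are holomorphic; the next one has a simple pole.
  set N := Nat.find hex with hN
  have hgN : iteratedDeriv N g t ≠ 0 := Nat.find_spec hex
  have hlt : ∀ i < N, iteratedDeriv i g t = 0 := fun i hi => not_not.1 (Nat.find_min hex hi)
  have hstep : ∀ (i : ℕ) (E : ℂ → ℂ), DifferentiableOn ℂ E (Metric.ball t ρ) →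
      (∀ w ∈ V, iteratedDeriv i F w = E w + c * (iteratedDeriv i g w * ℓ w)) →
      ∀ w ∈ V, iteratedDeriv (i + 1) F w = deriv E w +
        c * (iteratedDeriv i g w / (w - t)) + c * (iteratedDeriv (i + 1) g w * ℓ w) := by
    intro i E hE hi w hw
    have h1 : iteratedDeriv i F =ᶠ[𝓝 w]
        fun w => E w + c * (iteratedDeriv i g w * ℓ w) := by
      filter_upwards [hℓ.isOpen.mem_nhds hw] with x hx using hi x hx
    rw [iteratedDeriv_succ, h1.deriv_eq, iteratedDeriv_succ]
    have h2 := (hE.differentiableAt (hball.mem_nhds (hV hw))).hasDerivAt.add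
      ((((differentiableOn_iteratedDeriv hball hg i).differentiableAt
        (hball.mem_nhds (hV hw))).hasDerivAt.mul (hℓ.hasDerivAt w hw)).const_mul c)
    refine h2.deriv.trans ?_
    ring
  have hind : ∀ i ≤ N, ∃ E : ℂ → ℂ, DifferentiableOn ℂ E (Metric.ball t ρ) ∧
      ∀ w ∈ V, iteratedDeriv i F w = E w + c * (iteratedDeriv i g w * ℓ w) := by
    intro i
    induction i with
    | zero => exact fun _ => ⟨D, hD, by simpa using hF⟩
    | succ i ih =>
      intro hi
      obtain ⟨E, hE, hEF⟩ := ih (by omega)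
      refine ⟨fun w => deriv E w + c * dslope (iteratedDeriv i g) t w,
        (hE.deriv hball).add (DifferentiableOn.const_mul
          ((Complex.differentiableOn_dslope (hball.mem_nhds htB)).2
            (differentiableOn_iteratedDeriv hball hg i)) c), fun w hw => ?_⟩
      beta_reduce
      rw [hstep i E hE hEF w hw, dslope_of_ne _ (sub_ne_zero.1 (hℓ.sub_ne_zero hw)),
        slope_def_field, hlt i (by omega), sub_zero]
  obtain ⟨E, hE, hEF⟩ := hind N le_rfl
  refine ⟨N + 1, c, fun w => (w - t) * deriv E w + c * iteratedDeriv N g w,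
    iteratedDeriv (N + 1) g, ?_, differentiableOn_iteratedDeriv hball hg _, ?_,
    Or.inr ⟨1, le_rfl, by simp⟩, ?_, fun w hw => ?_⟩
  · have h1 := hE.deriv hball
    have h2 := differentiableOn_iteratedDeriv hball hg N
    fun_prop
  · simp [hc, hgN]
  · intro n h
    have h1 : ((n + 1 : ℕ) : ℂ) = 0 := by push_cast; linear_combination h
    exact n.succ_ne_zero (Nat.cast_eq_zero.1 h1)
  · have hX := hℓ.sub_ne_zero hw
    rw [hstep N E hE hEF w hw, neg_mul, one_mul, Complex.exp_neg, hℓ.exp_eq w hw]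
    field_simp

/-! ### Growth of the derivatives of a singular function -/

theorem IsLogBranch.iteratedDeriv_exp (hℓ : IsLogBranch t V ℓ) (s : ℂ) (n : ℕ) {w : ℂ}
    (hw : w ∈ V) : iteratedDeriv n (fun w => Complex.exp (s * ℓ w)) w =
      (∏ i ∈ Finset.range n, (s - i)) * Complex.exp ((s - n) * ℓ w) := by
  induction n generalizing w with
  | zero => simp
  | succ n ih =>
    have h1 : iteratedDeriv n (fun w => Complex.exp (s * ℓ w)) =ᶠ[𝓝 w]
        fun w => (∏ i ∈ Finset.range n, (s - i)) * Complex.exp ((s - n) * ℓ w) := by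
      filter_upwards [hℓ.isOpen.mem_nhds hw] with x hx using ih hx
    rw [iteratedDeriv_succ, h1.deriv_eq, ((hℓ.hasDerivAt_exp hw (s - n)).const_mul _).deriv,
      Finset.prod_range_succ]
    push_cast
    rw [← sub_sub]
    ring

/-- A rising factorial grows at least like `n! n ^ (Re P - 1)`. -/
theorem exists_le_norm_prod_add (P : ℂ) (hP : ∀ n : ℕ, P ≠ -n) :
    ∃ c > 0, ∀ n : ℕ, 1 ≤ n → c * (n.factorial * (n : ℝ) ^ (P.re - 1)) ≤
      ‖∏ i ∈ Finset.range n, (-P - i)‖ := by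
  -- Gauss's product converges, so `n^P n! / ∏_{i ≤ n} (P + i)` is bounded. Removing the factor `P +
  -- n`, of size at most `(‖P‖ + 1) n`, turns the exponent `Re P` into `Re P - 1`.
  obtain ⟨C, hC⟩ := (Complex.GammaSeq_tendsto_Gamma P).norm.bddAbove_range
  have hne : ∀ n : ℕ, P + n ≠ 0 := fun n h => hP n (eq_neg_of_add_eq_zero_left h)
  have hCpos : 0 < |C| + 1 := by positivity
  refine ⟨((|C| + 1) * (‖P‖ + 1))⁻¹, by positivity, fun n hn => ?_⟩
  have hn0 : (0 : ℝ) < n := by exact_mod_cast hn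
  have h1 : ‖Complex.GammaSeq P n‖ ≤ |C| + 1 :=
    (hC ⟨n, rfl⟩).trans ((le_abs_self C).trans (by linarith))
  have e1 : ‖∏ i ∈ Finset.range n, (-P - i)‖ = ‖∏ i ∈ Finset.range n, (P + i)‖ := by
    rw [norm_prod, norm_prod]
    refine Finset.prod_congr rfl fun i _ => ?_
    rw [← norm_neg]
    congr 1
    ring
  rw [Complex.GammaSeq, norm_div, norm_mul, Complex.norm_natCast_cpow_of_pos hn,
    Complex.norm_natCast, Finset.prod_range_succ, norm_mul] at h1
  have hprod : 0 < ‖∏ i ∈ Finset.range n, (P + i)‖ :=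
    norm_pos_iff.2 (Finset.prod_ne_zero_iff.2 fun i _ => hne i)
  have hPn : 0 < ‖P + n‖ := norm_pos_iff.2 (hne n)
  rw [div_le_iff₀ (by positivity)] at h1
  have h2 : ‖P + n‖ ≤ (‖P‖ + 1) * n := by
    have h3 := norm_add_le P (n : ℂ)
    rw [Complex.norm_natCast] at h3
    have h4 : (1 : ℝ) ≤ n := by exact_mod_cast hn
    nlinarith [norm_nonneg P]
  have h5 : (n : ℝ) ^ P.re = (n : ℝ) ^ (P.re - 1) * n := by
    rw [Real.rpow_sub_one hn0.ne']; field_simp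
  rw [h5] at h1
  rw [e1, inv_mul_le_iff₀ (by positivity)]
  have h6 : (n : ℝ) ^ (P.re - 1) * n * n.factorial ≤
      (|C| + 1) * (‖∏ i ∈ Finset.range n, (P + i)‖ * ((‖P‖ + 1) * n)) := h1.trans (by gcongr)
  have h7 : (n.factorial * (n : ℝ) ^ (P.re - 1)) * n ≤
      ((|C| + 1) * (‖P‖ + 1) * ‖∏ i ∈ Finset.range n, (P + i)‖) * n := by linarith
  exact le_of_mul_le_mul_right h7 hn0

end Perron

namespace Perron

variable {t : ℂ} {ρ : ℝ} {V : Set ℂ} {ℓ : ℂ → ℂ} {P : ℂ} {F : ℂ → ℂ}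

/-- A singular function differs from its two leading terms by `O(|w - t| ^ (2 - Re P))`. -/
theorem HasSingularForm.exists_remainder_bound (hρ : 0 < ρ) (hℓ : IsLogBranch t V ℓ)
    (hP3 : 3 ≤ P.re) (hF : HasSingularForm t ρ (V ∩ Metric.ball t ρ) ℓ P F) :
    ∃ β₀ β₁ : ℂ, β₀ ≠ 0 ∧ ∃ ρ' > 0, ρ' < ρ ∧ ∃ C : ℝ, ∀ w ∈ V, ‖w - t‖ < ρ' →
      ‖F w - (β₀ * Complex.exp (-P * ℓ w) + β₁ * Complex.exp ((-P + 1) * ℓ w))‖ ≤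
        C * ‖w - t‖ ^ (2 - P.re) := by
  obtain ⟨c, B, ψ, hB, hψ, hBt, -, -, hFe⟩ := hF
  have htB : t ∈ Metric.ball t ρ := Metric.mem_ball_self hρ
  have hnhds := Metric.isOpen_ball.mem_nhds htB
  set B1 := dslope B t with hB1
  set B2 := dslope B1 t with hB2
  have hB1d : DifferentiableOn ℂ B1 (Metric.ball t ρ) :=
    (Complex.differentiableOn_dslope hnhds).2 hB
  have hB2d : DifferentiableOn ℂ B2 (Metric.ball t ρ) :=
    (Complex.differentiableOn_dslope hnhds).2 hB1d
  have hexp : ∀ w, B w = B t + B1 t * (w - t) + (w - t) ^ 2 * B2 w := by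
    intro w
    have h1 := sub_smul_dslope B t w
    have h2 := sub_smul_dslope B1 t w
    rw [smul_eq_mul] at h1 h2
    rw [← hB1] at h1
    rw [← hB2] at h2
    linear_combination -h1 - (w - t) * h2
  -- The bound `ρ' ≤ 1` gives `‖w - t‖⁻¹ ≤ ‖w - t‖ ^ (2 - P.re)`, which absorbs the logarithm.
  set ρ' := min (ρ / 2) 1 with hρ'
  have hρ'0 : 0 < ρ' := by positivity
  have hsub : Metric.closedBall t ρ' ⊆ Metric.ball t ρ :=
    Metric.closedBall_subset_ball ((min_le_left _ _).trans_lt (by linarith))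
  obtain ⟨C2, hC2⟩ := (isCompact_closedBall t ρ').exists_bound_of_continuousOn
    (hB2d.continuousOn.mono hsub)
  obtain ⟨Cψ, hCψ⟩ := (isCompact_closedBall t ρ').exists_bound_of_continuousOn
    (hψ.continuousOn.mono hsub)
  refine ⟨B t, B1 t, hBt, ρ', hρ'0, (min_le_left _ _).trans_lt (by linarith),
    Real.exp (|(-P).im| * (2 * Real.pi)) * |C2| + ‖c‖ * (|Cψ| * (1 + 2 * Real.pi)),
    fun w hw hwρ => ?_⟩
  have hwcb : w ∈ Metric.closedBall t ρ' := by
    rw [mem_closedBall_iff_norm]; exact hwρ.le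
  have hX := hℓ.sub_ne_zero hw
  have hXpos : 0 < ‖w - t‖ := norm_pos_iff.2 hX
  have hX1 : ‖w - t‖ ≤ 1 := hwρ.le.trans (min_le_right _ _)
  have e1 : F w - (B t * Complex.exp (-P * ℓ w) + B1 t * Complex.exp ((-P + 1) * ℓ w)) =
      Complex.exp (-P * ℓ w) * ((w - t) ^ 2 * B2 w) + c * (ψ w * ℓ w) := by
    rw [hFe w ⟨hw, hsub hwcb⟩, hexp w, add_mul (-P), one_mul, Complex.exp_add, hℓ.exp_eq w hw]
    ring
  rw [e1]
  have h1 : ‖Complex.exp (-P * ℓ w) * ((w - t) ^ 2 * B2 w)‖ ≤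
      Real.exp (|(-P).im| * (2 * Real.pi)) * |C2| * ‖w - t‖ ^ (2 - P.re) := by
    rw [norm_mul, norm_mul, norm_pow]
    have h2 := hℓ.norm_exp_le hw (-P)
    have h3 : ‖w - t‖ ^ (2 - P.re) = ‖w - t‖ ^ (-P).re * ‖w - t‖ ^ 2 := by
      rw [Complex.neg_re, ← Real.rpow_natCast, ← Real.rpow_add hXpos]
      congr 1
      push_cast
      ring
    rw [h3]
    calc _ ≤ (Real.exp (|(-P).im| * (2 * Real.pi)) * ‖w - t‖ ^ (-P).re) *
          (‖w - t‖ ^ 2 * |C2|) := by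
          gcongr
          exact (hC2 w hwcb).trans (le_abs_self _)
      _ = _ := by ring
  have h2 : ‖c * (ψ w * ℓ w)‖ ≤ ‖c‖ * (|Cψ| * (1 + 2 * Real.pi)) * ‖w - t‖ ^ (2 - P.re) := by
    rw [norm_mul, norm_mul]
    have h3 : ‖w - t‖⁻¹ ≤ ‖w - t‖ ^ (2 - P.re) := by
      rw [← Real.rpow_neg_one]
      exact Real.rpow_le_rpow_of_exponent_ge hXpos hX1 (by linarith)
    calc _ ≤ ‖c‖ * (|Cψ| * ((1 + 2 * Real.pi) * ‖w - t‖ ^ (2 - P.re))) := by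
          gcongr
          · exact (hCψ w hwcb).trans (le_abs_self _)
          · refine (hℓ.norm_le hw hX1).trans ?_
            gcongr
      _ = _ := by ring
  calc _ ≤ _ := norm_add_le _ _
    _ ≤ _ := add_le_add h1 h2
    _ = _ := by ring

/-- The Cauchy estimate for a function bounded by a negative power of the distance to a point `t`
on the boundary of the disc. -/
theorem norm_iteratedDeriv_le_of_norm_le_rpow {z : ℂ} (hzt : z ≠ t) {f : ℂ → ℂ}
    (hf : DifferentiableOn ℂ f (Metric.ball z ‖z - t‖)) {C σ : ℝ} (hσ : 0 ≤ σ)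
    (hfC : ∀ w ∈ Metric.ball z ‖z - t‖, ‖f w‖ ≤ C * ‖w - t‖ ^ (-σ)) {n : ℕ} (hn : 2 ≤ n) :
    ‖iteratedDeriv n f z‖ * ‖z - t‖ ^ n ≤ 4 * |C| * n.factorial * (n : ℝ) ^ σ * ‖z - t‖ ^ (-σ) := by
  set r := ‖z - t‖ with hr
  have hr0 : 0 < r := norm_pos_iff.2 (sub_ne_zero.2 hzt)
  have hn2 : (2 : ℝ) ≤ n := by exact_mod_cast hn
  have hn0 : (0 : ℝ) < n := by linarith
  -- On the circle of radius `r (1 - 1 / n)` the distance to `t` is at least `r / n`, which costs `n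
  -- ^ σ`, while `θ ^ n ≥ 1 / 4` costs only the factor `4`.
  set θ : ℝ := 1 - 1 / n with hθ
  have hθ0 : 0 < θ := by
    have : 1 / (n : ℝ) < 1 := by rw [div_lt_one hn0]; linarith
    linarith
  have hθ1 : θ < 1 := by
    have : 0 < 1 / (n : ℝ) := by positivity
    linarith
  have hsub : Metric.closedBall z (r * θ) ⊆ Metric.ball z r :=
    Metric.closedBall_subset_ball (by nlinarith)
  have hdc : DiffContOnCl ℂ f (Metric.ball z (r * θ)) :=
    (hf.mono ((Metric.closure_ball_subset_closedBall).trans hsub)).diffContOnCl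
  have hsph : ∀ w ∈ Metric.sphere z (r * θ), ‖f w‖ ≤ |C| * (r / n) ^ (-σ) := by
    intro w hw
    have hwb := hsub (Metric.sphere_subset_closedBall hw)
    refine (hfC w hwb).trans ?_
    have h1 : r / n ≤ ‖w - t‖ := by
      rw [mem_sphere_iff_norm] at hw
      have h2 := norm_sub_le (w - t) (w - z)
      rw [sub_sub_sub_cancel_left, hw, ← hr] at h2
      rw [hθ] at h2
      have : r * (1 - 1 / n) = r - r / n := by ring
      linarith
    have h2 : ‖w - t‖ ^ (-σ) ≤ (r / n) ^ (-σ) :=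
      Real.rpow_le_rpow_of_nonpos (by positivity) h1 (by linarith)
    calc C * ‖w - t‖ ^ (-σ) ≤ |C| * ‖w - t‖ ^ (-σ) := by
          gcongr; exact le_abs_self C
      _ ≤ _ := by gcongr
  have h1 := Complex.norm_iteratedDeriv_le_of_forall_mem_sphere_norm_le n (by positivity) hdc hsph
  have hθn : 1 / 4 ≤ θ ^ n := by
    -- Bernoulli's inequality for the exponent `j`, with `k = 2 j` or `k = 2 j + 1`, followed by
    -- squaring.
    have h2 : ∀ k : ℕ, 2 ≤ k → (1 / 4 : ℝ) ≤ (1 - 1 / (k : ℝ)) ^ k := by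
      intro k hk
      have hk2 : (2 : ℝ) ≤ k := by exact_mod_cast hk
      obtain ⟨j, hj | hj⟩ := Nat.even_or_odd' k
      · have hj1 : 1 ≤ j := by omega
        have h3 : (1 / 2 : ℝ) ≤ (1 - 1 / (k : ℝ)) ^ j := by
          have h4 := one_add_mul_le_pow (a := -(1 / (k : ℝ)))
            (by have : 1 / (k : ℝ) ≤ 1 := by rw [div_le_one (by linarith)]; linarith
                linarith) j
          have h5 : (j : ℝ) * (1 / k) = 1 / 2 := by
            rw [hj]; push_cast
            have : (j : ℝ) ≠ 0 := by positivity
            field_simp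
          rw [← sub_eq_add_neg] at h4
          linarith
        rw [hj, mul_comm 2 j, pow_mul, ← hj.trans (mul_comm 2 j)]
        nlinarith
      · have hj1 : 1 ≤ j := by omega
        have hj1' : (1 : ℝ) ≤ j := by exact_mod_cast hj1
        have hkr : (k : ℝ) = 2 * j + 1 := by rw [hj]; push_cast; ring
        have hk1 : 1 / (k : ℝ) ≤ 1 / 3 := by
          apply one_div_le_one_div_of_le <;> linarith
        have h4 := one_add_mul_le_pow (a := -(1 / (k : ℝ))) (by linarith) j
        rw [← sub_eq_add_neg] at h4
        set x := 1 / (k : ℝ) with hx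
        have h5 : (j : ℝ) * x = (1 - x) / 2 := by
          rw [hx, hkr]; field_simp; ring
        have h6 : (1 + x) / 2 ≤ (1 - x) ^ j := by linarith
        rw [hj, pow_succ, mul_comm 2 j, pow_mul]
        have hx0 : 0 < x := by rw [hx]; positivity
        have h7 : ((1 + x) / 2) ^ 2 ≤ ((1 - x) ^ j) ^ 2 := by gcongr
        have h8 : (1 / 4 : ℝ) ≤ ((1 + x) / 2) ^ 2 * (1 - x) := by
          nlinarith
        refine h8.trans ?_
        gcongr
        linarith
    exact h2 n hn
  have h2 : (r / n) ^ (-σ) = (n : ℝ) ^ σ * r ^ (-σ) := by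
    rw [Real.div_rpow hr0.le hn0.le, Real.rpow_neg hn0.le]
    field_simp
  rw [h2, mul_pow] at h1
  have hrn : 0 < r ^ n := by positivity
  rw [le_div_iff₀ (by positivity)] at h1
  have h3 : 0 ≤ ‖iteratedDeriv n f z‖ * r ^ n := by positivity
  nlinarith

/-- The derivatives of a function with a singular form at the boundary point `t` of the discs
`|w - z| < |z - t|` grow like those of a pole, uniformly in the centre `z`. -/
theorem HasSingularForm.exists_le_norm_iteratedDeriv (hρ : 0 < ρ) (hℓ : IsLogBranch t V ℓ)
    (hP3 : 3 ≤ P.re) (hF : HasSingularForm t ρ (V ∩ Metric.ball t ρ) ℓ P F)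
    (hFd : DifferentiableOn ℂ F V) {A : Set ℂ} {R₀ : ℝ} (hAV : A ⊆ V)
    (hR₀ : ∀ z ∈ A, ‖z - t‖ ≤ R₀) (hball : ∀ z ∈ A, Metric.ball z ‖z - t‖ ⊆ V)
    (hbd : ∀ ρ' > 0, ∃ C : ℝ, ∀ z ∈ A, ∀ w ∈ Metric.ball z ‖z - t‖, ρ' ≤ ‖w - t‖ → ‖F w‖ ≤ C) :
    ∃ c > 0, ∀ᶠ n : ℕ in atTop, ∀ z ∈ A,
      c * n.factorial ≤ ‖iteratedDeriv n F z‖ * ‖z - t‖ ^ n * ‖z - t‖ ^ P.re := by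
  obtain ⟨β₀, β₁, hβ₀, ρ', hρ', hρ'ρ, C₁, hC₁⟩ := hF.exists_remainder_bound hρ hℓ hP3
  obtain ⟨-, -, -, -, -, -, -, hPn, -⟩ := hF
  obtain ⟨C₂, hC₂⟩ := hbd ρ' hρ'
  set E : ℂ → ℂ := fun w => Complex.exp (-P * ℓ w) with hE
  set E' : ℂ → ℂ := fun w => Complex.exp ((-P + 1) * ℓ w) with hE'
  set Rem : ℂ → ℂ := fun w => F w - (β₀ * E w + β₁ * E' w) with hRem
  have hEd : DifferentiableOn ℂ E V := fun w hw =>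
    (hℓ.hasDerivAt_exp hw _).differentiableAt.differentiableWithinAt
  have hE'd : DifferentiableOn ℂ E' V := fun w hw =>
    (hℓ.hasDerivAt_exp hw _).differentiableAt.differentiableWithinAt
  have hRemd : DifferentiableOn ℂ Rem V :=
    hFd.sub ((hEd.const_mul β₀).add (hE'd.const_mul β₁))
  set R := max R₀ 1 with hRdef
  have hR1 : 1 ≤ R := le_max_right _ _
  have hR0 : 0 < R := by linarith
  -- Near `t` this is the remainder bound. Away from `t` everything is bounded, and `‖w - t‖ ≤ 2 R`
  -- turns a constant into a multiple of the negative power.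
  obtain ⟨C, hC⟩ : ∃ C : ℝ, ∀ z ∈ A, ∀ w ∈ Metric.ball z ‖z - t‖,
      ‖Rem w‖ ≤ C * ‖w - t‖ ^ (-(P.re - 2)) := by
    set M := Real.exp (|(-P).im| * (2 * Real.pi)) with hM
    set M' := Real.exp (|(-P + 1).im| * (2 * Real.pi)) with hM'
    set D := |C₂| + (‖β₀‖ * (M * ρ' ^ (-P).re) + ‖β₁‖ * (M' * ρ' ^ (-P + 1).re)) with hD
    have hD0 : 0 ≤ D := by positivity
    refine ⟨|C₁| + D * (2 * R) ^ (P.re - 2), fun z hz w hw => ?_⟩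
    have hwV := hball z hz hw
    have hXpos : 0 < ‖w - t‖ := norm_pos_iff.2 (hℓ.sub_ne_zero hwV)
    have hneg : -(P.re - 2) = 2 - P.re := by ring
    rw [add_mul]
    rcases lt_or_ge ‖w - t‖ ρ' with h | h
    · have h1 := hC₁ w hwV h
      rw [hneg]
      have h2 : C₁ * ‖w - t‖ ^ (2 - P.re) ≤ |C₁| * ‖w - t‖ ^ (2 - P.re) := by
        gcongr; exact le_abs_self _
      have h3 : 0 ≤ D * (2 * R) ^ (P.re - 2) * ‖w - t‖ ^ (2 - P.re) := by positivity
      exact h1.trans (h2.trans (by linarith))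
    · have h1 : ‖Rem w‖ ≤ D := by
        refine (norm_sub_le _ _).trans (add_le_add ((hC₂ z hz w hw h).trans (le_abs_self _)) ?_)
        refine (norm_add_le _ _).trans ?_
        rw [norm_mul, norm_mul]
        have h2 : ‖w - t‖ ^ (-P).re ≤ ρ' ^ (-P).re :=
          Real.rpow_le_rpow_of_nonpos hρ' h (by rw [Complex.neg_re]; linarith)
        have h3 : ‖w - t‖ ^ (-P + 1).re ≤ ρ' ^ (-P + 1).re :=
          Real.rpow_le_rpow_of_nonpos hρ' h (by
            rw [Complex.add_re, Complex.neg_re, Complex.one_re]; linarith)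
        gcongr
        · exact (hℓ.norm_exp_le hwV _).trans (by gcongr)
        · exact (hℓ.norm_exp_le hwV _).trans (by gcongr)
      have h2 : ‖w - t‖ ≤ 2 * R := by
        rw [mem_ball_iff_norm] at hw
        have h3 := norm_add_le (w - z) (z - t)
        rw [sub_add_sub_cancel] at h3
        have := (hR₀ z hz).trans (le_max_left R₀ 1)
        linarith
      have h3 : 1 ≤ (2 * R) ^ (P.re - 2) * ‖w - t‖ ^ (-(P.re - 2)) := by
        rw [Real.rpow_neg hXpos.le, ← div_eq_mul_inv, one_le_div (by positivity)]
        exact Real.rpow_le_rpow hXpos.le h2 (by linarith)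
      have h4 : 0 ≤ |C₁| * ‖w - t‖ ^ (-(P.re - 2)) := by positivity
      nlinarith
  obtain ⟨c₁, hc₁, hprod⟩ := exists_le_norm_prod_add P hPn
  set m₀ := Real.exp (-(|(-P).im| * (2 * Real.pi))) with hm₀
  have hm₀pos : 0 < m₀ := Real.exp_pos _
  have hβ₀' : 0 < ‖β₀‖ := norm_pos_iff.2 hβ₀
  set K := c₁ * m₀ * (‖β₀‖ / 2) with hK
  have hKpos : 0 < K := by positivity
  refine ⟨K / 2, by positivity, ?_⟩
  -- From here on the `β₁` term is at most half of the `β₀` term; `hev2` likewise makes the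
  -- remainder at most half of the main part.
  have hev1 : ∀ᶠ n : ℕ in atTop, 2 * (‖β₁‖ * ‖-P + 1‖ * R) / ‖β₀‖ + ‖-P + 1‖ + 1 ≤ n :=
    tendsto_natCast_atTop_atTop.eventually_ge_atTop _
  have hev2 : ∀ᶠ n : ℕ in atTop, 8 * |C| * R ^ 2 / K ≤ n :=
    tendsto_natCast_atTop_atTop.eventually_ge_atTop _
  filter_upwards [hev1, hev2, eventually_ge_atTop 2] with n hn1 hn2 hn z hz
  have hzV := hAV hz
  have hX := hℓ.sub_ne_zero hzV
  have hzt : z ≠ t := sub_ne_zero.1 hX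
  set r := ‖z - t‖ with hr
  have hr0 : 0 < r := norm_pos_iff.2 hX
  have hrR : r ≤ R := (hR₀ z hz).trans (le_max_left _ _)
  have hnr : (2 : ℝ) ≤ n := by exact_mod_cast hn
  have hn0 : (0 : ℝ) < n := by linarith
  have hcd : ∀ {f : ℂ → ℂ}, DifferentiableOn ℂ f V → ContDiffAt ℂ n f z := fun hf =>
    (hf.analyticAt (hℓ.isOpen.mem_nhds hzV)).contDiffAt
  have hsplit : iteratedDeriv n F z =
      iteratedDeriv n Rem z + (β₀ * iteratedDeriv n E z + β₁ * iteratedDeriv n E' z) := by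
    have h1 : F = fun w => Rem w + (β₀ * E w + β₁ * E' w) := by
      funext w; simp [hRem]
    conv_lhs => rw [h1]
    have h2 : DifferentiableOn ℂ (fun w => β₀ * E w + β₁ * E' w) V :=
      (hEd.const_mul β₀).add (hE'd.const_mul β₁)
    rw [iteratedDeriv_fun_add (hcd hRemd) (hcd h2),
      iteratedDeriv_fun_add (hcd (hEd.const_mul β₀)) (hcd (hE'd.const_mul β₁)),
      iteratedDeriv_const_mul_field, iteratedDeriv_const_mul_field]
  set Q := ∏ i ∈ Finset.range n, (-P - i) with hQ
  -- The product for the exponent `-P + 1` is the one for `-P` shifted by one index, hence smaller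
  -- by a factor of order `1 / n`.
  have hQ' : (∏ i ∈ Finset.range n, (-P + 1 - i)) * (-P + 1 - n) = (-P + 1) * Q := by
    rw [← Finset.prod_range_succ, Finset.prod_range_succ', mul_comm]
    congr 1
    · simp
    · refine Finset.prod_congr rfl fun i _ => ?_
      push_cast
      ring
  have hden : 2 * (‖β₁‖ * ‖-P + 1‖ * R) / ‖β₀‖ + 1 ≤ ‖-P + 1 - n‖ := by
    have h1 := norm_sub_norm_le (n : ℂ) (-P + 1)
    rw [Complex.norm_natCast, norm_sub_rev] at h1
    linarith
  have hden0 : 0 < ‖-P + 1 - (n : ℂ)‖ := lt_of_lt_of_le (by positivity) hden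
  have hmain : β₀ * iteratedDeriv n E z + β₁ * iteratedDeriv n E' z =
      Q * Complex.exp ((-P - n) * ℓ z) * (β₀ + β₁ * ((-P + 1) / (-P + 1 - n)) * (z - t)) := by
    have h0 : -P + 1 - (n : ℂ) ≠ 0 := norm_pos_iff.1 hden0
    rw [hE, hE', hℓ.iteratedDeriv_exp _ _ hzV, hℓ.iteratedDeriv_exp _ _ hzV, ← hQ,
      eq_div_of_mul_eq h0 hQ', show -P + 1 - (n : ℂ) = (-P - n) + 1 by ring, add_mul (-P - (n : ℂ)),
      one_mul, Complex.exp_add, hℓ.exp_eq z hzV]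
    field_simp
  have hbr : ‖β₀‖ / 2 ≤ ‖β₀ + β₁ * ((-P + 1) / (-P + 1 - n)) * (z - t)‖ := by
    have h1 : ‖β₁ * ((-P + 1) / (-P + 1 - n)) * (z - t)‖ ≤ ‖β₀‖ / 2 := by
      rw [norm_mul, norm_mul, norm_div, ← mul_div_assoc, div_mul_eq_mul_div, div_le_iff₀ hden0]
      have h2 : 2 * (‖β₁‖ * ‖-P + 1‖ * R) / ‖β₀‖ * (‖β₀‖ / 2) ≤ ‖-P + 1 - n‖ * (‖β₀‖ / 2) := by
        gcongr; linarith
      have h3 : 2 * (‖β₁‖ * ‖-P + 1‖ * R) / ‖β₀‖ * (‖β₀‖ / 2) = ‖β₁‖ * ‖-P + 1‖ * R := by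
        field_simp
      have h4 : ‖β₁‖ * ‖-P + 1‖ * ‖z - t‖ ≤ ‖β₁‖ * ‖-P + 1‖ * R := by gcongr
      linarith
    have h2 := norm_sub_le (β₀ + β₁ * ((-P + 1) / (-P + 1 - n)) * (z - t))
      (β₁ * ((-P + 1) / (-P + 1 - n)) * (z - t))
    rw [add_sub_cancel_right] at h2
    linarith
  have hexpn : ‖Complex.exp ((-P - n) * ℓ z)‖ * r ^ n = ‖Complex.exp (-P * ℓ z)‖ := by
    rw [hr, ← norm_pow, ← norm_mul, ← hℓ.exp_natCast_mul hzV, ← Complex.exp_add]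
    congr 2
    ring
  have hmexp : m₀ ≤ ‖Complex.exp (-P * ℓ z)‖ * r ^ P.re := by
    have h1 := hℓ.le_norm_exp hzV (-P)
    rw [← hm₀, ← hr, Complex.neg_re, Real.rpow_neg hr0.le] at h1
    have h2 : 0 < r ^ P.re := by positivity
    rwa [← div_eq_mul_inv, div_le_iff₀ h2] at h1
  have hlow : K * (n.factorial * (n : ℝ) ^ (P.re - 1)) ≤
      ‖β₀ * iteratedDeriv n E z + β₁ * iteratedDeriv n E' z‖ * r ^ n * r ^ P.re := by
    rw [hmain, norm_mul, norm_mul]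
    calc K * (n.factorial * (n : ℝ) ^ (P.re - 1))
        = (c₁ * (n.factorial * (n : ℝ) ^ (P.re - 1))) * m₀ * (‖β₀‖ / 2) := by rw [hK]; ring
      _ ≤ ‖Q‖ * (‖Complex.exp (-P * ℓ z)‖ * r ^ P.re) *
          ‖β₀ + β₁ * ((-P + 1) / (-P + 1 - n)) * (z - t)‖ := by
          gcongr
          exact hprod n (by omega)
      _ = _ := by rw [← hexpn]; ring
  have hup : ‖iteratedDeriv n Rem z‖ * r ^ n * r ^ P.re ≤
      4 * |C| * n.factorial * (n : ℝ) ^ (P.re - 2) * R ^ 2 := by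
    have h1 := norm_iteratedDeriv_le_of_norm_le_rpow hzt (hRemd.mono (hball z hz))
      (by linarith : 0 ≤ P.re - 2) (hC z hz) hn
    rw [← hr] at h1
    have h2 : r ^ (-(P.re - 2)) * r ^ P.re = r ^ 2 := by
      rw [← Real.rpow_add hr0, ← Real.rpow_natCast]
      congr 1
      push_cast
      ring
    calc _ ≤ 4 * |C| * n.factorial * (n : ℝ) ^ (P.re - 2) * r ^ (-(P.re - 2)) * r ^ P.re := by
          gcongr
      _ = 4 * |C| * n.factorial * (n : ℝ) ^ (P.re - 2) * r ^ 2 := by rw [mul_assoc, h2]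
      _ ≤ _ := by gcongr
  have hpow : (n : ℝ) ^ (P.re - 1) = (n : ℝ) ^ (P.re - 2) * n := by
    rw [← Real.rpow_add_one hn0.ne']
    congr 1
    ring
  have hpow1 : 1 ≤ (n : ℝ) ^ (P.re - 1) := Real.one_le_rpow (by linarith) (by linarith)
  have hsmall : 4 * |C| * n.factorial * (n : ℝ) ^ (P.re - 2) * R ^ 2 ≤
      K / 2 * (n.factorial * (n : ℝ) ^ (P.re - 1)) := by
    rw [hpow]
    have h1 : 8 * |C| * R ^ 2 ≤ n * K := by rwa [div_le_iff₀ hKpos] at hn2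
    have h2 : 0 ≤ (n.factorial : ℝ) * (n : ℝ) ^ (P.re - 2) := by positivity
    nlinarith
  have htri : ‖β₀ * iteratedDeriv n E z + β₁ * iteratedDeriv n E' z‖ ≤
      ‖iteratedDeriv n F z‖ + ‖iteratedDeriv n Rem z‖ := by
    have h1 := norm_sub_le (iteratedDeriv n F z) (iteratedDeriv n Rem z)
    rwa [hsplit, add_sub_cancel_left, ← hsplit] at h1
  have hpp : 0 ≤ r ^ n * r ^ P.re := by positivity
  have hfin : ‖β₀ * iteratedDeriv n E z + β₁ * iteratedDeriv n E' z‖ * r ^ n * r ^ P.re ≤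
      ‖iteratedDeriv n F z‖ * r ^ n * r ^ P.re + ‖iteratedDeriv n Rem z‖ * r ^ n * r ^ P.re := by
    rw [mul_assoc, mul_assoc, mul_assoc, ← add_mul]
    gcongr
  have hfac : K / 2 * n.factorial ≤ K / 2 * (n.factorial * (n : ℝ) ^ (P.re - 1)) := by
    gcongr
    exact le_mul_of_one_le_right (by positivity) hpow1
  linarith

end Perron

namespace Perron

/-! ### Continuation from a singular point, and the local holomorphic solution -/

variable {q₀ q₁ : RatFunc ℂ} {V : Set ℂ} {y : ℂ → ℂ} {t : ℂ}

/-- A solution that is holomorphic on a disc around `t` extends to every open set that is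
star-shaped about `t` and has no singular point besides `t`. -/
theorem IsSolutionOn.exists_extension_of_star {ρ : ℝ} (hρ : 0 < ρ) (hV : IsOpen V)
    (hVS : ∀ z ∈ V, z ≠ t → z ∉ singularSet q₀ q₁)
    (hst : ∀ w ∈ V, ∀ s : ℝ, 0 < s → s ≤ 1 → t + s * (w - t) ∈ V)
    (hy : IsSolutionOn q₀ q₁ (Metric.ball t ρ) y) :
    ∃ u, IsSolutionOn q₀ q₁ V u ∧ Set.EqOn u y (Metric.ball t ρ) := by
  classical
  have hV' : IsOpen (V \ {t}) := hV.sdiff isClosed_singleton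
  obtain ⟨u, hu, huy⟩ := IsSolutionOn.exists_extension hρ hV'
    (Set.disjoint_left.2 fun z hz => hVS z hz.1 hz.2)
    (fun w hw s hs0 hs1 => ⟨hst w hw.1 s hs0 hs1, fun h => hw.2 (by
      have h1 : (s : ℂ) * (w - t) = 0 := by
        have h2 : t + (s : ℂ) * (w - t) = t := h
        linear_combination h2
      rcases mul_eq_zero.1 h1 with h2 | h2
      · exact absurd (Complex.ofReal_eq_zero.1 h2) hs0.ne'
      · exact sub_eq_zero.1 h2)⟩)
    (hy.mono (Set.inter_subset_right (s := V \ {t})))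
  refine ⟨fun z => if z ∈ Metric.ball t ρ then y z else u z,
    IsSolutionOn.congr_nhds fun z hz => ?_, fun z hz => if_pos hz⟩
  by_cases hzt : z = t
  · exact ⟨Metric.ball t ρ, Metric.isOpen_ball, hzt ▸ Metric.mem_ball_self hρ, y, hy,
      fun w hw => if_pos hw⟩
  · refine ⟨V \ {t}, hV', ⟨hz, hzt⟩, u, hu, fun w hw => ?_⟩
    by_cases hwb : w ∈ Metric.ball t ρ
    · exact (if_pos hwb).trans (huy ⟨hw, hwb⟩).symm
    · exact if_neg hwb

theorem ball_star {ρ : ℝ} : ∀ w ∈ Metric.ball t ρ, ∀ s : ℝ, 0 < s → s ≤ 1 →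
    t + s * (w - t) ∈ Metric.ball t ρ := by
  intro w hw s hs0 hs1
  rw [mem_ball_iff_norm] at hw ⊢
  rw [add_sub_cancel_left, norm_mul, Complex.norm_real, Real.norm_of_nonneg hs0.le]
  exact (mul_le_of_le_one_left (norm_nonneg _) hs1).trans_lt hw

theorem isOpen_slitDisc (t : ℂ) (ε : ℝ) : IsOpen (slitDisc t ε) :=
  (isOpen_lt (by fun_prop : Continuous fun z => ‖z - t‖) continuous_const).inter
    (Complex.isOpen_slitPlane.preimage (by fun_prop : Continuous fun z => z - t))

theorem slitDisc_subset_ball (t : ℂ) (ε : ℝ) : slitDisc t ε ⊆ Metric.ball t ε := fun z hz => by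
  rw [mem_ball_iff_norm]; exact hz.1

theorem add_half_mem_slitDisc (t : ℂ) {ε : ℝ} (hε : 0 < ε) : t + ((ε / 2 : ℝ) : ℂ) ∈ slitDisc t ε := by
  constructor
  · rw [add_sub_cancel_left, Complex.norm_real, Real.norm_of_nonneg (by positivity)]
    linarith
  · rw [add_sub_cancel_left]
    exact Complex.ofReal_mem_slitPlane.2 (by positivity)

/-- A holomorphic function on a connected open set that solves the equation on a nonempty open
subset solves it everywhere. -/
theorem IsSolutionOn.of_isPreconnected {W : Set ℂ} (hV : IsOpen V) (hVc : IsPreconnected V)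
    (hy : DifferentiableOn ℂ y V) (hW : IsOpen W) (hWV : W ⊆ V) (hW0 : W.Nonempty)
    (hWS : Disjoint W (singularSet q₀ q₁)) (hyW : IsSolutionOn q₀ q₁ W y) :
    IsSolutionOn q₀ q₁ V y := by
  refine ⟨hy, ?_⟩
  -- With the denominators cleared, the equation is holomorphic across singular points and the
  -- identity theorem applies.
  set Φ : ℂ → ℂ := fun z => q₀.denom.eval z * q₁.denom.eval z * deriv (deriv y) z -
    (q₀.num.eval z * q₁.denom.eval z * y z + q₁.num.eval z * q₀.denom.eval z * deriv y z) with hΦ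
  have hd0 : ∀ p : Polynomial ℂ, DifferentiableOn ℂ (fun z => p.eval z) V :=
    fun p => p.differentiable.differentiableOn
  have hΦd : DifferentiableOn ℂ Φ V := by
    have h1 := hy.deriv hV
    have h2 := h1.deriv hV
    exact (((hd0 _).mul (hd0 _)).mul h2).sub
      ((((hd0 _).mul (hd0 _)).mul hy).add (((hd0 _).mul (hd0 _)).mul h1))
  obtain ⟨p, hp⟩ := hW0
  have hΦ0 : Set.EqOn Φ 0 V := by
    refine eqOn_of_eventuallyEq hV hVc hΦd (differentiableOn_const 0) (hWV hp) ?_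
    filter_upwards [hW.mem_nhds hp] with z hz
    have hzS := hWS.notMem_of_mem_left hz
    have h0 : q₀.denom.eval z ≠ 0 := fun h => hzS (Or.inl h)
    have h1 : q₁.denom.eval z ≠ 0 := fun h => hzS (Or.inr h)
    simp only [hΦ, hyW.2 z hz hzS, value_eq, Pi.zero_apply]
    field_simp
    ring
  intro z hz hzS
  have h0 : q₀.denom.eval z ≠ 0 := fun h => hzS (Or.inl h)
  have h1 : q₁.denom.eval z ≠ 0 := fun h => hzS (Or.inr h)
  have h2 : Φ z = 0 := hΦ0 hz
  simp only [hΦ] at h2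
  rw [value_eq, value_eq]
  field_simp
  linear_combination h2

/-- Genericity is used here: a holomorphic solution with a nonzero `y₁` component would make `y₁`
extend too, so holomorphic solutions at `t` are the multiples of `g`. The radius is shrunk until `g`
has no zero besides possibly `t`. -/
theorem exists_local_solution (hG : IsGeneric q₀ q₁) (ht : t ∈ singularSet q₀ q₁) :
    ∃ R > 0, (∀ z ∈ Metric.ball t R, z ≠ t → z ∉ singularSet q₀ q₁) ∧
      ∃ (g G : ℂ → ℂ) (m : ℕ), IsSolutionOn q₀ q₁ (Metric.ball t R) g ∧
        DifferentiableOn ℂ G (Metric.ball t R) ∧ (∀ z ∈ Metric.ball t R, G z ≠ 0) ∧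
        (∀ z ∈ Metric.ball t R, g z = (z - t) ^ m * G z) ∧
        ∀ ρ, 0 < ρ → ρ ≤ R → ∀ y, IsSolutionOn q₀ q₁ (Metric.ball t ρ) y →
          ∃ c, ∀ z ∈ Metric.ball t ρ, y z = c * g z := by
  obtain ⟨ε, hε, hεS, y₁, y₂, ⟨hy₁, hy₂, hind, hspan⟩, ⟨g, hgd, hgy⟩, hnot⟩ := hG t ht
  have hS : ∀ z ∈ Metric.ball t ε, z ≠ t → z ∉ singularSet q₀ q₁ :=
    fun z hz hzt hzS => hzt (hεS z hzS hz)
  have hslitS : Disjoint (slitDisc t ε) (singularSet q₀ q₁) := by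
    refine Set.disjoint_left.2 fun z hz => hS z (slitDisc_subset_ball t ε hz) ?_
    rintro rfl
    exact Complex.slitPlane_ne_zero hz.2 (sub_self _)
  have hball := Metric.isOpen_ball (x := t) (ε := ε)
  have hconn : ∀ ρ : ℝ, IsPreconnected (Metric.ball t ρ) := fun ρ =>
    (convex_ball t ρ).isPreconnected
  have hg : IsSolutionOn q₀ q₁ (Metric.ball t ε) g :=
    IsSolutionOn.of_isPreconnected hball (hconn ε) hgd (isOpen_slitDisc t ε)
      (slitDisc_subset_ball t ε) ⟨_, add_half_mem_slitDisc t hε⟩ hslitS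
      (hy₂.congr (isOpen_slitDisc t ε) hgy)
  have htB : t ∈ Metric.ball t ε := Metric.mem_ball_self hε
  have hg0 : ¬ ∀ᶠ z in 𝓝 t, g z = 0 := by
    intro h0
    have h1 := eqOn_of_eventuallyEq hball (hconn ε) hgd (differentiableOn_const 0) htB h0
    have h2 := (hind 0 1 fun z hz => by
      rw [← hgy hz, h1 (slitDisc_subset_ball t ε hz)]; simp).2
    exact one_ne_zero h2
  obtain ⟨m, G, hGa, hGt, hgG⟩ := (hgd.analyticAt
    (hball.mem_nhds htB)).exists_eventuallyEq_pow_smul_nonzero_iff.2 hg0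
  obtain ⟨R', hR', hR'b⟩ := Metric.eventually_nhds_iff_ball.1
    ((hGa.eventually_analyticAt.and (hGa.continuousAt.eventually_ne hGt)).and hgG)
  set R := min R' ε with hR
  have hR0 : 0 < R := lt_min hR' hε
  have hsub : Metric.ball t R ⊆ Metric.ball t ε := Metric.ball_subset_ball (min_le_right _ _)
  have hsub' : Metric.ball t R ⊆ Metric.ball t R' := Metric.ball_subset_ball (min_le_left _ _)
  refine ⟨R, hR0, fun z hz => hS z (hsub hz), g, G, m, hg.mono hsub,
    fun z hz => (hR'b z (hsub' hz)).1.1.differentiableAt.differentiableWithinAt,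
    fun z hz => (hR'b z (hsub' hz)).1.2, fun z hz => (hR'b z (hsub' hz)).2, fun ρ hρ hρR y hy => ?_⟩
  have hρε : Metric.ball t ρ ⊆ Metric.ball t ε :=
    Metric.ball_subset_ball (hρR.trans (min_le_right _ _))
  -- The given basis lives on the slit disc of radius `ε`, so `y` is first continued to the full
  -- disc.
  obtain ⟨u, hu, huy⟩ := hy.exists_extension_of_star hρ hball hS ball_star
  obtain ⟨c₁, c₂, hc⟩ := hspan u (hu.mono (slitDisc_subset_ball t ε))
  have hc₁ : c₁ = 0 := by
    by_contra hc₁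
    refine hnot ⟨fun z => (u z - c₂ * g z) / c₁, (hu.1.sub (hgd.const_mul c₂)).div_const c₁,
      fun z hz => ?_⟩
    have h1 := hc z hz
    rw [← hgy hz] at h1
    simp only [h1]
    field_simp
    ring
  have huc : Set.EqOn u (fun z => c₂ * g z) (Metric.ball t ε) := by
    refine eqOn_of_eventuallyEq hball (hconn ε) hu.1 (hgd.const_mul c₂)
      (slitDisc_subset_ball t ε (add_half_mem_slitDisc t hε)) ?_
    filter_upwards [(isOpen_slitDisc t ε).mem_nhds (add_half_mem_slitDisc t hε)] with z hz
    rw [hc z hz, hc₁, hgy hz]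
    ring
  exact ⟨c₂, fun z hz => by rw [← huy hz, huc (hρε hz)]⟩

theorem mem_slitPlaneAt_self {z : ℂ} (hz : z ≠ t) : z ∈ slitPlaneAt t (z - t) := by
  show (z - t) / (z - t) ∈ Complex.slitPlane
  rw [div_self (sub_ne_zero.2 hz)]
  exact Complex.one_mem_slitPlane

/-- In every direction `α` there is, near the singular point `t`, a solution on the slit disc some
derivative of which has a strong singularity at `t`. -/
theorem exists_singular_solution (hF : IsFuchsian q₀ q₁) (ht : t ∈ singularSet q₀ q₁) {R : ℝ}
    (hR : 0 < R) (hS : ∀ z ∈ Metric.ball t R, z ≠ t → z ∉ singularSet q₀ q₁)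
    {g G : ℂ → ℂ} {m : ℕ} (hg : IsSolutionOn q₀ q₁ (Metric.ball t R) g)
    (hG : DifferentiableOn ℂ G (Metric.ball t R)) (hG0 : ∀ z ∈ Metric.ball t R, G z ≠ 0)
    (hgG : ∀ z ∈ Metric.ball t R, g z = (z - t) ^ m * G z)
    (huniq : ∀ ρ, 0 < ρ → ρ ≤ R → ∀ y, IsSolutionOn q₀ q₁ (Metric.ball t ρ) y →
      ∃ c, ∀ z ∈ Metric.ball t ρ, y z = c * g z) {α : ℂ} (hα : α ≠ 0) :
    ∃ ρ > 0, ∃ (ℓ y : ℂ → ℂ) (n : ℕ) (P : ℂ), IsLogBranch t (slitPlaneAt t α) ℓ ∧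
      IsSolutionOn q₀ q₁ (slitPlaneAt t α ∩ Metric.ball t ρ) y ∧
      (∃ C σ : ℝ, 0 ≤ σ ∧ ∀ w ∈ slitPlaneAt t α ∩ Metric.ball t ρ, ‖y w‖ ≤ C * ‖w - t‖ ^ (-σ)) ∧
      3 ≤ P.re ∧ HasSingularForm t ρ (slitPlaneAt t α ∩ Metric.ball t ρ) ℓ P (iteratedDeriv n y) := by
  obtain ⟨ρ₀, hρ₀, hρ₀R, H, s, c, hH, hs, hsol⟩ := exists_second_solution hR hS (hF t ht).1 hg hG
    hG0 hgG
  set ρ := min (ρ₀ / 2) 1 with hρdef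
  have hρ : 0 < ρ := by positivity
  have hρρ₀ : ρ < ρ₀ := (min_le_left _ _).trans_lt (by linarith)
  have hcb : Metric.closedBall t ρ ⊆ Metric.ball t ρ₀ := Metric.closedBall_subset_ball hρρ₀
  have hb0 : Metric.ball t ρ ⊆ Metric.ball t ρ₀ := Metric.ball_subset_ball hρρ₀.le
  have hbR : Metric.ball t ρ ⊆ Metric.ball t R := hb0.trans (Metric.ball_subset_ball hρ₀R.le)
  have hbranch := isLogBranch_slitPlaneAt t hα
  set ℓ : ℂ → ℂ := fun w => Complex.log ((w - t) / α) + Complex.log α with hℓ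
  have hVo : IsOpen (slitPlaneAt t α ∩ Metric.ball t ρ) := hbranch.isOpen.inter Metric.isOpen_ball
  have hbr := hbranch.mono hVo Set.inter_subset_left
  set y : ℂ → ℂ := fun w => Complex.exp (s * ℓ w) * H w + c * (g w * ℓ w) with hy
  have hgd : DifferentiableOn ℂ g (Metric.ball t ρ) := hg.1.mono hbR
  obtain ⟨n, P, hP, hform⟩ : ∃ (n : ℕ) (P : ℂ), 3 ≤ P.re ∧
      HasSingularForm t ρ (slitPlaneAt t α ∩ Metric.ball t ρ) ℓ P (iteratedDeriv n y) := by
    suffices h : ∃ (n : ℕ) (P : ℂ),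
        HasSingularForm t ρ (slitPlaneAt t α ∩ Metric.ball t ρ) ℓ P (iteratedDeriv n y) by
      obtain ⟨n, P, h⟩ := h
      obtain ⟨k, Q, hQ, h'⟩ := h.exists_three_le_re hbr Set.inter_subset_right
      refine ⟨k + n, Q, hQ, ?_⟩
      rwa [iteratedDeriv_eq_iterate, Function.iterate_add_apply, ← iteratedDeriv_eq_iterate,
        ← iteratedDeriv_eq_iterate]
    by_cases hsn : ∀ k : ℕ, s ≠ k
    · obtain ⟨hHt, hcp⟩ := hs hsn
      refine ⟨0, -s, c, H, g, hH.mono hb0, hgd, hHt, ?_, fun k hk => hsn k (neg_inj.1 hk),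
        fun w hw => ?_⟩
      · exact hcp.imp_right fun ⟨p, hp1, hp2⟩ => ⟨p, hp1, by rw [hp2, neg_neg]⟩
      · simp [hy]
    · push Not at hsn
      obtain ⟨k, rfl⟩ := hsn
      -- Without the logarithm, `(w - t) ^ k * H w` would be a solution holomorphic at `t`, hence a
      -- multiple of `g`, against the nonzero Wronskian. Being a solution is checked around each `z`
      -- on the plane slit opposite to `z`.
      have hc : c ≠ 0 := by
        rintro rfl
        set v : ℂ → ℂ := fun w => (w - t) ^ k * H w with hv
        have hloc : ∀ z ∈ Metric.ball t ρ₀, z ≠ t →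
            IsSolutionOn q₀ q₁ (slitPlaneAt t (z - t) ∩ Metric.ball t ρ₀) v ∧
            g z * deriv v z - deriv g z * v z ≠ 0 := by
          intro z hz hzt
          have hb := isLogBranch_slitPlaneAt t (sub_ne_zero.2 hzt)
          have hWo := hb.isOpen.inter (Metric.isOpen_ball (x := t) (ε := ρ₀))
          have hb' := hb.mono hWo Set.inter_subset_left
          obtain ⟨h1, h2⟩ := hsol _ _ hb' Set.inter_subset_right
          have hzW : z ∈ slitPlaneAt t (z - t) ∩ Metric.ball t ρ₀ := ⟨mem_slitPlaneAt_self hzt, hz⟩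
          have heq : Set.EqOn v (fun w => Complex.exp ((k : ℂ) * (Complex.log ((w - t) / (z - t)) +
              Complex.log (z - t))) * H w + 0 * (g w * (Complex.log ((w - t) / (z - t)) +
              Complex.log (z - t)))) (slitPlaneAt t (z - t) ∩ Metric.ball t ρ₀) := by
            intro w hw
            simp only [hv]
            rw [hb'.exp_natCast_mul hw]
            ring
          refine ⟨h1.congr hWo heq, ?_⟩
          have h3 := h2 z hzW
          have h4 := heq hzW
          beta_reduce at h4
          rwa [← (heq.eventuallyEq_of_mem (hWo.mem_nhds hzW)).deriv_eq, ← h4] at h3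
        have hvs : IsSolutionOn q₀ q₁ (Metric.ball t ρ₀) v := by
          refine ⟨DifferentiableOn.mul (by fun_prop) hH, fun z hz hzS => ?_⟩
          have hzt : z ≠ t := fun h => hzS (h ▸ ht)
          exact (hloc z hz hzt).1.2 z ⟨mem_slitPlaneAt_self hzt, hz⟩ hzS
        obtain ⟨a, ha⟩ := huniq ρ₀ hρ₀ hρ₀R.le v hvs
        have hz : t + ((ρ₀ / 2 : ℝ) : ℂ) ∈ Metric.ball t ρ₀ :=
          slitDisc_subset_ball t ρ₀ (add_half_mem_slitDisc t hρ₀)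
        have hzt : t + ((ρ₀ / 2 : ℝ) : ℂ) ≠ t := by
          have : ρ₀ / 2 ≠ 0 := by positivity
          simpa using this
        refine (hloc _ hz hzt).2 ?_
        have hev : v =ᶠ[𝓝 (t + ((ρ₀ / 2 : ℝ) : ℂ))] fun z => a * g z := by
          filter_upwards [Metric.isOpen_ball.mem_nhds hz] with w hw using ha w hw
        rw [hev.deriv_eq, hev.eq_of_nhds, deriv_const_mul_field]
        ring
      have hg0 : ∃ z ∈ Metric.ball t ρ, g z ≠ 0 := by
        have hz := add_half_mem_slitDisc t hρ
        refine ⟨_, slitDisc_subset_ball t ρ hz, ?_⟩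
        rw [hgG _ (hbR (slitDisc_subset_ball t ρ hz))]
        exact mul_ne_zero (pow_ne_zero _ (Complex.slitPlane_ne_zero hz.2))
          (hG0 _ (hbR (slitDisc_subset_ball t ρ hz)))
      have hDd : DifferentiableOn ℂ (fun w => (w - t) ^ k * H w) (Metric.ball t ρ) :=
        DifferentiableOn.mul (by fun_prop) (hH.mono hb0)
      obtain ⟨n, hn⟩ := exists_iteratedDeriv_hasSingularForm_of_log hρ hbr Set.inter_subset_right hc
        hgd hg0 hDd (F := y) fun w hw => by
          simp only [hy]
          rw [hbr.exp_natCast_mul hw]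
      exact ⟨n, 1, hn⟩
  refine ⟨ρ, hρ, ℓ, y, n, P, hbranch, (hsol _ ℓ hbr (Set.inter_subset_right.trans hb0)).1, ?_, hP,
    hform⟩
  obtain ⟨CH, hCH⟩ := (isCompact_closedBall t ρ).exists_bound_of_continuousOn
    (hH.continuousOn.mono hcb)
  obtain ⟨Cg, hCg⟩ := (isCompact_closedBall t ρ).exists_bound_of_continuousOn
    (hg.1.continuousOn.mono (hcb.trans (Metric.ball_subset_ball hρ₀R.le)))
  -- The exponent `|s.re| + 1` dominates both `‖w - t‖ ^ s.re` and the bound `‖w - t‖⁻¹` for the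
  -- logarithm.
  refine ⟨Real.exp (|s.im| * (2 * Real.pi)) * |CH| + ‖c‖ * (|Cg| * (1 + 2 * Real.pi)),
    |s.re| + 1, by positivity, fun w hw => ?_⟩
  have hwcb : w ∈ Metric.closedBall t ρ := Metric.ball_subset_closedBall hw.2
  have hXpos : 0 < ‖w - t‖ := norm_pos_iff.2 (hbr.sub_ne_zero hw)
  have hX1 : ‖w - t‖ ≤ 1 := by
    have := hw.2
    rw [mem_ball_iff_norm] at this
    exact this.le.trans (min_le_right _ _)
  have h1 : ‖w - t‖ ^ s.re ≤ ‖w - t‖ ^ (-(|s.re| + 1)) :=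
    Real.rpow_le_rpow_of_exponent_ge hXpos hX1 (by linarith [neg_abs_le s.re])
  have h2 : ‖w - t‖⁻¹ ≤ ‖w - t‖ ^ (-(|s.re| + 1)) := by
    rw [← Real.rpow_neg_one]
    exact Real.rpow_le_rpow_of_exponent_ge hXpos hX1 (by linarith [abs_nonneg s.re])
  simp only [hy]
  refine (norm_add_le _ _).trans ?_
  rw [norm_mul, norm_mul, norm_mul, add_mul]
  refine add_le_add ?_ ?_
  · calc _ ≤ (Real.exp (|s.im| * (2 * Real.pi)) * ‖w - t‖ ^ (-(|s.re| + 1))) * |CH| := by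
          gcongr
          · exact (hbr.norm_exp_le hw s).trans (by gcongr)
          · exact (hCH w hwcb).trans (le_abs_self _)
      _ = _ := by ring
  · calc _ ≤ ‖c‖ * (|Cg| * ((1 + 2 * Real.pi) * ‖w - t‖ ^ (-(|s.re| + 1)))) := by
          gcongr
          · exact (hCg w hwcb).trans (le_abs_self _)
          · exact (hbr.norm_le hw hX1).trans (by gcongr)
      _ = _ := by ring

end Perron

namespace Perron

/-! ### Star-shaped neighbourhoods of the Voronoi cell -/

/-- The points `w` such that no point of `S` other than `t` lies on the segment from `t` to `w`. -/
def starDomain (S : Set ℂ) (t : ℂ) : Set ℂ := {w | ∀ s ∈ S, s ≠ t → ‖w - t‖ < ‖s - t‖ + ‖w - s‖}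

variable {S : Set ℂ} {t : ℂ}

theorem isOpen_starDomain (hS : S.Finite) (t : ℂ) : IsOpen (starDomain S t) := by
  have : starDomain S t = ⋂ s ∈ S, {w | s ≠ t → ‖w - t‖ < ‖s - t‖ + ‖w - s‖} := by
    ext w; simp [starDomain]
  rw [this]
  refine hS.isOpen_biInter fun s _ => ?_
  by_cases h : s = t
  · simp [h]
  · simpa [h] using isOpen_lt (by fun_prop : Continuous fun w => ‖w - t‖)
      (by fun_prop : Continuous fun w => ‖s - t‖ + ‖w - s‖)

theorem isOpen_voronoiCell (hS : S.Finite) (t : ℂ) : IsOpen (voronoiCell S t) := by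
  have : voronoiCell S t = ⋂ s ∈ S, {w | s ≠ t → ‖w - t‖ < ‖w - s‖} := by
    ext w; simp [voronoiCell]
  rw [this]
  refine hS.isOpen_biInter fun s _ => ?_
  by_cases h : s = t
  · simp [h]
  · simpa [h] using isOpen_lt (by fun_prop : Continuous fun w => ‖w - t‖)
      (by fun_prop : Continuous fun w => ‖w - s‖)

theorem norm_contraction_sub {w : ℂ} {a : ℝ} (ha0 : 0 < a) :
    ‖t + a * (w - t) - t‖ = a * ‖w - t‖ := by
  rw [add_sub_cancel_left, norm_mul, Complex.norm_real, Real.norm_of_nonneg ha0.le]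

theorem norm_sub_le_contraction {w s : ℂ} {a : ℝ} (ha1 : a ≤ 1) :
    ‖w - s‖ ≤ ‖t + a * (w - t) - s‖ + (1 - a) * ‖w - t‖ := by
  have h := norm_add_le (t + a * (w - t) - s) (((1 - a : ℝ) : ℂ) * (w - t))
  rw [norm_mul, Complex.norm_real, Real.norm_of_nonneg (by linarith)] at h
  refine le_trans (le_of_eq ?_) h
  congr 1
  push_cast
  ring

theorem starDomain_star : ∀ w ∈ starDomain S t, ∀ a : ℝ, 0 < a → a ≤ 1 →
    t + a * (w - t) ∈ starDomain S t := by
  intro w hw a ha0 ha1 s hs hst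
  have h1 := hw s hs hst
  have h2 := norm_sub_le_contraction (t := t) (w := w) (s := s) ha1
  rw [norm_contraction_sub ha0]
  linarith

theorem voronoiCell_star : ∀ w ∈ voronoiCell S t, ∀ a : ℝ, 0 < a → a ≤ 1 →
    t + a * (w - t) ∈ voronoiCell S t := by
  intro w hw a ha0 ha1 s hs hst
  have h1 := hw s hs hst
  have h2 := norm_sub_le_contraction (t := t) (w := w) (s := s) ha1
  rw [norm_contraction_sub ha0]
  linarith

theorem notMem_of_mem_starDomain {w : ℂ} (hw : w ∈ starDomain S t) (hwt : w ≠ t) : w ∉ S := by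
  intro h
  have := hw w h hwt
  simp at this

theorem voronoiCell_subset_starDomain : voronoiCell S t ⊆ starDomain S t := fun _ hw s hs hst =>
  (hw s hs hst).trans_le (le_add_of_nonneg_left (norm_nonneg _))

theorem self_mem_voronoiCell : t ∈ voronoiCell S t := fun s _ hst => by
  rw [sub_self, norm_zero]
  exact norm_pos_iff.2 (sub_ne_zero.2 hst.symm)

theorem isPreconnected_of_star {V : Set ℂ} (htV : t ∈ V)
    (hst : ∀ w ∈ V, ∀ a : ℝ, 0 < a → a ≤ 1 → t + a * (w - t) ∈ V) : IsPreconnected V := by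
  refine isPreconnected_of_forall t fun w hw => ⟨segment ℝ t w, ?_, left_mem_segment ℝ t w,
    right_mem_segment ℝ t w, (convex_segment t w).isPreconnected⟩
  rw [segment_eq_image']
  rintro _ ⟨a, ⟨ha0, ha1⟩, rfl⟩
  rcases ha0.eq_or_lt with rfl | ha0
  · simpa using htV
  · simpa using hst w hw a ha0 ha1

/-- If `s` lay on the segment from `t` to a point of the disc, convexity would put `s` in the disc.
Such discs may leave the Voronoi cell, which is why solutions are continued to the star domain. -/
theorem closedBall_subset_starDomain {z : ℂ} {r : ℝ} (hr : ‖z - t‖ ≤ r)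
    (h : ∀ s ∈ S, s ≠ t → r < ‖z - s‖) : Metric.closedBall z r ⊆ starDomain S t := by
  intro w hw s hs hst
  by_contra! hcon
  have h1 : dist t s + dist s w = dist t w := by
    refine le_antisymm ?_ (dist_triangle _ _ _)
    rwa [dist_comm t s, dist_comm s w, dist_comm t w, dist_eq_norm, dist_eq_norm, dist_eq_norm]
  have h2 : s ∈ Metric.closedBall z r :=
    (convex_closedBall z r).mem_of_wbtw (dist_add_dist_eq_iff.1 h1)
      (by rwa [mem_closedBall_iff_norm, norm_sub_rev]) hw
  rw [mem_closedBall_iff_norm, norm_sub_rev] at h2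
  exact absurd (h s hs hst) (not_lt.2 h2)

theorem exists_uniform_gap (hS : S.Finite) {K : Set ℂ} (hK : IsCompact K)
    (hKU : K ⊆ voronoiCell S t) :
    ∃ η > 0, ∀ z ∈ K, ∀ s ∈ S, s ≠ t → ‖z - t‖ + η < ‖z - s‖ := by
  have h1 : ∀ s ∈ S, ∀ᶠ η in 𝓝[>] (0 : ℝ), ∀ z ∈ K, s ≠ t → ‖z - t‖ + η < ‖z - s‖ := by
    intro s hs
    by_cases hst : s = t
    · exact Eventually.of_forall fun η z _ h => absurd hst h
    obtain ⟨δ, hδ, hδK⟩ : ∃ δ > 0, ∀ z ∈ K, δ ≤ ‖z - s‖ - ‖z - t‖ := by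
      rcases K.eq_empty_or_nonempty with rfl | hne
      · exact ⟨1, one_pos, fun z hz => absurd hz (Set.notMem_empty z)⟩
      obtain ⟨z₀, hz₀, hmin⟩ := hK.exists_isMinOn hne
        (f := fun z => ‖z - s‖ - ‖z - t‖) (by fun_prop)
      exact ⟨_, sub_pos.2 (hKU hz₀ s hs hst), fun z hz => hmin hz⟩
    filter_upwards [Ioo_mem_nhdsGT hδ] with η hη z hz _
    have := hδK z hz
    linarith [hη.2]
  obtain ⟨η, hη, hη0⟩ := (((Filter.eventually_all_finite hS).2 h1).and
    self_mem_nhdsWithin).exists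
  exact ⟨η, hη0, fun z hz s hs hst => hη s hs z hz hst⟩

theorem isCompact_biUnion_closedBall {K : Set ℂ} (hK : IsCompact K) {f : ℂ → ℝ} (hf : Continuous f)
    (hf0 : ∀ z, 0 ≤ f z) : IsCompact {w | ∃ z ∈ K, ‖w - z‖ ≤ f z} := by
  have h := (hK.prod (isCompact_closedBall (0 : ℂ) 1)).image
    (by fun_prop : Continuous fun p : ℂ × ℂ => p.1 + (f p.1 : ℂ) * p.2)
  convert! h using 1
  ext w
  constructor
  · rintro ⟨z, hz, hw⟩
    by_cases h0 : f z = 0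
    · refine ⟨(z, 0), ⟨hz, by simp⟩, ?_⟩
      have : w - z = 0 := norm_le_zero_iff.1 (hw.trans h0.le)
      simp [sub_eq_zero.1 this]
    · have hpos := lt_of_le_of_ne (hf0 z) (Ne.symm h0)
      refine ⟨(z, (w - z) / f z), ⟨hz, ?_⟩, ?_⟩
      · rw [mem_closedBall_zero_iff, norm_div, Complex.norm_real, Real.norm_of_nonneg hpos.le,
          div_le_one hpos]
        exact hw
      · have : (f z : ℂ) ≠ 0 := by exact_mod_cast h0
        simp only
        field_simp
        ring
  · rintro ⟨⟨z, u⟩, ⟨hz, hu⟩, rfl⟩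
    refine ⟨z, hz, ?_⟩
    rw [mem_closedBall_zero_iff] at hu
    simp only [add_sub_cancel_left, norm_mul, Complex.norm_real, Real.norm_of_nonneg (hf0 z)]
    exact mul_le_of_le_one_right (hf0 z) hu

/-- A disc whose boundary passes through `t` and whose centre lies roughly in the direction `α`
stays off the cut in the direction `-α`. -/
theorem mem_slitPlaneAt_of_norm_sub_le {z w α : ℂ} (hα : ‖α‖ = 1)
    (hz : ‖z - t‖ ≤ 2 * ((z - t) / α).re) (hw : ‖w - z‖ ≤ ‖z - t‖) (hwt : w ≠ t) :
    w ∈ slitPlaneAt t α := by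
  have hα0 : α ≠ 0 := norm_pos_iff.1 (by rw [hα]; exact one_pos)
  set x₀ := (z - t) / α with hx₀
  set x := (w - t) / α with hx
  have hx0 : x ≠ 0 := div_ne_zero (sub_ne_zero.2 hwt) hα0
  have h1 : ‖x - x₀‖ ≤ ‖x₀‖ := by
    rw [hx, hx₀, ← sub_div, norm_div, norm_div, hα, div_one, div_one, sub_sub_sub_cancel_right]
    exact hw
  have hz0 : 0 < ‖z - t‖ := by
    rcases (norm_nonneg (z - t)).eq_or_lt with h | h
    · exfalso
      rw [← h] at hw
      have e1 := sub_eq_zero.1 (norm_le_zero_iff.1 hw)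
      have e2 := sub_eq_zero.1 (norm_eq_zero.1 h.symm)
      exact hwt (e1.trans e2)
    · exact h
  show x ∈ Complex.slitPlane
  rw [Complex.mem_slitPlane_iff]
  by_cases him : x.im = 0
  · left
    -- For real `x` this says `x² ≤ 2 x Re x₀`; as `Re x₀ > 0` and `x ≠ 0`, it forces `x > 0`.
    have h2 : ‖x - x₀‖ ^ 2 ≤ ‖x₀‖ ^ 2 := by gcongr
    rw [← Complex.normSq_eq_norm_sq, ← Complex.normSq_eq_norm_sq, Complex.normSq_apply,
      Complex.normSq_apply, Complex.sub_re, Complex.sub_im, him] at h2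
    have hre : x.re ≠ 0 := fun h => hx0 (Complex.ext h him)
    have h3 : 0 < x₀.re := by linarith
    have h4 : 0 < x.re ^ 2 := by positivity
    by_contra! hneg
    nlinarith
  · exact Or.inr him

/-- The larger of `|Re z|` and `|Im z|` is at least half of `‖z‖`. Finitely many directions keep the
estimates uniform in `z`. -/
theorem exists_direction (z : ℂ) : ∃ α ∈ ({1, -1, Complex.I, -Complex.I} : Set ℂ),
    ‖z‖ ≤ 2 * (z / α).re := by
  have h := Complex.norm_le_abs_re_add_abs_im z
  rcases le_total |z.im| |z.re| with h1 | h1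
  · rcases le_total 0 z.re with h2 | h2
    · refine ⟨1, by simp, ?_⟩
      rw [abs_of_nonneg h2] at *
      rw [div_one]
      linarith
    · refine ⟨-1, by simp, ?_⟩
      rw [abs_of_nonpos h2] at *
      rw [div_neg, div_one, Complex.neg_re]
      linarith
  · rcases le_total 0 z.im with h2 | h2
    · refine ⟨Complex.I, by simp, ?_⟩
      rw [abs_of_nonneg h2] at *
      have : (z / Complex.I).re = z.im := by simp [Complex.div_I]
      rw [this]
      linarith
    · refine ⟨-Complex.I, by simp, ?_⟩
      rw [abs_of_nonpos h2] at *
      have : (z / -Complex.I).re = -z.im := by simp [div_neg, Complex.div_I]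
      rw [this]
      linarith

end Perron

namespace Perron

/-! ### Growth of the coefficients and convergence -/

variable {q₀ q₁ : RatFunc ℂ} {S : Set ℂ} {t : ℂ}

theorem factorial_add_le (n M : ℕ) : (n + M).factorial ≤ n.factorial * (n + M) ^ M := by
  have h := Nat.factorial_mul_descFactorial (Nat.le_add_left M n)
  rw [Nat.add_sub_cancel] at h
  rw [← h]
  exact Nat.mul_le_mul_left _ (Nat.descFactorial_le_pow _ _)

/-- For all `r ≤ R` one has `r ≤ θ (r + η)` with a single `θ < 1`, and `θ ^ k` beats the polynomial
size of `(n + M)! / n!`. Splitting `n = k + Q` leaves `r ^ Q` on both sides, so the bound is uniform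
down to `r = 0`. -/
theorem eventually_factorial_mul_pow_le {η R D ε : ℝ} (hη : 0 < η) (hR : 0 ≤ R) (hD : 0 ≤ D)
    (hε : 0 < ε) (M Q : ℕ) :
    ∀ᶠ n : ℕ in atTop, ∀ r : ℝ, 0 ≤ r → r ≤ R →
      D * (n + M).factorial * r ^ n ≤ ε * n.factorial * r ^ Q * (r + η) ^ (n + M) := by
  set θ := (R + 1) / (R + 1 + η) with hθ
  have hθ0 : 0 < θ := by positivity
  have hθ1 : θ < 1 := by rw [hθ, div_lt_one (by positivity)]; linarith
  have hlim : Tendsto (fun j : ℕ => D * ((j : ℝ) ^ M * θ ^ j)) atTop (𝓝 0) := by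
    simpa using (tendsto_pow_const_mul_const_pow_of_lt_one M hθ0.le hθ1).const_mul D
  have hev := hlim.eventually_le_const (show 0 < ε * η ^ (Q + M) * θ ^ (Q + M) by positivity)
  rw [← Filter.map_add_atTop_eq_nat (Q + M), eventually_map] at hev
  rw [← Filter.map_add_atTop_eq_nat Q, eventually_map]
  filter_upwards [hev] with k hk r hr0 hrR
  have h1 : D * ((k + Q + M : ℕ) : ℝ) ^ M * θ ^ k ≤ ε * η ^ (Q + M) := by
    rw [pow_add θ k, ← add_assoc] at hk
    refine le_of_mul_le_mul_right ?_ (pow_pos hθ0 (Q + M))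
    linarith
  have h2 : r ≤ θ * (r + η) := by
    rw [hθ, div_mul_eq_mul_div, le_div_iff₀ (by positivity)]
    nlinarith
  have h3 : r ^ k ≤ θ ^ k * (r + η) ^ k := by
    rw [← mul_pow]
    exact pow_le_pow_left₀ hr0 h2 k
  have h4 : ((k + Q + M).factorial : ℝ) ≤ (k + Q).factorial * ((k + Q + M : ℕ) : ℝ) ^ M := by
    exact_mod_cast factorial_add_le (k + Q) M
  have h5 : η ^ (Q + M) ≤ (r + η) ^ (Q + M) := pow_le_pow_left₀ hη.le (by linarith) _
  calc D * (k + Q + M).factorial * r ^ (k + Q)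
      ≤ D * ((k + Q).factorial * ((k + Q + M : ℕ) : ℝ) ^ M) * ((θ ^ k * (r + η) ^ k) * r ^ Q) := by
        rw [pow_add]; gcongr
    _ = (D * ((k + Q + M : ℕ) : ℝ) ^ M * θ ^ k) * ((k + Q).factorial * (r + η) ^ k * r ^ Q) := by
        ring
    _ ≤ (ε * (r + η) ^ (Q + M)) * ((k + Q).factorial * (r + η) ^ k * r ^ Q) := by
        refine mul_le_mul_of_nonneg_right (h1.trans (by gcongr)) (by positivity)
    _ = ε * (k + Q).factorial * r ^ Q * (r + η) ^ (k + Q + M) := by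
        rw [add_assoc, pow_add (r + η) k]; ring

/-- The Euclidean norm of the pair `(q_{0,n}, q_{1,n})` at `z`. -/
noncomputable def coeffNorm (q₀ q₁ : RatFunc ℂ) (n : ℕ) (z : ℂ) : ℝ :=
  √(‖value (derivCoeff q₀ q₁ n).1 z‖ ^ 2 + ‖value (derivCoeff q₀ q₁ n).2 z‖ ^ 2)

/-- Used as a lower bound for the coefficients: one solution with large derivatives makes the pair
large. -/
theorem IsSolutionOn.norm_iteratedDeriv_le {V : Set ℂ} {y : ℂ → ℂ} (hV : IsOpen V)
    (hy : IsSolutionOn q₀ q₁ V y) (n : ℕ) {z : ℂ} (hz : z ∈ V) (hzS : z ∉ singularSet q₀ q₁) :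
    ‖iteratedDeriv n y z‖ ≤ coeffNorm q₀ q₁ n z * (‖y z‖ + ‖deriv y z‖) := by
  rw [hy.iteratedDeriv_eq hV n hz hzS, coeffNorm]
  have h1 := Real.le_sqrt_of_sq_le (le_add_of_nonneg_right (a := ‖value (derivCoeff q₀ q₁ n).1 z‖ ^ 2)
    (sq_nonneg ‖value (derivCoeff q₀ q₁ n).2 z‖))
  have h2 := Real.le_sqrt_of_sq_le (le_add_of_nonneg_left (a := ‖value (derivCoeff q₀ q₁ n).2 z‖ ^ 2)
    (sq_nonneg ‖value (derivCoeff q₀ q₁ n).1 z‖))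
  refine (norm_add_le _ _).trans ?_
  rw [norm_mul, norm_mul, mul_add]
  gcongr

theorem exists_norm_iteratedDeriv_le {W K : Set ℂ} {y : ℂ → ℂ} (hy : DifferentiableOn ℂ y W)
    (hK : IsCompact K) {η : ℝ} (hη : 0 < η)
    (hKW : ∀ z ∈ K, Metric.closedBall z (‖z - t‖ + η) ⊆ W) :
    ∃ C, 0 ≤ C ∧ ∀ z ∈ K, ∀ n : ℕ, ‖iteratedDeriv n y z‖ * (‖z - t‖ + η) ^ n ≤ C * n.factorial := by
  set T : Set ℂ := {w | ∃ z ∈ K, ‖w - z‖ ≤ ‖z - t‖ + η} with hT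
  have hTc : IsCompact T := isCompact_biUnion_closedBall hK (by fun_prop) fun z => by positivity
  have hTW : T ⊆ W := by
    rintro w ⟨z, hz, hw⟩
    exact hKW z hz (mem_closedBall_iff_norm.2 hw)
  obtain ⟨C, hC⟩ := hTc.exists_bound_of_continuousOn (hy.continuousOn.mono hTW)
  refine ⟨max C 0, le_max_right _ _, fun z hz n => ?_⟩
  have hr : 0 < ‖z - t‖ + η := by positivity
  have hd : DiffContOnCl ℂ y (Metric.ball z (‖z - t‖ + η)) :=
    (hy.mono (hKW z hz)).diffContOnCl_ball subset_rfl
  have h := Complex.norm_iteratedDeriv_le_of_forall_mem_sphere_norm_le (C := max C 0) n hr hd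
    fun w hw => (hC w ⟨z, hz, (mem_sphere_iff_norm.1 hw).le⟩).trans (le_max_left _ _)
  rw [le_div_iff₀ (by positivity)] at h
  linarith

/-- At `t` both `y` and `y'` may vanish, so the power `m` is unavoidable. Near `t` it comes from the
factorisation, elsewhere from compactness. -/
theorem exists_le_sqrt_norm_sq {K : Set ℂ} (hK : IsCompact K) {y G : ℂ → ℂ} {m : ℕ}
    (hy : ContinuousOn y K) (hy' : ContinuousOn (deriv y) K)
    (hy0 : ∀ z ∈ K, z ≠ t → y z ≠ 0 ∨ deriv y z ≠ 0) (hG : ContinuousAt G t) (hGt : G t ≠ 0)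
    (hyG : ∀ᶠ z in 𝓝 t, y z = (z - t) ^ m * G z) :
    ∃ c > 0, ∀ z ∈ K, z ≠ t → c * ‖z - t‖ ^ m ≤ √(‖deriv y z‖ ^ 2 + ‖y z‖ ^ 2) := by
  have hG2 : ∀ᶠ z in 𝓝 t, ‖G t‖ / 2 < ‖G z‖ :=
    hG.norm.eventually_const_lt (half_lt_self (norm_pos_iff.2 hGt))
  obtain ⟨δ, hδ, hball⟩ := Metric.eventually_nhds_iff_ball.1 (hyG.and hG2)
  set f : ℂ → ℝ := fun z => √(‖deriv y z‖ ^ 2 + ‖y z‖ ^ 2) with hf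
  have hfar : ∃ c > 0, ∀ z ∈ K \ Metric.ball t δ, c * ‖z - t‖ ^ m ≤ f z := by
    have hKδ : IsCompact (K \ Metric.ball t δ) := hK.diff Metric.isOpen_ball
    have hpos : ∀ z ∈ K \ Metric.ball t δ, 0 < f z := fun z hz => by
      refine sqrt_norm_sq_add_pos (hy0 z hz.1 ?_).symm
      rintro rfl
      exact hz.2 (Metric.mem_ball_self hδ)
    have hfc : ContinuousOn f (K \ Metric.ball t δ) := by
      have h1 := hy.mono (Set.sdiff_subset (t := Metric.ball t δ))
      have h2 := hy'.mono (Set.sdiff_subset (t := Metric.ball t δ))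
      exact ((h2.norm.pow 2).add (h1.norm.pow 2)).sqrt
    obtain ⟨C, hC⟩ := hKδ.exists_bound_of_continuousOn
      (f := fun z => ‖z - t‖ ^ m / f z) (((by fun_prop : Continuous fun z => ‖z - t‖ ^ m).continuousOn).div hfc
        fun z hz => (hpos z hz).ne')
    refine ⟨1 / max C 1, by positivity, fun z hz => ?_⟩
    have h := (le_abs_self _).trans ((hC z hz).trans (le_max_left C 1))
    rw [div_le_iff₀ (hpos z hz)] at h
    rwa [one_div_mul_eq_div, div_le_iff₀ (by positivity), mul_comm]
  obtain ⟨c, hc, hfar⟩ := hfar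
  refine ⟨min c (‖G t‖ / 2), lt_min hc (half_pos (norm_pos_iff.2 hGt)), fun z hz _ => ?_⟩
  by_cases hzb : z ∈ Metric.ball t δ
  · obtain ⟨h1, h2⟩ := hball z hzb
    refine Real.le_sqrt_of_sq_le ((pow_le_pow_left₀ (by positivity) ?_ 2).trans
      (le_add_of_nonneg_left (sq_nonneg _)))
    rw [h1, norm_mul, norm_pow, mul_comm]
    gcongr
    exact (min_le_right _ _).trans h2.le
  · refine le_trans ?_ (hfar z ⟨hz, hzb⟩)
    gcongr
    exact min_le_left _ _

end Perron

/-! ### Lower bounds for the coefficients -/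

namespace Perron

variable {q₀ q₁ : RatFunc ℂ} {t : ℂ}

theorem slitPlaneAt_star {α : ℂ} : ∀ w ∈ slitPlaneAt t α, ∀ a : ℝ, 0 < a → a ≤ 1 →
    t + a * (w - t) ∈ slitPlaneAt t α := by
  intro w hw a ha0 _
  have h : (t + a * (w - t) - t) / α = a * ((w - t) / α) := by ring
  have hw' : (w - t) / α ∈ Complex.slitPlane := hw
  show (t + a * (w - t) - t) / α ∈ Complex.slitPlane
  rw [h]
  rw [Complex.mem_slitPlane_iff] at hw' ⊢
  rw [Complex.re_ofReal_mul, Complex.im_ofReal_mul]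
  exact hw'.imp (mul_pos ha0) (mul_ne_zero ha0.ne')

/-- On the disc of half the radius `‖w - t‖ ≥ ‖z - t‖ / 2`, so `u` is `O(‖z - t‖ ^ (-⌈σ⌉₊))` there;
Cauchy's estimate for `u'` costs one more power. -/
theorem exists_norm_add_norm_deriv_le {V A : Set ℂ} {u : ℂ → ℂ} {ρ σ C C₁ R : ℝ}
    (hu : DifferentiableOn ℂ u V) (hσ : 0 ≤ σ)
    (hnear : ∀ w ∈ V, ‖w - t‖ < ρ → ‖u w‖ ≤ C * ‖w - t‖ ^ (-σ))
    (hAt : ∀ z ∈ A, z ≠ t) (hR : 1 ≤ R) (hAR : ∀ z ∈ A, ‖z - t‖ ≤ R)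
    (hball : ∀ z ∈ A, Metric.ball z ‖z - t‖ ⊆ V)
    (hfar : ∀ z ∈ A, ∀ w ∈ Metric.ball z ‖z - t‖, ρ ≤ ‖w - t‖ → ‖u w‖ ≤ C₁) :
    ∃ C', 0 ≤ C' ∧ ∀ z ∈ A, (‖u z‖ + ‖deriv u z‖) * ‖z - t‖ ^ (⌈σ⌉₊ + 1) ≤ C' := by
  set b := ⌈σ⌉₊ with hb
  set C₂ := max (|C| * 2 ^ σ * R ^ b) (|C₁| * R ^ b) with hC₂
  have hC₂0 : 0 ≤ C₂ := le_max_of_le_right (by positivity)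
  have hbd : ∀ z ∈ A, ∀ w ∈ Metric.closedBall z (‖z - t‖ / 2), ‖u w‖ * ‖z - t‖ ^ b ≤ C₂ := by
    intro z hz w hw
    have hr : 0 < ‖z - t‖ := norm_pos_iff.2 (sub_ne_zero.2 (hAt z hz))
    have hwb : w ∈ Metric.ball z ‖z - t‖ := Metric.closedBall_subset_ball (half_lt_self hr) hw
    have hwt : ‖z - t‖ / 2 ≤ ‖w - t‖ := by
      rw [mem_closedBall_iff_norm, norm_sub_rev] at hw
      have := norm_add_le (z - w) (w - t)
      rw [sub_add_sub_cancel] at this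
      linarith
    rcases lt_or_ge ‖w - t‖ ρ with h | h
    · refine le_trans ?_ (le_max_left _ _)
      have h1 : ‖w - t‖ ^ (-σ) ≤ (‖z - t‖ / 2) ^ (-σ) :=
        Real.rpow_le_rpow_of_nonpos (by positivity) hwt (by linarith)
      have h2 : (‖z - t‖ / 2) ^ (-σ) * ‖z - t‖ ^ b = 2 ^ σ * ‖z - t‖ ^ (b - σ) := by
        rw [Real.div_rpow hr.le two_pos.le, Real.rpow_neg two_pos.le, div_inv_eq_mul,
          ← Real.rpow_natCast ‖z - t‖ b, sub_eq_neg_add (b : ℝ) σ, Real.rpow_add hr]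
        ring
      have h3 : ‖z - t‖ ^ ((b : ℝ) - σ) ≤ R ^ b := by
        have hbσ : 0 ≤ (b : ℝ) - σ := sub_nonneg.2 (Nat.le_ceil σ)
        refine (Real.rpow_le_rpow hr.le (hAR z hz) hbσ).trans ?_
        rw [← Real.rpow_natCast]
        exact Real.rpow_le_rpow_of_exponent_le hR (by linarith)
      calc ‖u w‖ * ‖z - t‖ ^ b ≤ (|C| * (‖z - t‖ / 2) ^ (-σ)) * ‖z - t‖ ^ b := by
            refine mul_le_mul_of_nonneg_right ((hnear w (hball z hz hwb) h).trans ?_) (by positivity)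
            exact mul_le_mul (le_abs_self C) h1 (by positivity) (abs_nonneg C)
        _ = |C| * 2 ^ σ * ‖z - t‖ ^ ((b : ℝ) - σ) := by rw [mul_assoc, h2, mul_assoc]
        _ ≤ |C| * 2 ^ σ * R ^ b := by gcongr
    · refine le_trans ?_ (le_max_right _ _)
      exact mul_le_mul ((hfar z hz w hwb h).trans (le_abs_self _))
        (pow_le_pow_left₀ hr.le (hAR z hz) b) (by positivity) (abs_nonneg _)
  refine ⟨C₂ * R + 2 * C₂, by positivity, fun z hz => ?_⟩
  have hr : 0 < ‖z - t‖ := norm_pos_iff.2 (sub_ne_zero.2 (hAt z hz))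
  have h1 := hbd z hz z (Metric.mem_closedBall_self (by positivity))
  have hd : DiffContOnCl ℂ u (Metric.ball z (‖z - t‖ / 2)) :=
    (hu.mono ((Metric.closedBall_subset_ball (half_lt_self hr)).trans
      (hball z hz))).diffContOnCl_ball subset_rfl
  have h2 := Complex.norm_deriv_le_of_forall_mem_sphere_norm_le (half_pos hr) hd
    (C := C₂ / ‖z - t‖ ^ b) fun w hw => by
      rw [le_div_iff₀ (by positivity)]
      exact hbd z hz w (Metric.sphere_subset_closedBall hw)
  rw [div_div, le_div_iff₀ (by positivity)] at h2
  have h3 : ‖u z‖ * ‖z - t‖ ^ b * ‖z - t‖ ≤ C₂ * R :=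
    mul_le_mul h1 (hAR z hz) hr.le hC₂0
  rw [pow_succ]
  linarith

/-- In the sector around the direction `α`, the coefficients grow at least as the derivatives of a
solution that is singular at `t`. -/
theorem exists_le_coeffNorm (hU : (singularSet q₀ q₁).Finite) {K : Set ℂ} (hK : IsCompact K)
    (hKU : K ⊆ voronoiCell (singularSet q₀ q₁) t) {α : ℂ} (hα : ‖α‖ = 1) {ρ : ℝ} (hρ : 0 < ρ)
    {ℓ y : ℂ → ℂ} {M : ℕ} {P : ℂ} (hℓ : IsLogBranch t (slitPlaneAt t α) ℓ)
    (hy : IsSolutionOn q₀ q₁ (slitPlaneAt t α ∩ Metric.ball t ρ) y)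
    {C σ : ℝ} (hσ : 0 ≤ σ)
    (hyC : ∀ w ∈ slitPlaneAt t α ∩ Metric.ball t ρ, ‖y w‖ ≤ C * ‖w - t‖ ^ (-σ))
    (hP : 3 ≤ P.re)
    (hsing : HasSingularForm t ρ (slitPlaneAt t α ∩ Metric.ball t ρ) ℓ P (iteratedDeriv M y)) :
    ∃ c > 0, ∃ B : ℕ, ∀ᶠ n : ℕ in atTop, ∀ z ∈ K, z ≠ t → ‖z - t‖ ≤ 2 * ((z - t) / α).re →
      c * n.factorial * ‖z - t‖ ^ B ≤ coeffNorm q₀ q₁ (n + M) z * ‖z - t‖ ^ n := by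
  set V := starDomain (singularSet q₀ q₁) t ∩ slitPlaneAt t α with hVdef
  have hV : IsOpen V := (isOpen_starDomain hU t).inter hℓ.isOpen
  have hVt : ∀ w ∈ V, w ≠ t := fun w hw => sub_ne_zero.1 (hℓ.sub_ne_zero hw.2)
  have hVS : ∀ w ∈ V, w ∉ singularSet q₀ q₁ := fun w hw =>
    notMem_of_mem_starDomain hw.1 (hVt w hw)
  have hVsub : V ∩ Metric.ball t ρ ⊆ slitPlaneAt t α ∩ Metric.ball t ρ :=
    Set.inter_subset_inter_left _ Set.inter_subset_right
  have hVb : IsOpen (V ∩ Metric.ball t ρ) := hV.inter Metric.isOpen_ball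
  obtain ⟨u, hu, huy⟩ := IsSolutionOn.exists_extension hρ hV (Set.disjoint_left.2 hVS)
    (fun w hw a ha0 ha1 => ⟨starDomain_star w hw.1 a ha0 ha1, slitPlaneAt_star w hw.2 a ha0 ha1⟩)
    (hy.mono hVsub)
  have hFd := differentiableOn_iteratedDeriv hV hu.1 M
  set F := iteratedDeriv M u with hFdef
  have hFform : HasSingularForm t ρ (V ∩ Metric.ball t ρ) ℓ P F := by
    obtain ⟨c, B, ψ, h1, h2, h3, h4, h5, h6⟩ := hsing
    refine ⟨c, B, ψ, h1, h2, h3, h4, h5, fun w hw => ?_⟩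
    rw [← h6 w (hVsub hw)]
    exact (huy.eventuallyEq_of_mem (hVb.mem_nhds hw)).iteratedDeriv_eq M
  set K' := {z ∈ K | ‖z - t‖ ≤ 2 * ((z - t) / α).re} with hK'
  have hK'c : IsCompact K' := hK.inter_right (isClosed_le (by fun_prop)
    (continuous_const.mul (Complex.continuous_re.comp (by fun_prop))))
  -- The closed disc about `z` through `t` meets the complement of `V` at most in `t`, so `t` is the
  -- only obstruction to bounding the continued solution.
  have hmem : ∀ z ∈ K', ∀ w, ‖w - z‖ ≤ ‖z - t‖ → w ≠ t → w ∈ V := fun z hz w hw hwt =>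
    ⟨closedBall_subset_starDomain le_rfl (hKU hz.1) (mem_closedBall_iff_norm.2 hw),
      mem_slitPlaneAt_of_norm_sub_le hα hz.2 hw hwt⟩
  have hfar : ∀ f : ℂ → ℂ, ContinuousOn f V → ∀ ρ' > 0, ∃ C, ∀ z ∈ K',
      ∀ w ∈ Metric.ball z ‖z - t‖, ρ' ≤ ‖w - t‖ → ‖f w‖ ≤ C := by
    intro f hf ρ' hρ'
    have hT : IsCompact ({w | ∃ z ∈ K', ‖w - z‖ ≤ ‖z - t‖} ∩ {w | ρ' ≤ ‖w - t‖}) :=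
      (isCompact_biUnion_closedBall hK'c (by fun_prop) fun z => norm_nonneg (z - t)).inter_right
        (isClosed_le continuous_const (by fun_prop))
    have hTV : {w | ∃ z ∈ K', ‖w - z‖ ≤ ‖z - t‖} ∩ {w | ρ' ≤ ‖w - t‖} ⊆ V := by
      rintro w ⟨⟨z, hz, hw⟩, hρw⟩
      refine hmem z hz w hw ?_
      rintro rfl
      have : ρ' ≤ ‖w - w‖ := hρw
      rw [sub_self, norm_zero] at this
      exact absurd hρ' (not_lt.2 this)
    obtain ⟨C, hC⟩ := hT.exists_bound_of_continuousOn (hf.mono hTV)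
    exact ⟨C, fun z hz w hw hρw => hC w ⟨⟨z, hz, (mem_ball_iff_norm.1 hw).le⟩, hρw⟩⟩
  set A := {z ∈ K' | z ≠ t} with hA
  have hball : ∀ z ∈ A, Metric.ball z ‖z - t‖ ⊆ V := fun z hz w hw => by
    refine hmem z hz.1 w (mem_ball_iff_norm.1 hw).le ?_
    rintro rfl
    rw [mem_ball_iff_norm, norm_sub_rev] at hw
    exact lt_irrefl _ hw
  have hAV : A ⊆ V := fun z hz => hmem z hz.1 z (by simp) hz.2
  obtain ⟨R₀, hR₀⟩ := hK.exists_bound_of_continuousOn (f := fun z => z - t) (by fun_prop)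
  set R := max R₀ 1 with hR
  have hAR : ∀ z ∈ A, ‖z - t‖ ≤ R := fun z hz => (hR₀ z hz.1.1).trans (le_max_left _ _)
  obtain ⟨C₁, hC₁⟩ := hfar u hu.1.continuousOn ρ hρ
  obtain ⟨C', hC'0, hC'⟩ := exists_norm_add_norm_deriv_le hu.1 hσ
    (fun w hw hwρ => by
      have hwb : w ∈ V ∩ Metric.ball t ρ := ⟨hw, mem_ball_iff_norm.2 hwρ⟩
      rw [huy hwb]
      exact hyC w (hVsub hwb))
    (fun z hz => hz.2) (le_max_right R₀ 1) hAR hball fun z hz => hC₁ z hz.1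
  obtain ⟨c, hc, hev⟩ := hFform.exists_le_norm_iteratedDeriv hρ (hℓ.mono hV Set.inter_subset_right)
    hP hFd hAV hAR hball fun ρ' hρ' =>
      let ⟨C, hC⟩ := hfar F hFd.continuousOn ρ' hρ'
      ⟨C, fun z hz => hC z hz.1⟩
  have hR1 : 0 < R := one_pos.trans_le (le_max_right R₀ 1)
  refine ⟨c / ((C' + 1) * R ^ P.re), by positivity, ⌈σ⌉₊ + 1, ?_⟩
  filter_upwards [hev] with n hn z hzK hzt hzα
  have hzA : z ∈ A := ⟨⟨hzK, hzα⟩, hzt⟩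
  have hit : iteratedDeriv n F z = iteratedDeriv (n + M) u z := by
    rw [hFdef, iteratedDeriv_eq_iterate, iteratedDeriv_eq_iterate, iteratedDeriv_eq_iterate,
      Function.iterate_add_apply]
  have h1 := hn z hzA
  have h2 := hu.norm_iteratedDeriv_le hV (n + M) (hAV hzA) (hVS z (hAV hzA))
  rw [hit] at h1
  have h3 : ‖z - t‖ ^ P.re ≤ R ^ P.re :=
    Real.rpow_le_rpow (norm_nonneg _) (hAR z hzA) (by linarith)
  have hq : 0 ≤ coeffNorm q₀ q₁ (n + M) z := Real.sqrt_nonneg _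
  rw [div_mul_eq_mul_div, div_mul_eq_mul_div, div_le_iff₀ (by positivity)]
  calc c * n.factorial * ‖z - t‖ ^ (⌈σ⌉₊ + 1)
      ≤ (coeffNorm q₀ q₁ (n + M) z * (‖u z‖ + ‖deriv u z‖) * ‖z - t‖ ^ n * R ^ P.re) *
        ‖z - t‖ ^ (⌈σ⌉₊ + 1) := by
        refine mul_le_mul_of_nonneg_right (h1.trans ?_) (by positivity)
        gcongr
    _ = coeffNorm q₀ q₁ (n + M) z * ‖z - t‖ ^ n * (((‖u z‖ + ‖deriv u z‖) *
        ‖z - t‖ ^ (⌈σ⌉₊ + 1)) * R ^ P.re) := by ring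
    _ ≤ coeffNorm q₀ q₁ (n + M) z * ‖z - t‖ ^ n * ((C' + 1) * R ^ P.re) := by
        gcongr
        linarith [hC' z hzA]

end Perron

/-! ### Comparison of the two growth rates -/

namespace Perron

variable {q₀ q₁ : RatFunc ℂ} {t : ℂ}

/-- Derivatives of a function `y` that is holomorphic on a disc larger than that through `t` are
small compared with coefficients that grow as the derivatives of a function singular at `t`. -/
theorem eventually_norm_iteratedDeriv_le {K : Set ℂ} {s : ℂ → Prop} {y : ℂ → ℂ} {Y : ℂ → ℝ}
    {η R C c d ε : ℝ} {B m M : ℕ} (hη : 0 < η) (hR : 0 ≤ R) (hKR : ∀ z ∈ K, ‖z - t‖ ≤ R)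
    (hC : 0 ≤ C) (hc : 0 < c) (hd : 0 < d) (hε : 0 < ε)
    (hup : ∀ z ∈ K, ∀ n : ℕ, ‖iteratedDeriv n y z‖ * (‖z - t‖ + η) ^ n ≤ C * n.factorial)
    (hY : ∀ z ∈ K, z ≠ t → d * ‖z - t‖ ^ m ≤ Y z)
    (hlow : ∀ᶠ n : ℕ in atTop, ∀ z ∈ K, z ≠ t → s z →
      c * n.factorial * ‖z - t‖ ^ B ≤ coeffNorm q₀ q₁ (n + M) z * ‖z - t‖ ^ n) :
    ∀ᶠ n : ℕ in atTop, ∀ z ∈ K, z ≠ t → s z → 0 < coeffNorm q₀ q₁ n z ∧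
      ‖iteratedDeriv n y z‖ ≤ ε * (coeffNorm q₀ q₁ n z * Y z) := by
  rw [← Filter.map_add_atTop_eq_nat M, eventually_map]
  -- The exponent `B + m` collects the losses at `t` in the lower bounds for the coefficients and
  -- for `(y, y')`.
  filter_upwards [hlow, eventually_factorial_mul_pow_le hη hR hC
    (show 0 < ε * (c * d) by positivity) M (B + m)] with n h1 h2 z hz hzt hzs
  have hr : 0 < ‖z - t‖ := norm_pos_iff.2 (sub_ne_zero.2 hzt)
  have h3 := h1 z hz hzt hzs
  have hq : 0 < coeffNorm q₀ q₁ (n + M) z :=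
    pos_of_mul_pos_left ((by positivity : 0 < c * n.factorial * ‖z - t‖ ^ B).trans_le h3)
      (by positivity)
  refine ⟨hq, ?_⟩
  have h4 := hY z hz hzt
  have hpos : 0 < (‖z - t‖ + η) ^ (n + M) * ‖z - t‖ ^ n := by positivity
  refine le_of_mul_le_mul_right ?_ hpos
  calc ‖iteratedDeriv (n + M) y z‖ * ((‖z - t‖ + η) ^ (n + M) * ‖z - t‖ ^ n)
      = ‖iteratedDeriv (n + M) y z‖ * (‖z - t‖ + η) ^ (n + M) * ‖z - t‖ ^ n := by ring
    _ ≤ C * (n + M).factorial * ‖z - t‖ ^ n := by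
        exact mul_le_mul_of_nonneg_right (hup z hz _) (by positivity)
    _ ≤ ε * (c * d) * n.factorial * ‖z - t‖ ^ (B + m) * (‖z - t‖ + η) ^ (n + M) :=
        h2 _ hr.le (hKR z hz)
    _ = ε * (‖z - t‖ + η) ^ (n + M) * ((c * n.factorial * ‖z - t‖ ^ B) * (d * ‖z - t‖ ^ m)) := by
        ring
    _ ≤ ε * (‖z - t‖ + η) ^ (n + M) * ((coeffNorm q₀ q₁ (n + M) z * ‖z - t‖ ^ n) * Y z) := by
        gcongr
    _ = _ := by ring

/-- The solution that is holomorphic at `t`, on the star-shaped domain of `t`, and the convergence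
of the quotients of the coefficients on the Voronoi cell of `t`. -/
theorem exists_holomorphic_solution (hF : IsFuchsian q₀ q₁) (hG : IsGeneric q₀ q₁)
    (ht : t ∈ singularSet q₀ q₁) :
    ∃ y₂ : ℂ → ℂ, IsSolutionOn q₀ q₁ (voronoiCell (singularSet q₀ q₁) t) y₂ ∧
      (∃ z ∈ voronoiCell (singularSet q₀ q₁) t, y₂ z ≠ 0) ∧
      (∀ y : ℂ → ℂ, IsSolutionOn q₀ q₁ (voronoiCell (singularSet q₀ q₁) t) y →
        ∃ c : ℂ, ∀ z ∈ voronoiCell (singularSet q₀ q₁) t, y z = c * y₂ z) ∧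
      (∀ᶠ n in atTop, (derivCoeff q₀ q₁ n).2 ≠ 0) ∧
      ConvergesOnCompacts (fun n => (derivCoeff q₀ q₁ n).1 / (derivCoeff q₀ q₁ n).2)
        (fun z => -(deriv y₂ z / y₂ z)) {z | y₂ z = 0} (voronoiCell (singularSet q₀ q₁) t) := by
  obtain ⟨R, hR, hRS, g, G, m, hg, hGd, hG0, hgG, huniq⟩ := exists_local_solution hG ht
  have hfin := finite_singularSet q₀ q₁
  set W := starDomain (singularSet q₀ q₁) t with hW
  set U := voronoiCell (singularSet q₀ q₁) t with hU
  have hWo : IsOpen W := isOpen_starDomain hfin t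
  have hUo : IsOpen U := isOpen_voronoiCell hfin t
  have hUW : U ⊆ W := voronoiCell_subset_starDomain
  have htU : t ∈ U := self_mem_voronoiCell
  have hWS : ∀ z ∈ W, z ≠ t → z ∉ singularSet q₀ q₁ := fun z hz => notMem_of_mem_starDomain hz
  obtain ⟨y₂, hy₂, hy₂g⟩ := hg.exists_extension_of_star hR hWo hWS starDomain_star
  have hUconn : IsPreconnected U := isPreconnected_of_star htU voronoiCell_star
  have hWconn : IsPreconnected W := isPreconnected_of_star (hUW htU) starDomain_star
  obtain ⟨δ, hδ, hδU⟩ := Metric.isOpen_iff.1 hUo t htU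
  set ρ := min δ R with hρdef
  have hρ : 0 < ρ := lt_min hδ hR
  have hρU : Metric.ball t ρ ⊆ U := (Metric.ball_subset_ball (min_le_left _ _)).trans hδU
  have hρR : Metric.ball t ρ ⊆ Metric.ball t R := Metric.ball_subset_ball (min_le_right _ _)
  have hyG : ∀ᶠ z in 𝓝 t, y₂ z = (z - t) ^ m * G z := by
    filter_upwards [Metric.ball_mem_nhds t hR] with z hz
    rw [hy₂g hz, hgG z hz]
  have htR : t ∈ Metric.ball t R := Metric.mem_ball_self hR
  have hGan : AnalyticAt ℂ G t := hGd.analyticAt (Metric.isOpen_ball.mem_nhds htR)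
  have hnz : ∀ z ∈ Metric.ball t ρ, z ≠ t → y₂ z ≠ 0 := fun z hz hzt => by
    rw [hy₂g (hρR hz), hgG z (hρR hz)]
    exact mul_ne_zero (pow_ne_zero _ (sub_ne_zero.2 hzt)) (hG0 z (hρR hz))
  obtain ⟨p, hp, hpt⟩ : ∃ p ∈ Metric.ball t ρ, p ≠ t := by
    refine ⟨t + ((ρ / 2 : ℝ) : ℂ), slitDisc_subset_ball t ρ (add_half_mem_slitDisc t hρ), ?_⟩
    have : ((ρ / 2 : ℝ) : ℂ) ≠ 0 := by exact_mod_cast (half_pos hρ).ne'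
    simpa using this
  -- A common zero at a regular point would make `y₂` vanish on the connected set `W`.
  have hy0 : ∀ z ∈ W, z ≠ t → y₂ z ≠ 0 ∨ deriv y₂ z ≠ 0 := by
    intro z hz hzt
    by_contra! hcon
    have h := hy₂.eventually_eq_zero hWo hz (hWS z hz hzt) hcon.1 hcon.2
    exact hnz p hp hpt
      (eqOn_of_eventuallyEq hWo hWconn hy₂.1 (differentiableOn_const 0) hz h (hUW (hρU hp)))
  have hUsol := hy₂.mono hUW
  refine ⟨y₂, hUsol, ⟨p, hρU hp, hnz p hp hpt⟩, fun y hy => ?_, ?_⟩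
  · obtain ⟨c, hc⟩ := huniq ρ hρ (min_le_right _ _) y (hy.mono hρU)
    refine ⟨c, eqOn_of_eventuallyEq hUo hUconn hy.1 (hUsol.1.const_mul c) htU ?_⟩
    filter_upwards [Metric.ball_mem_nhds t hρ] with z hz
    rw [hc z hz, hy₂g (hρR hz)]
  · refine converges_of_iteratedDeriv_small hUo htU (fun z hz => hWS z (hUW hz)) hUsol
      (fun z hz => hy0 z (hUW hz)) hGan (hG0 t htR) hyG fun K hKU hK ε hε => ?_
    obtain ⟨η, hη, hgap⟩ := exists_uniform_gap hfin hK hKU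
    obtain ⟨C, hC, hup⟩ := exists_norm_iteratedDeriv_le hy₂.1 hK hη fun z hz =>
      closedBall_subset_starDomain (le_add_of_nonneg_right hη.le) (hgap z hz)
    obtain ⟨d, hd, hY⟩ := exists_le_sqrt_norm_sq hK (hUsol.1.continuousOn.mono hKU)
      ((hUsol.1.deriv hUo).continuousOn.mono hKU) (fun z hz => hy0 z (hUW (hKU hz)))
      hGan.continuousAt (hG0 t htR) hyG
    obtain ⟨R₀, hR₀⟩ := hK.exists_bound_of_continuousOn (f := fun z => z - t) (by fun_prop)
    have hdir : ∀ α ∈ ({1, -1, Complex.I, -Complex.I} : Set ℂ), ∀ᶠ n : ℕ in atTop, ∀ z ∈ K, z ≠ t →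
        ‖z - t‖ ≤ 2 * ((z - t) / α).re → 0 < coeffNorm q₀ q₁ n z ∧ ‖iteratedDeriv n y₂ z‖ ≤
          ε * (coeffNorm q₀ q₁ n z * √(‖deriv y₂ z‖ ^ 2 + ‖y₂ z‖ ^ 2)) := by
      intro α hα
      have hα1 : ‖α‖ = 1 := by
        rcases hα with rfl | rfl | rfl | rfl <;> simp
      have hα0 : α ≠ 0 := norm_ne_zero_iff.1 (hα1 ▸ one_ne_zero)
      obtain ⟨ρ', hρ', ℓ, y, M, P, hℓ, hy, ⟨C', σ, hσ, hyC⟩, hP, hsing⟩ :=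
        exists_singular_solution hF ht hR hRS hg hGd hG0 hgG huniq hα0
      obtain ⟨c, hc, B, hlow⟩ := exists_le_coeffNorm hfin hK hKU hα1 hρ' hℓ hy hσ hyC hP hsing
      exact eventually_norm_iteratedDeriv_le hη (le_max_right R₀ 0)
        (fun z hz => (hR₀ z hz).trans (le_max_left _ _)) hC hc hd hε hup hY hlow
    filter_upwards [(Filter.eventually_all_finite (Set.toFinite _)).2 hdir] with n hn z hz hzt
    obtain ⟨α, hα, hzα⟩ := exists_direction (z - t)
    exact hn α hα z hz hzt hzα

end Perron

theorem theorem4 (q₀ q₁ : RatFunc ℂ) (hF : Perron.IsFuchsian q₀ q₁)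
    (hG : Perron.IsGeneric q₀ q₁) (t : ℂ) (ht : t ∈ Perron.singularSet q₀ q₁)
    (U : Set ℂ) (hU : U = Perron.voronoiCell (Perron.singularSet q₀ q₁) t) :
    ∃ y₂ : ℂ → ℂ,
      Perron.IsSolutionOn q₀ q₁ U y₂ ∧
      (∃ z ∈ U, y₂ z ≠ 0) ∧
      (∀ y : ℂ → ℂ, Perron.IsSolutionOn q₀ q₁ U y → ∃ c : ℂ, ∀ z ∈ U, y z = c * y₂ z) ∧
      (∀ᶠ n in atTop, (Perron.derivCoeff q₀ q₁ n).2 ≠ 0) ∧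
      Perron.ConvergesOnCompacts
        (fun n => (Perron.derivCoeff q₀ q₁ n).1 / (Perron.derivCoeff q₀ q₁ n).2)
        (fun z => -(deriv y₂ z / y₂ z)) {z | y₂ z = 0} U ∧
      (∀ a₁ a₂ : ℕ → RatFunc ℂ, Perron.IsRecurrence q₀ q₁ a₁ a₂ →
        (∀ n : ℕ, (Perron.perronFraction a₁ a₂).convs n =
          -((Perron.derivCoeff q₀ q₁ (n + 1)).1 / (Perron.derivCoeff q₀ q₁ (n + 1)).2)) ∧
        Perron.ConvergesOnCompacts (fun n => (Perron.perronFraction a₁ a₂).convs n)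
          (fun z => deriv y₂ z / y₂ z) {z | y₂ z = 0} U) := by
  subst hU
  obtain ⟨y₂, hy, hne, huniq, hq, hconv⟩ := Perron.exists_holomorphic_solution hF hG ht
  refine ⟨y₂, hy, hne, huniq, hq, hconv, fun a₁ a₂ h => ⟨h.convs_perronFraction, ?_⟩⟩
  have hUo := Perron.isOpen_voronoiCell (Perron.finite_singularSet q₀ q₁) t
  have hcont : ContinuousOn (fun z => -(deriv y₂ z / y₂ z))
      (Perron.voronoiCell (Perron.singularSet q₀ q₁) t \ {z | y₂ z = 0}) :=
    (((hy.1.deriv hUo).continuousOn.mono Set.sdiff_subset).div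
      (hy.1.continuousOn.mono Set.sdiff_subset) fun z hz => hz.2).neg
  have h2 := hconv.neg_shift hcont
  simp only [neg_neg] at h2
  simpa only [h.convs_perronFraction] using h2
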